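/- Let $G$ be a topological group acting continuously on a locally connected space $Y$, let $X=Y/G$ be the orbit space and $\pi:Y\to X$ the projection. $X$ is regarded as a (global) orbispace: its basic open sets are all connected open subsets $U$ of $X$, each equipped with a fixed choice of a connected component $\widehat U$ of $\pi^{-1}(U)$ and with the group $G_U=\{g\in G: g\widehat U=\widehat U\}$; a transition map in $Tran(U,V)$ is the restriction of some $g\in G$ to a component $W$ of $\widehat U\cap\pi^{-1}(V)$ with $gW\subset\widehat V$ (topologized as a disjoint union over $W$ of subspaces of $G$). A base-point structure $\underline o=(o,U_o,\hat o)$ is a basic open set $U_o$ and a point $\hat o\in\widehat{U_o}$, $o=\pi(\hat o)$. The based loop space $\Omega(X,\underline o)$ is the set of equivalence classes of based systems $(\{I_i\},\{U_i\},\{f_i\},\{\rho_{ji}\})$ on the circle $S^1=[0,1]/\{0\sim 1\}$, $*=0$: a cyclic chain of open intervals $I_0\ni *,I_1,\dots,I_n$ covering $S^1$, basic open sets $U_i$ with $U_0=U_o$, continuous maps $f_i:I_i\to\widehat{U_i}$ with $f_0(*)=\hat o$, and transition maps $\rho_{ji}\in Tran(U_i,U_j)$ for consecutive intervals with $f_j=\rho_{ji}\circ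 f_i$ on $I_i\cap I_j$; two systems are equivalent if they have isomorphic refinements, where isomorphisms and refinements are the identity on $U_o$ at the base point. It carries the compact-open topology, generated by the sets of the classes of those systems with given $U_i$ for which $K_i\subset I_i$, $f_i(K_i)\subset V_i$, $\rho_{ji}\in A_{ji}$, for compact $K_i$ and open $V_i$, $A_{ji}$. Its base point $\tilde o$ is the class of the constant system, and loops are multiplied by concatenation. For $k\ge 1$ put $\pi_k(X,\underline o)=\pi_{k-1}(\Omega(X,\underline o),\tilde o)$; for $k=1$ its product is induced by concatenation of based loops. Let $EG$ be Milnor's space of all $\langle g,t\rangle=(t_0g_0,t_1g_1,\dots)$ with $g_i\in G$, $t_i\in[0,1]$, only finitely many $t_i\ne0$, $\sum t_i=1$, where $\langle g,t\rangle=\langle g',t'\rangle$ iff $t=t'$ and $g_i=g_i'$ whenever $t_i>0$, with the coarsest topology making all $t_i:EG\to[0,1]$ and $g_i:t_i^{-1}(0,1]\to G$ continuous. Let $Y_G=EG\times_GY$ be the Borel space, the quotient of $EG\times Y$ by $(\langle gh,t\rangle,y)\sim(\langle g,t\rangle,hy)$, with base point $\check o=[((1\cdot 1_G,0,0,\dots),\hat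 o)]$. Theorem. There are group isomorphisms $\theta_k^X:\pi_k(X,\underline o)\to\pi_k(Y_G,\check o)$ for all $k\ge1$ and all such $(Y,G)$ and $\underline o$, which are natural: let $\rho:G\to G'$ be a continuous homomorphism and $f:Y\to Y'$ a continuous $\rho$-equivariant map with $f(\hat o)=\hat o'$ such that the induced map $X\to X'$ takes $U_o$ into $U'_{o}$. Then $(f,\rho)$ defines a morphism of based orbispaces $X\to X'$, composition with it is a continuous map $\Omega(X,\underline o)\to\Omega(X',\underline o')$, and $$\theta_k^{X'}\circ(f,\rho)_\#=(f,\rho)_*\circ\theta_k^X\qquad(k\ge1),$$ where $(f,\rho)_\#:\pi_k(X,\underline o)\to\pi_k(X',\underline o')$ is induced by that map of loop spaces and $(f,\rho)_*:\pi_k(Y_G,\check o)\to\pi_k(Y'_{G'},\check o')$ by $[\langle g,t\rangle,y]\mapsto[\langle\rho(g),t\rangle,f(y)]$. -/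

import Mathlib

open Set Topology

universe u v

noncomputable section

/-! ### Locally connected `G`-spaces and their global orbispaces -/

/-- A locally connected `G`-space `(Y, G)`: a topological group `G` acting continuously on a
locally connected space `Y`. -/
structure GSpace : Type (max (u + 1) (v + 1)) where
  G : Type u
  Y : Type v
  [group : Group G]
  [topG : TopologicalSpace G]
  [topGroup : IsTopologicalGroup G]
  [topY : TopologicalSpace Y]
  [locConn : LocallyConnectedSpace Y]
  [act : MulAction G Y]
  [contAct : ContinuousSMul G Y]

attribute [instance] GSpace.group GSpace.topG GSpace.topGroup GSpace.topY GSpace.locConn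
  GSpace.act GSpace.contAct

namespace GSpace


/-- The orbit space `X = Y/G`, with the quotient topology. -/
abbrev Orbits (A : GSpace.{u, v}) : Type v := Quotient (MulAction.orbitRel A.G A.Y)

/-- The projection `π : Y → Y/G`. -/
def proj (A : GSpace.{u, v}) (y : A.Y) : A.Orbits := Quotient.mk _ y

/-- The basic open sets of the orbispace `Y/G`: all connected open subsets of `Y/G`. -/
structure BasicOpen (A : GSpace.{u, v}) where
  carrier : Set A.Orbits
  isOpen : IsOpen carrier
  isConnected : IsConnected carrier

/-- The inverse image `π⁻¹(U) ⊆ Y` of a basic open set. -/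
def preim (A : GSpace.{u, v}) (U : A.BasicOpen) : Set A.Y := A.proj ⁻¹' U.carrier

end GSpace

/-- The global orbispace `X = Y/G` of a locally connected `G`-space. The basic open sets are all
connected open subsets `U` of `Y/G`. The `G`-structure `(Û, G_U, π_U)` of `U` is a fixed choice of
an induced one: `Û = hat U` is a connected component of `π⁻¹(U)`, the group `G_U` is the subgroup
of all `g` with `g • Û = Û`, and `π_U` is the restriction of `π`. -/
structure GlobalOrbispace extends GSpace where
  hat : toGSpace.BasicOpen → Set Y
  hat_component : ∀ U, ∃ y ∈ toGSpace.preim U, hat U = connectedComponentIn (toGSpace.preim U) y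

/-- A pair `(g, W)` of a group element and a subset of `Y`, thought of as the map
`W → Y, y ↦ g • y` together with the conjugation by `g`. -/
@[ext] structure Transition (G Y : Type*) where
  elt : G
  dom : Set Y

/-- The disjoint union topology: one copy of the topological group `G` for every domain. -/
instance Transition.instTopologicalSpace {G Y : Type*} [TopologicalSpace G] :
    TopologicalSpace (Transition G Y) :=
  TopologicalSpace.induced Transition.elt inferInstance ⊓
    TopologicalSpace.induced Transition.dom ⊥

namespace GlobalOrbispace


/-- The group `G_U = {g | g • Û = Û}` of the `G`-structure of `U`. -/
def structGroup (A : GlobalOrbispace.{u, v}) (U : A.BasicOpen) : Set A.G :=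
  {g | (fun y => g • y) '' A.hat U = A.hat U}

/-- The set `Tran(U, V)` of transition maps. A transition map is the restriction of an element
`g` of `G` to a component `W` of `Û ∩ π⁻¹(V)` (these are the spaces of the induced `G`-structures
of the components of `U ∩ V`) such that `g • W ⊆ V̂`; as `g • W` is a connected subset of `π⁻¹(V)`,
it suffices that `g` takes one point of `W` into the component `V̂`. Transition maps are told apart
by `g` and by the domain `W`, also when the action is not effective. -/
def Tran (A : GlobalOrbispace.{u, v}) (U V : A.BasicOpen) : Set (Transition A.G A.Y) :=
  {τ | ∃ y ∈ A.hat U, τ.elt • y ∈ A.hat V ∧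
    τ.dom = connectedComponentIn (A.hat U ∩ A.preim V) y}

end GlobalOrbispace

/-- A global orbispace with a base-point structure `(o, U_o, ô)`: a basic open set `U_o` and a
point `ô ∈ Û_o`, lying over `o = π(ô) ∈ U_o`. -/
structure BasedGlobalOrbispace extends GlobalOrbispace where
  baseOpen : toGSpace.BasicOpen
  basePt : Y
  basePt_mem : basePt ∈ hat baseOpen

namespace GSpace


variable (A : GSpace.{u, v})

theorem proj_smul (g : A.G) (y : A.Y) : A.proj (g • y) = A.proj y :=
  Quotient.sound (MulAction.mem_orbit y g)

theorem exists_smul_of_proj_eq {y z : A.Y} (h : A.proj y = A.proj z) : ∃ g : A.G, g • z = y := by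
  have := Quotient.exact h
  exact this

theorem isOpenQuotientMap_proj : IsOpenQuotientMap A.proj :=
  MulAction.isOpenQuotientMap_quotientMk

theorem smul_mem_preim {U : A.BasicOpen} {y : A.Y} (g : A.G) :
    g • y ∈ A.preim U ↔ y ∈ A.preim U := by
  simp [preim, proj_smul]

theorem isOpen_preim (U : A.BasicOpen) : IsOpen (A.preim U) :=
  U.isOpen.preimage A.isOpenQuotientMap_proj.continuous

end GSpace

namespace GlobalOrbispace


variable (A : GlobalOrbispace.{u, v})

theorem hat_subset (U : A.BasicOpen) : A.hat U ⊆ A.preim U := by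
  obtain ⟨y, -, h⟩ := A.hat_component U
  rw [h]; exact connectedComponentIn_subset _ _

theorem hat_isPreconnected (U : A.BasicOpen) : IsPreconnected (A.hat U) := by
  obtain ⟨y, -, h⟩ := A.hat_component U
  rw [h]; exact isPreconnected_connectedComponentIn

theorem hat_isOpen (U : A.BasicOpen) : IsOpen (A.hat U) := by
  obtain ⟨y, -, h⟩ := A.hat_component U
  rw [h]; exact (A.isOpen_preim U).connectedComponentIn

theorem hat_nonempty (U : A.BasicOpen) : (A.hat U).Nonempty := by
  obtain ⟨y, hy, h⟩ := A.hat_component U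
  rw [h]; exact ⟨y, mem_connectedComponentIn hy⟩

theorem hat_eq {U : A.BasicOpen} {y : A.Y} (hy : y ∈ A.hat U) :
    A.hat U = connectedComponentIn (A.preim U) y := by
  obtain ⟨z, -, h⟩ := A.hat_component U
  rw [h] at hy ⊢
  exact connectedComponentIn_eq hy

theorem subset_hat {U : A.BasicOpen} {S : Set A.Y} (hS : IsPreconnected S) (hSU : S ⊆ A.preim U)
    {y : A.Y} (hyS : y ∈ S) (hy : y ∈ A.hat U) : S ⊆ A.hat U := by
  rw [A.hat_eq hy]; exact hS.subset_connectedComponentIn hyS hSU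

theorem smul_mem_hat {U : A.BasicOpen} {g : A.G} {y z : A.Y} (hy : y ∈ A.hat U)
    (hgy : g • y ∈ A.hat U) (hz : z ∈ A.hat U) : g • z ∈ A.hat U := by
  refine A.subset_hat (S := (fun y => g • y) '' A.hat U)
    ((A.hat_isPreconnected U).image _ (continuous_const_smul g).continuousOn) ?_
    (mem_image_of_mem _ hy) hgy (mem_image_of_mem _ hz)
  rintro _ ⟨w, hw, rfl⟩
  exact (A.smul_mem_preim g).2 (A.hat_subset U hw)

theorem mem_structGroup {U : A.BasicOpen} {g : A.G} {y : A.Y} (hy : y ∈ A.hat U)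
    (hgy : g • y ∈ A.hat U) : g ∈ A.structGroup U := by
  refine Subset.antisymm ?_ fun z hz => ?_
  · rintro _ ⟨w, hw, rfl⟩
    exact A.smul_mem_hat hy hgy hw
  · exact ⟨g⁻¹ • z, A.smul_mem_hat hgy (by simpa using hy) hz, by simp⟩

theorem smul_mem_of_structGroup {U : A.BasicOpen} {g : A.G} (hg : g ∈ A.structGroup U) {y : A.Y}
    (hy : y ∈ A.hat U) : g • y ∈ A.hat U := by
  have h : (fun y => g • y) '' A.hat U = A.hat U := hg
  rw [← h]; exact mem_image_of_mem _ hy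

/-- The map `π_U : Û → U` is onto. -/
theorem exists_mem_hat {U : A.BasicOpen} {z : A.Y} (hz : z ∈ A.preim U) :
    ∃ g : A.G, g • z ∈ A.hat U := by
  have key : U.carrier ⊆ A.proj '' A.hat U := by
    refine U.isConnected.isPreconnected.subset_of_closure_inter_subset
      (A.isOpenQuotientMap_proj.isOpenMap _ (A.hat_isOpen U)) ?_ ?_
    · obtain ⟨y, hy⟩ := A.hat_nonempty U
      exact ⟨A.proj y, A.hat_subset U hy, mem_image_of_mem _ hy⟩
    · rintro p ⟨hp, hpU⟩
      obtain ⟨w, rfl⟩ := A.isOpenQuotientMap_proj.surjective p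
      have hw : w ∈ A.preim U := hpU
      have hop : IsOpen (A.proj '' connectedComponentIn (A.preim U) w) :=
        A.isOpenQuotientMap_proj.isOpenMap _ (A.isOpen_preim U).connectedComponentIn
      obtain ⟨_, ⟨c, hc, rfl⟩, ⟨y, hy, hyc⟩⟩ := mem_closure_iff.1 hp _ hop
        (mem_image_of_mem _ (mem_connectedComponentIn hw))
      obtain ⟨g, rfl⟩ := A.exists_smul_of_proj_eq hyc
      refine ⟨g • w, ?_, A.proj_smul g w⟩
      refine A.subset_hat (S := (fun y => g • y) '' connectedComponentIn (A.preim U) w)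
        (isPreconnected_connectedComponentIn.image _ (continuous_const_smul g).continuousOn) ?_
        (mem_image_of_mem _ hc) hy (mem_image_of_mem _ (mem_connectedComponentIn hw))
      rintro _ ⟨x, hx, rfl⟩
      exact (A.smul_mem_preim g).2 (connectedComponentIn_subset _ _ hx)
  obtain ⟨y, hy, hyz⟩ := key hz
  obtain ⟨g, rfl⟩ := A.exists_smul_of_proj_eq hyz
  exact ⟨g, hy⟩

/-- The identity of `Û`, as an element of `Tran(U, U)`. -/
theorem id_mem_Tran (U : A.BasicOpen) : (⟨1, A.hat U⟩ : Transition A.G A.Y) ∈ A.Tran U U := by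
  obtain ⟨y, hy⟩ := A.hat_nonempty U
  refine ⟨y, hy, by simpa using hy, ?_⟩
  have h : A.hat U ∩ A.preim U = A.hat U := inter_eq_left.2 (A.hat_subset U)
  rw [h]
  exact ((A.hat_isPreconnected U).connectedComponentIn hy).symm

end GlobalOrbispace

/-! ### Based loops in a global orbispace -/

/-- A based system of maps from `(S¹, *)` into a based global orbispace, where `S¹ = ℝ/ℤ` and
`* = 0`. The circle is covered by a cyclic chain of `N ≥ 3` open arcs, numbered in the positive
direction. The arc number `i` is given by its lift `(a i, b i)` to the line; `*` lies on the arc `0`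
only; consecutive arcs overlap, others do not. The index `N` stands for the arc `0` again, lifted
one turn further, and only the values of `a, b, U, f` at indices `≤ N` and of `ρ` at indices `< N`
matter. Arc `i` carries a basic open set `U i`, with `U 0 = U_o`, and a continuous map `f i` into
`Û_i`, with `f 0 * = ô`; and for every two consecutive arcs a transition map
`ρ i ∈ Tran(U i, U (i+1))` is given with `f (i+1) = ρ i ∘ f i` on the overlap. -/
structure LoopSystem (A : BasedGlobalOrbispace) where
  N : ℕ
  three_le : 3 ≤ N
  a : ℕ → ℝ
  b : ℕ → ℝ
  a_zero : a 0 < 0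
  b_zero : 0 < b 0
  a_one : 0 ≤ a 1
  b_pred : b (N - 1) ≤ 1
  a_last : a N = a 0 + 1
  b_last : b N = b 0 + 1
  overlap : ∀ i < N, a (i + 1) < b i
  separate : ∀ i, i + 2 ≤ N → b i ≤ a (i + 2)
  U : ℕ → A.BasicOpen
  U_zero : U 0 = A.baseOpen
  U_last : U N = A.baseOpen
  f : ℕ → ℝ → A.Y
  f_cont : ∀ i ≤ N, ContinuousOn (f i) (Ioo (a i) (b i))
  f_mem : ∀ i ≤ N, ∀ x ∈ Ioo (a i) (b i), f i x ∈ A.hat (U i)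
  f_last : ∀ x ∈ Ioo (a 0) (b 0), f N (x + 1) = f 0 x
  f_base : f 0 0 = A.basePt
  ρ : ℕ → Transition A.G A.Y
  ρ_mem : ∀ i < N, ρ i ∈ A.Tran (U i) (U (i + 1))
  compat : ∀ i < N, ∀ x ∈ Ioo (a (i + 1)) (b i),
    f i x ∈ (ρ i).dom ∧ f (i + 1) x = (ρ i).elt • f i x

namespace LoopSystem


variable {A : BasedGlobalOrbispace.{u, v}}

/-- The (lifted) arc number `i`. -/
def arc (s : LoopSystem A) (i : ℕ) : Set ℝ := Ioo (s.a i) (s.b i)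

/-- Two systems over the same arcs and the same basic open sets are isomorphic if they differ by
automorphisms `δ i ∈ G_{U i}` with `δ = 1` at the base point: `f' i = δ i ∘ f i` and
`ρ' i = δ (i+1) ∘ ρ i ∘ (δ i)⁻¹`. (The domains of the transition maps then correspond
automatically, as the domain of `ρ i` is determined by a point of it.) -/
def Iso (s t : LoopSystem A) : Prop :=
  t.N = s.N ∧ (∀ i ≤ s.N, t.a i = s.a i ∧ t.b i = s.b i ∧ t.U i = s.U i) ∧
  ∃ δ : ℕ → A.G, δ 0 = 1 ∧ δ s.N = 1 ∧
    (∀ i ≤ s.N, δ i ∈ A.structGroup (s.U i) ∧ ∀ x ∈ s.arc i, t.f i x = δ i • s.f i x) ∧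
    ∀ i < s.N, (t.ρ i).elt = δ (i + 1) * (s.ρ i).elt * (δ i)⁻¹

/-- `s.Link i j g`: the arcs `i, j` are equal or consecutive and the transition map of the system
`s` from `i` to `j` is given by the group element `g`. -/
def Link (s : LoopSystem A) (i j : ℕ) (g : A.G) : Prop :=
  (j = i ∧ g = 1) ∨ (j = i + 1 ∧ g = (s.ρ i).elt) ∨ (i = j + 1 ∧ g = (s.ρ j).elt⁻¹)

/-- `t.Refines s`: every arc `k` of `t` is contained in the arc `θ k` of `s`, and there are
transition maps `j k ∈ Tran(t.U k, s.U (θ k))`, the identity at the base point, such that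
`t.f k = (j k)⁻¹ ∘ s.f (θ k)` and `t.ρ k = (j (k+1))⁻¹ ∘ s.ρ_{θ (k+1), θ k} ∘ j k`. -/
def Refines (t s : LoopSystem A) : Prop :=
  ∃ (θ : ℕ → ℕ) (j : ℕ → Transition A.G A.Y),
    θ 0 = 0 ∧ θ t.N = s.N ∧ (j 0).elt = 1 ∧ (j t.N).elt = 1 ∧
    (∀ k ≤ t.N, θ k ≤ s.N ∧ t.arc k ⊆ s.arc (θ k) ∧ j k ∈ A.Tran (t.U k) (s.U (θ k)) ∧
      ∀ x ∈ t.arc k, t.f k x ∈ (j k).dom ∧ (j k).elt • t.f k x = s.f (θ k) x) ∧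
    ∀ k < t.N, ∃ g, s.Link (θ k) (θ (k + 1)) g ∧
      (t.ρ k).elt = (j (k + 1)).elt⁻¹ * g * (j k).elt

/-- Two systems are directly equivalent if they have isomorphic refinements. -/
def DirectEquiv (s t : LoopSystem A) : Prop :=
  ∃ s' t' : LoopSystem A, s'.Refines s ∧ t'.Refines t ∧ s'.Iso t'

end LoopSystem

/-- The based loop space `Ω(X, o)` as a set: equivalence classes of based systems from `(S¹, *)`,
for the equivalence relation generated by direct equivalence. -/
def OrbiLoops (A : BasedGlobalOrbispace) : Type _ :=
  Quot (LoopSystem.DirectEquiv (A := A))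

namespace OrbiLoops


variable {A : BasedGlobalOrbispace.{u, v}}

/-- The based loop represented by a system. -/
def mk (s : LoopSystem A) : OrbiLoops A := Quot.mk _ s

/-- The subbasic open set `O(s, K, V, W)`: the loops that have a representing system over the same
basic open sets `U i` as `s`, whose maps take the compact subsets `K i` of the arcs into `V i` and
whose transition maps lie in `W i`. As usual for the compact-open topology, the maps are compared on
the compact sets `K i` only: the arcs of the representing system may differ from those of `s`,
as long as the arc `i` contains `K i`. -/
def subbasic (s : LoopSystem A) (K : ℕ → Set ℝ) (V : ℕ → Set A.Y)
    (W : ℕ → Set (Transition A.G A.Y)) : Set (OrbiLoops A) :=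
  {γ | ∃ t : LoopSystem A, mk t = γ ∧ t.N = s.N ∧ (∀ i ≤ s.N, t.U i = s.U i) ∧
    ∀ i < s.N, K i ⊆ t.arc i ∧ MapsTo (t.f i) (K i) (V i) ∧ t.ρ i ∈ W i}

/-- The compact-open topology of the based loop space, generated by all sets `O(s, K, V, W)` where
`K i` is a compact subset of the arc `i` of `s`, `V i` is open with `s.f i (K i) ⊆ V i`, and `W i`
is an open neighbourhood of `s.ρ i`. -/
instance instTopologicalSpace : TopologicalSpace (OrbiLoops A) :=
  TopologicalSpace.generateFrom
    {O | ∃ (s : LoopSystem A) (K : ℕ → Set ℝ) (V : ℕ → Set A.Y)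
        (W : ℕ → Set (Transition A.G A.Y)),
      (∀ i < s.N, IsCompact (K i) ∧ K i ⊆ s.arc i ∧ IsOpen (V i) ∧ MapsTo (s.f i) (K i) (V i) ∧
        IsOpen (W i) ∧ s.ρ i ∈ W i) ∧
      O = subbasic s K V W}

end OrbiLoops

namespace LoopSystem


/-- The constant system: all maps are constant with value `ô`, all transition maps are the
identity of `Û_o`. -/
def const (A : BasedGlobalOrbispace.{u, v}) : LoopSystem A where
  N := 3
  three_le := le_rfl
  a i := ((i : ℝ) - 1 / 2) / 3
  b i := ((i : ℝ) + 1) / 3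
  a_zero := by norm_num
  b_zero := by norm_num
  a_one := by norm_num
  b_pred := by norm_num
  a_last := by norm_num
  b_last := by norm_num
  overlap i _ := by push_cast; linarith
  separate i _ := by push_cast; linarith
  U _ := A.baseOpen
  U_zero := rfl
  U_last := rfl
  f _ _ := A.basePt
  f_cont _ _ := continuousOn_const
  f_mem _ _ _ _ := A.basePt_mem
  f_last _ _ := rfl
  f_base := rfl
  ρ _ := ⟨1, A.hat A.baseOpen⟩
  ρ_mem _ _ := A.id_mem_Tran _
  compat _ _ _ _ := ⟨A.basePt_mem, by simp⟩

variable {A : BasedGlobalOrbispace.{u, v}}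

theorem Refines.refl (s : LoopSystem A) : s.Refines s := by
  refine ⟨id, fun k => ⟨1, A.hat (s.U k)⟩, rfl, rfl, rfl, rfl, fun k hk => ⟨hk, Subset.rfl,
    A.id_mem_Tran _, fun x hx => ⟨s.f_mem k hk x hx, by simp⟩⟩, fun k _ => ⟨(s.ρ k).elt,
    Or.inr (Or.inl ⟨rfl, rfl⟩), by simp⟩⟩

theorem Iso.refl (s : LoopSystem A) : s.Iso s :=
  ⟨rfl, fun _ _ => ⟨rfl, rfl, rfl⟩, fun _ => 1, rfl, rfl, fun i _ =>
    ⟨by simp [GlobalOrbispace.structGroup], by simp⟩, by simp⟩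

theorem continuousOn_glue {Z : Type*} [TopologicalSpace Z] {f g : ℝ → Z} {c p q : ℝ}
    (hf : ContinuousOn f (Ioc p c)) (hg : ContinuousOn g (Ico c q)) (h : f c = g c) :
    ContinuousOn (fun x => if x ≤ c then f x else g x) (Ioo p q) := by
  have h1 : {x : ℝ | x ≤ c} = Iic c := rfl
  have h2 : {x : ℝ | ¬ x ≤ c} = Ioi c := by ext x; simp
  refine ContinuousOn.if ?_ ?_ ?_
  · rintro x ⟨-, hx⟩
    rw [h1, frontier_Iic] at hx
    rw [mem_singleton_iff.1 hx, h]
  · rw [h1, closure_Iic]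
    exact hf.mono fun x hx => ⟨hx.1.1, hx.2⟩
  · rw [h2, closure_Ioi]
    exact hg.mono fun x hx => ⟨hx.2, hx.1.2⟩

theorem f_last' (s : LoopSystem A) {x : ℝ} (hx : x ∈ Ioo (s.a s.N) (s.b s.N)) :
    s.f s.N x = s.f 0 (x - 1) := by
  have := s.f_last (x - 1) ⟨by linarith [hx.1, s.a_last], by linarith [hx.2, s.b_last]⟩
  rwa [sub_add_cancel] at this

theorem zero_mem_arc (s : LoopSystem A) : (0 : ℝ) ∈ Ioo (s.a 0) (s.b 0) := ⟨s.a_zero, s.b_zero⟩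

theorem one_mem_arc (s : LoopSystem A) : (1 : ℝ) ∈ Ioo (s.a s.N) (s.b s.N) :=
  ⟨by linarith [s.a_last, s.a_zero], by linarith [s.b_last, s.b_zero]⟩

theorem f_one (s : LoopSystem A) : s.f s.N 1 = A.basePt := by
  rw [s.f_last' s.one_mem_arc, sub_self, s.f_base]

/-- The concatenation `s # t`: first `s`, then `t`, each at double speed. The arcs are those of `s`
and of `t`, except that the two halves of the arcs `0` of `s` and `t` at the base point are
regrouped into one arc around time `0` and one around time `1/2`. -/
def concat (s t : LoopSystem A) : LoopSystem A where
  N := s.N + t.N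
  three_le := le_trans s.three_le (Nat.le_add_right _ _)
  a i := if i = 0 then t.a 0 / 2 else if i ≤ s.N then s.a i / 2 else (1 + t.a (i - s.N)) / 2
  b i := if i < s.N then s.b i / 2 else if i < s.N + t.N then (1 + t.b (i - s.N)) / 2
    else 1 + s.b 0 / 2
  a_zero := by have := t.a_zero; simp; linarith
  b_zero := by
    have h := s.three_le; have := s.b_zero
    rw [if_pos (by omega)]; linarith
  a_one := by
    have h := s.three_le; have := s.a_one
    rw [if_neg (by omega), if_pos (by omega)]; linarith
  b_pred := by
    have h := s.three_le; have h' := t.three_le; have := t.b_pred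
    rw [if_neg (by omega), if_pos (by omega), show s.N + t.N - 1 - s.N = t.N - 1 by omega]
    linarith
  a_last := by
    have h := s.three_le; have h' := t.three_le; have := t.a_last
    rw [if_neg (by omega), if_neg (by omega), if_pos rfl, show s.N + t.N - s.N = t.N by omega]
    linarith
  b_last := by
    have h := s.three_le
    rw [if_neg (by omega), if_neg (by omega), if_pos (by omega)]; ring
  overlap i hi := by
    have h := s.three_le; have h' := t.three_le
    rw [if_neg (by omega)]
    rcases lt_or_ge i s.N with h1 | h1
    · have := s.overlap i h1
      rw [if_pos (by omega), if_pos h1]; linarith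
    · have := t.overlap (i - s.N) (by omega)
      rw [if_neg (by omega), if_neg (by omega), if_pos hi,
        show i + 1 - s.N = i - s.N + 1 by omega]; linarith
  separate i hi := by
    have h := s.three_le; have h' := t.three_le
    rw [if_neg (by omega : ¬ i + 2 = 0)]
    rcases lt_or_ge i s.N with h1 | h1
    · rw [if_pos h1]
      rcases le_or_gt (i + 2) s.N with h2 | h2
      · have := s.separate i h2
        rw [if_pos h2]; linarith
      · have e : i = s.N - 1 := by omega
        have := s.b_pred; have := t.a_one
        rw [if_neg (by omega), e, show s.N - 1 + 2 - s.N = 1 by omega]; linarith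
    · have := t.separate (i - s.N) (by omega)
      rw [if_neg (by omega), if_pos (by omega), if_neg (by omega),
        show i + 2 - s.N = i - s.N + 2 by omega]; linarith
  U i := if i < s.N then s.U i else t.U (i - s.N)
  U_zero := by
    have h := s.three_le
    rw [if_pos (by omega), s.U_zero]
  U_last := by rw [if_neg (by omega), show s.N + t.N - s.N = t.N by omega, t.U_last]
  f i x := if i = 0 then (if x ≤ 0 then t.f 0 (2 * x) else s.f 0 (2 * x))
    else if i < s.N then s.f i (2 * x)
    else if i = s.N then (if x ≤ 1 / 2 then s.f s.N (2 * x) else t.f 0 (2 * x - 1))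
    else if i < s.N + t.N then t.f (i - s.N) (2 * x - 1)
    else (if x ≤ 1 then t.f t.N (2 * x - 1) else s.f 0 (2 * x - 2))
  f_cont i hi := by
    have h := s.three_le; have h' := t.three_le
    rcases Nat.eq_zero_or_pos i with rfl | h0
    · simp only [if_true, if_pos (show 0 < s.N by omega)]
      refine continuousOn_glue (f := fun x => t.f 0 (2 * x)) (g := fun x => s.f 0 (2 * x)) ?_ ?_ ?_
      · refine (t.f_cont 0 (by omega)).comp (by fun_prop) fun x hx => ?_
        have := t.b_zero
        exact ⟨by linarith [hx.1], by linarith [hx.2]⟩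
      · refine (s.f_cont 0 (by omega)).comp (by fun_prop) fun x hx => ?_
        have := s.a_zero
        exact ⟨by linarith [hx.1], by linarith [hx.2]⟩
      · simp [s.f_base, t.f_base]
    rcases lt_trichotomy i s.N with h1 | h1 | h1
    · simp only [if_neg h0.ne', if_pos h1, if_pos h1.le]
      refine (s.f_cont i h1.le).comp (by fun_prop) fun x hx => ?_
      exact ⟨by linarith [hx.1], by linarith [hx.2]⟩
    · subst h1
      simp only [if_neg h0.ne', lt_irrefl, if_true, if_false, le_refl, Nat.sub_self,
        if_pos (show s.N < s.N + t.N by omega)]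
      refine continuousOn_glue (f := fun x => s.f s.N (2 * x)) (g := fun x => t.f 0 (2 * x - 1))
        ?_ ?_ ?_
      · refine (s.f_cont s.N le_rfl).comp (by fun_prop) fun x hx => ?_
        have := s.one_mem_arc.2
        exact ⟨by linarith [hx.1], by linarith [hx.2]⟩
      · refine (t.f_cont 0 (by omega)).comp (by fun_prop) fun x hx => ?_
        have := t.a_zero
        exact ⟨by linarith [hx.1], by linarith [hx.2]⟩
      · norm_num [s.f_one, t.f_base]
    rcases lt_or_ge i (s.N + t.N) with h2 | h2
    · simp only [if_neg h0.ne', if_neg h1.not_gt, if_neg h1.ne', if_neg h1.not_ge, if_pos h2]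
      refine (t.f_cont (i - s.N) (by omega)).comp (by fun_prop) fun x hx => ?_
      exact ⟨by linarith [hx.1], by linarith [hx.2]⟩
    · obtain rfl : i = s.N + t.N := by omega
      simp only [if_neg h0.ne', if_neg h1.not_gt, if_neg h1.ne', if_neg h1.not_ge, lt_irrefl,
        if_false, show s.N + t.N - s.N = t.N by omega]
      refine continuousOn_glue (f := fun x => t.f t.N (2 * x - 1))
        (g := fun x => s.f 0 (2 * x - 2)) ?_ ?_ ?_
      · refine (t.f_cont t.N le_rfl).comp (by fun_prop) fun x hx => ?_
        have := t.one_mem_arc.2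
        exact ⟨by linarith [hx.1], by linarith [hx.2]⟩
      · refine (s.f_cont 0 (by omega)).comp (by fun_prop) fun x hx => ?_
        have := s.a_zero
        exact ⟨by linarith [hx.1], by linarith [hx.2]⟩
      · norm_num [t.f_one, s.f_base]
  f_mem i hi x hx := by
    have h := s.three_le; have h' := t.three_le
    rcases Nat.eq_zero_or_pos i with rfl | h0
    · simp only [if_true, if_pos (show 0 < s.N by omega)] at hx ⊢
      split_ifs with hx0
      · rw [s.U_zero, ← t.U_zero]
        have := t.b_zero
        exact t.f_mem 0 (by omega) _ ⟨by linarith [hx.1], by linarith [hx.2]⟩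
      · have := s.a_zero
        exact s.f_mem 0 (by omega) _ ⟨by linarith [hx.1], by linarith [hx.2]⟩
    rcases lt_trichotomy i s.N with h1 | h1 | h1
    · simp only [if_neg h0.ne', if_pos h1, if_pos h1.le] at hx ⊢
      exact s.f_mem i h1.le _ ⟨by linarith [hx.1], by linarith [hx.2]⟩
    · subst h1
      simp only [if_neg h0.ne', lt_irrefl, if_true, if_false, le_refl, Nat.sub_self,
        if_pos (show s.N < s.N + t.N by omega)] at hx ⊢
      split_ifs with hx0
      · rw [t.U_zero, ← s.U_last]
        have := s.one_mem_arc.2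
        exact s.f_mem s.N le_rfl _ ⟨by linarith [hx.1], by linarith [hx.2]⟩
      · have := t.a_zero
        exact t.f_mem 0 (by omega) _ ⟨by linarith [hx.1], by linarith [hx.2]⟩
    rcases lt_or_ge i (s.N + t.N) with h2 | h2
    · simp only [if_neg h0.ne', if_neg h1.not_gt, if_neg h1.ne', if_neg h1.not_ge, if_pos h2]
        at hx ⊢
      exact t.f_mem (i - s.N) (by omega) _ ⟨by linarith [hx.1], by linarith [hx.2]⟩
    · obtain rfl : i = s.N + t.N := by omega
      simp only [if_neg h0.ne', if_neg h1.not_gt, if_neg h1.ne', if_neg h1.not_ge, lt_irrefl,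
        if_false, show s.N + t.N - s.N = t.N by omega] at hx ⊢
      split_ifs with hx0
      · have := t.one_mem_arc.2
        exact t.f_mem t.N le_rfl _ ⟨by linarith [hx.1], by linarith [hx.2]⟩
      · rw [t.U_last, ← s.U_zero]
        have := s.a_zero
        exact s.f_mem 0 (by omega) _ ⟨by linarith [hx.1], by linarith [hx.2]⟩
  f_last x hx := by
    have h := s.three_le; have h' := t.three_le
    simp only [if_true, if_pos (show 0 < s.N by omega)] at hx
    simp only [if_true, if_neg (show ¬ s.N + t.N = 0 by omega), lt_irrefl, if_false,
      if_neg (show ¬ s.N + t.N < s.N by omega), if_neg (show ¬ s.N + t.N = s.N by omega)]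
    by_cases hx0 : x ≤ 0
    · have := t.b_zero
      rw [if_pos hx0, if_pos (by linarith), ← t.f_last (2 * x) ⟨by linarith [hx.1],
        by linarith⟩]
      congr 1; ring
    · rw [if_neg hx0, if_neg (by linarith)]
      congr 1; ring
  f_base := by simp [t.f_base]
  ρ i := if i < s.N then s.ρ i else t.ρ (i - s.N)
  ρ_mem i hi := by
    rcases lt_or_ge i s.N with h1 | h1
    · have := s.ρ_mem i h1
      rcases lt_or_ge (i + 1) s.N with h2 | h2
      · simpa only [if_pos h1, if_pos h2] using this
      · have e : i + 1 = s.N := by omega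
        rw [e, s.U_last] at this
        simpa only [if_pos h1, e, lt_irrefl, if_false, Nat.sub_self, t.U_zero] using this
    · have := t.ρ_mem (i - s.N) (by omega)
      rw [show i - s.N + 1 = i + 1 - s.N by omega] at this
      simpa only [if_neg h1.not_gt, if_neg (show ¬ i + 1 < s.N by omega)] using this
  compat i hi x hx := by
    have h := s.three_le; have h' := t.three_le
    rcases lt_or_ge i s.N with h1 | h1
    · simp only [if_neg (show ¬ i + 1 = 0 by omega), if_pos (show i + 1 ≤ s.N by omega),
        if_pos h1] at hx ⊢
      have key := s.compat i h1 (2 * x) ⟨by linarith [hx.1], by linarith [hx.2]⟩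
      have e1 : (if i = 0 then (if x ≤ 0 then t.f 0 (2 * x) else s.f 0 (2 * x))
          else s.f i (2 * x)) = s.f i (2 * x) := by
        rcases Nat.eq_zero_or_pos i with rfl | h0
        · have := s.a_one
          have hx0 : ¬ x ≤ 0 := by have := hx.1; simp only [zero_add] at this; linarith
          simp [hx0]
        · rw [if_neg h0.ne']
      have e2 : (if i + 1 < s.N then s.f (i + 1) (2 * x) else if i + 1 = s.N then
          (if x ≤ 1 / 2 then s.f s.N (2 * x) else t.f 0 (2 * x - 1)) else
          if i + 1 < s.N + t.N then t.f (i + 1 - s.N) (2 * x - 1) else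
          (if x ≤ 1 then t.f t.N (2 * x - 1) else s.f 0 (2 * x - 2))) = s.f (i + 1) (2 * x) := by
        rcases lt_or_ge (i + 1) s.N with h2 | h2
        · rw [if_pos h2]
        · have e : i + 1 = s.N := by omega
          have := s.b_pred
          rw [show s.N - 1 = i by omega] at this
          rw [if_neg h2.not_gt, if_pos e, if_pos (by linarith [hx.2]), e]
      rw [e1, e2]
      exact key
    · simp only [if_neg (show ¬ i + 1 = 0 by omega), if_neg (show ¬ i + 1 ≤ s.N by omega),
        if_neg h1.not_gt, if_pos hi, if_neg (show ¬ i = 0 by omega),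
        if_neg (show ¬ i + 1 < s.N by omega), if_neg (show ¬ i + 1 = s.N by omega),
        show i + 1 - s.N = i - s.N + 1 by omega] at hx ⊢
      have key := t.compat (i - s.N) (by omega) (2 * x - 1)
        ⟨by linarith [hx.1], by linarith [hx.2]⟩
      have e1 : (if i = s.N then (if x ≤ 1 / 2 then s.f s.N (2 * x) else t.f 0 (2 * x - 1))
          else t.f (i - s.N) (2 * x - 1)) = t.f (i - s.N) (2 * x - 1) := by
        split_ifs with e hx0
        · exfalso
          have h3 := t.a_one; have h4 := hx.1
          rw [show i - s.N + 1 = 1 by omega] at h4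
          linarith
        · rw [e, Nat.sub_self]
        · rfl
      have e2 : (if i + 1 < s.N + t.N then t.f (i - s.N + 1) (2 * x - 1) else
          (if x ≤ 1 then t.f t.N (2 * x - 1) else s.f 0 (2 * x - 2))) =
          t.f (i - s.N + 1) (2 * x - 1) := by
        split_ifs with e hx0
        · rfl
        · rw [show t.N = i - s.N + 1 by omega]
        · exfalso
          have h3 := t.b_pred; have h4 := hx.2
          rw [show t.N - 1 = i - s.N by omega] at h3
          linarith
      rw [e1, e2]
      exact key

end LoopSystem

/-! ### Equivariant maps and the induced morphisms of based global orbispaces -/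

/-- An equivariant map `(f, ρ) : (Y, G) → (Y', G')`: a continuous homomorphism `ρ : G → G'` and a
continuous `ρ`-equivariant map `f : Y → Y'`, compatible with the base-point structures: `f ô = ô'`,
and the induced map `Y/G → Y'/G'` takes `U_o` into `U'_o`. -/
structure EquivariantMap (A B : BasedGlobalOrbispace.{u, v}) where
  hom : A.G →* B.G
  hom_cont : Continuous hom
  map : A.Y → B.Y
  map_cont : Continuous map
  map_smul : ∀ (g : A.G) (y : A.Y), map (g • y) = hom g • map y
  map_base : map A.basePt = B.basePt
  map_baseOpen : ∀ y ∈ A.preim A.baseOpen, map y ∈ B.preim B.baseOpen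

namespace EquivariantMap

variable {A B : BasedGlobalOrbispace.{u, v}}

/-- A system of local maps representing the morphism of based orbispaces defined by `(f, ρ)`,
over the cover of `X` by all its basic open sets: for every basic open set `U` of `X` a basic open
set `tgt U` of `X'` and an element `h U` of `G'` such that `h U ∘ f` maps `Û` into the space of the
`G`-structure of `tgt U`. The local maps of the system are `f_U = h U ∘ f`; the map
`Tran(U, V) → Tran(tgt U, tgt V)` is `g ↦ h V * ρ g * (h U)⁻¹` on group elements. At the base point,
`U_o ↦ U'_o` with `f_{U_o} = f`. -/
structure LocalSystem (F : EquivariantMap A B) where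
  tgt : A.BasicOpen → B.BasicOpen
  h : A.BasicOpen → B.G
  tgt_base : tgt A.baseOpen = B.baseOpen
  h_base : h A.baseOpen = 1
  maps : ∀ U, ∀ y ∈ A.hat U, h U • F.map y ∈ B.hat (tgt U)

theorem map_proj (F : EquivariantMap A B) {y z : A.Y} (h : A.proj y = A.proj z) :
    B.proj (F.map y) = B.proj (F.map z) := by
  obtain ⟨g, rfl⟩ := A.exists_smul_of_proj_eq h
  rw [F.map_smul, B.proj_smul]

theorem map_mem_hat_base (F : EquivariantMap A B) {y : A.Y} (hy : y ∈ A.hat A.baseOpen) :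
    F.map y ∈ B.hat B.baseOpen := by
  refine B.subset_hat (S := F.map '' A.hat A.baseOpen)
    ((A.hat_isPreconnected _).image _ F.map_cont.continuousOn) ?_
    (mem_image_of_mem _ A.basePt_mem) (by rw [F.map_base]; exact B.basePt_mem)
    (mem_image_of_mem _ hy)
  rintro _ ⟨w, hw, rfl⟩
  exact F.map_baseOpen w (A.hat_subset _ hw)

/-- Such systems exist: one can take for `tgt U` a whole component of `X'`. -/
theorem nonempty_localSystem (F : EquivariantMap A B) : Nonempty F.LocalSystem := by
  classical
  have key : ∀ U : A.BasicOpen, ∃ (V : B.BasicOpen) (h : B.G),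
      ∀ y ∈ A.hat U, h • F.map y ∈ B.hat V := by
    intro U
    obtain ⟨y₀, hy₀⟩ := A.hat_nonempty U
    have hop : IsOpen (B.proj '' connectedComponent (F.map y₀)) :=
      B.isOpenQuotientMap_proj.isOpenMap _ isOpen_connectedComponent
    let V : B.BasicOpen :=
      { carrier := B.proj '' connectedComponent (F.map y₀)
        isOpen := hop
        isConnected := isConnected_connectedComponent.image _
          B.isOpenQuotientMap_proj.continuous.continuousOn }
    have hV : ∀ y ∈ A.hat U, F.map y ∈ B.preim V := fun y hy =>
      mem_image_of_mem _ (((A.hat_isPreconnected U).image _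
        F.map_cont.continuousOn).subset_connectedComponent (mem_image_of_mem _ hy₀)
        (mem_image_of_mem _ hy))
    obtain ⟨h, hh⟩ := B.exists_mem_hat (hV y₀ hy₀)
    refine ⟨V, h, fun y hy => ?_⟩
    refine B.subset_hat (S := (fun y => h • F.map y) '' A.hat U)
      ((A.hat_isPreconnected U).image _ (F.map_cont.const_smul h).continuousOn) ?_
      (mem_image_of_mem _ hy₀) hh (mem_image_of_mem _ hy)
    rintro _ ⟨w, hw, rfl⟩
    exact (B.smul_mem_preim h).2 (hV w hw)
  choose V h hVh using key
  refine ⟨⟨fun U => if U = A.baseOpen then B.baseOpen else V U,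
    fun U => if U = A.baseOpen then 1 else h U, if_pos rfl, if_pos rfl, fun U y hy => ?_⟩⟩
  by_cases hU : U = A.baseOpen
  · subst hU
    simpa using F.map_mem_hat_base hy
  · simpa only [if_neg hU] using hVh U y hy

namespace LocalSystem

variable {F : EquivariantMap A B} (R : F.LocalSystem)

/-- The map `Tran(U, V) → Tran(tgt U, tgt V)` of the system: the group element is
`h V * ρ g * (h U)⁻¹`, and the new domain is the component that contains the image of the old
domain under `f_U`. -/
def tran (U V : A.BasicOpen) (τ : Transition A.G A.Y) : Transition B.G B.Y where
  elt := R.h V * F.hom τ.elt * (R.h U)⁻¹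
  dom := ⋃ y ∈ τ.dom,
    connectedComponentIn (B.hat (R.tgt U) ∩ B.preim (R.tgt V)) (R.h U • F.map y)

theorem elt_smul (U V : A.BasicOpen) (τ : Transition A.G A.Y) (y : A.Y) :
    (R.tran U V τ).elt • (R.h U • F.map y) = R.h V • F.map (τ.elt • y) := by
  simp [tran, mul_smul, F.map_smul]

theorem map_mem_preim {U V : A.BasicOpen} {y : A.Y} (hyU : y ∈ A.hat U) (hyV : y ∈ A.preim V) :
    R.h U • F.map y ∈ B.hat (R.tgt U) ∩ B.preim (R.tgt V) := by
  refine ⟨R.maps U y hyU, ?_⟩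
  obtain ⟨g, hg⟩ := A.exists_mem_hat hyV
  have h1 := B.hat_subset _ (R.maps V _ hg)
  rw [F.map_smul, B.smul_mem_preim, B.smul_mem_preim] at h1
  exact (B.smul_mem_preim _).2 h1

theorem mem_tran_dom {U V : A.BasicOpen} {τ : Transition A.G A.Y} (hτ : τ ∈ A.Tran U V) {y : A.Y}
    (hy : y ∈ τ.dom) : R.h U • F.map y ∈ (R.tran U V τ).dom := by
  obtain ⟨z, -, -, h⟩ := hτ
  have hy' : y ∈ A.hat U ∩ A.preim V := connectedComponentIn_subset _ _ (h ▸ hy)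
  exact mem_biUnion hy (mem_connectedComponentIn (R.map_mem_preim hy'.1 hy'.2))

theorem tran_mem {U V : A.BasicOpen} {τ : Transition A.G A.Y} (hτ : τ ∈ A.Tran U V) :
    R.tran U V τ ∈ B.Tran (R.tgt U) (R.tgt V) := by
  obtain ⟨z, hz, hgz, h⟩ := id hτ
  have hzV : z ∈ A.preim V := (A.smul_mem_preim _).1 (A.hat_subset _ hgz)
  have hzd : z ∈ τ.dom := h ▸ mem_connectedComponentIn ⟨hz, hzV⟩
  refine ⟨R.h U • F.map z, R.maps U z hz, ?_, ?_⟩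
  · rw [R.elt_smul]; exact R.maps V _ hgz
  · refine Subset.antisymm (iUnion₂_subset fun y hy => ?_) (subset_biUnion_of_mem
      (u := fun y => connectedComponentIn (B.hat (R.tgt U) ∩ B.preim (R.tgt V))
        (R.h U • F.map y)) hzd)
    have hsub : (fun y => R.h U • F.map y) '' τ.dom ⊆ B.hat (R.tgt U) ∩ B.preim (R.tgt V) := by
      rintro _ ⟨w, hw, rfl⟩
      have hw' : w ∈ A.hat U ∩ A.preim V := connectedComponentIn_subset _ _ (h ▸ hw)
      exact R.map_mem_preim hw'.1 hw'.2
    have hpre : IsPreconnected ((fun y => R.h U • F.map y) '' τ.dom) := by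
      rw [h]
      exact isPreconnected_connectedComponentIn.image _ (F.map_cont.const_smul _).continuousOn
    rw [connectedComponentIn_eq (hpre.subset_connectedComponentIn (mem_image_of_mem _ hzd) hsub
      (mem_image_of_mem _ hy))]

/-- The composition of a based loop system with the system of the morphism. -/
def push (s : LoopSystem A) : LoopSystem B where
  N := s.N
  three_le := s.three_le
  a := s.a
  b := s.b
  a_zero := s.a_zero
  b_zero := s.b_zero
  a_one := s.a_one
  b_pred := s.b_pred
  a_last := s.a_last
  b_last := s.b_last
  overlap := s.overlap
  separate := s.separate
  U i := R.tgt (s.U i)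
  U_zero := by rw [s.U_zero, R.tgt_base]
  U_last := by rw [s.U_last, R.tgt_base]
  f i x := R.h (s.U i) • F.map (s.f i x)
  f_cont i hi := (F.map_cont.comp_continuousOn (s.f_cont i hi)).const_smul _
  f_mem i hi x hx := R.maps _ _ (s.f_mem i hi x hx)
  f_last x hx := by rw [s.f_last x hx, s.U_zero, s.U_last]
  f_base := by rw [s.U_zero, R.h_base, s.f_base, one_smul, F.map_base]
  ρ i := R.tran (s.U i) (s.U (i + 1)) (s.ρ i)
  ρ_mem i hi := R.tran_mem (s.ρ_mem i hi)
  compat i hi x hx :=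
    ⟨R.mem_tran_dom (s.ρ_mem i hi) (s.compat i hi x hx).1, by
      rw [R.elt_smul, (s.compat i hi x hx).2]⟩

theorem push_refines {s t : LoopSystem A} (h : t.Refines s) : (R.push t).Refines (R.push s) := by
  obtain ⟨θ, j, h0, h1, h2, h3, h4, h5⟩ := h
  have e0 : t.U 0 = A.baseOpen := t.U_zero
  have e1 : s.U 0 = A.baseOpen := s.U_zero
  refine ⟨θ, fun k => R.tran (t.U k) (s.U (θ k)) (j k), h0, h1, ?_, ?_, fun k hk => ?_,
    fun k hk => ?_⟩
  · simp [tran, h0, h2, e0, e1, R.h_base]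
  · change (R.tran (t.U t.N) (s.U (θ t.N)) (j t.N)).elt = 1
    simp [tran, h1, h3, t.U_last, s.U_last, R.h_base]
  · obtain ⟨h6, h7, h8, h9⟩ := h4 k hk
    refine ⟨h6, h7, R.tran_mem h8, fun x hx => ⟨R.mem_tran_dom h8 (h9 x hx).1, ?_⟩⟩
    exact (R.elt_smul _ _ _ _).trans (by rw [(h9 x hx).2]; rfl)
  · obtain ⟨g, hg, hρ⟩ := h5 k hk
    refine ⟨R.h (s.U (θ (k + 1))) * F.hom g * (R.h (s.U (θ k)))⁻¹, ?_, ?_⟩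
    · rcases hg with ⟨e, rfl⟩ | ⟨e, rfl⟩ | ⟨e, rfl⟩
      · exact Or.inl ⟨e, by simp [e]⟩
      · exact Or.inr (Or.inl ⟨e, by rw [e]; rfl⟩)
      · refine Or.inr (Or.inr ⟨e, ?_⟩)
        rw [e]
        simp [push, tran, mul_assoc]
    · simp [push, tran, hρ, mul_assoc]

theorem push_iso {s t : LoopSystem A} (h : s.Iso t) : (R.push s).Iso (R.push t) := by
  obtain ⟨hN, hU, δ, h0, h1, h2, h3⟩ := h
  refine ⟨hN, fun i hi => ⟨(hU i hi).1, (hU i hi).2.1, congrArg R.tgt (hU i hi).2.2⟩,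
    fun i => R.h (s.U i) * F.hom (δ i) * (R.h (s.U i))⁻¹, ?_, ?_, fun i hi => ⟨?_, ?_⟩,
    fun i hi => ?_⟩
  · simp [h0]
  · change R.h (s.U s.N) * F.hom (δ s.N) * (R.h (s.U s.N))⁻¹ = 1
    simp [h1]
  · obtain ⟨y, hy⟩ := A.hat_nonempty (s.U i)
    refine B.mem_structGroup (R.maps _ y hy) ?_
    have := R.maps _ _ (A.smul_mem_of_structGroup (h2 i hi).1 hy)
    simpa [push, F.map_smul, mul_smul] using this
  · intro x hx
    have := (h2 i hi).2 x hx
    simp [push, this, (hU i hi).2.2, F.map_smul, mul_smul]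
  · have hi' : i + 1 ≤ s.N := hi
    have hi'' : i ≤ s.N := le_of_lt hi
    simp [push, tran, h3 i hi, (hU i hi'').2.2, (hU (i + 1) hi').2.2, mul_assoc]

/-- The map `Ω(X, o) → Ω(X', o')` induced by the morphism, `γ ↦ (f, ρ) ∘ γ`. -/
def loopMap : OrbiLoops A → OrbiLoops B :=
  Quot.map R.push fun _ _ ⟨s', t', hs, ht, h⟩ =>
    ⟨R.push s', R.push t', R.push_refines hs, R.push_refines ht, R.push_iso h⟩

end LocalSystem

end EquivariantMap

/-- The base point `õ` of the based loop space: the class of the constant system. -/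
def OrbiLoops.base (A : BasedGlobalOrbispace.{u, v}) : OrbiLoops A := mk (LoopSystem.const A)

theorem EquivariantMap.LocalSystem.loopMap_base {A B : BasedGlobalOrbispace.{u, v}}
    {F : EquivariantMap A B} (R : F.LocalSystem) :
    R.loopMap (OrbiLoops.base A) = OrbiLoops.base B := by
  refine Quot.sound ⟨_, _, LoopSystem.Refines.refl _, LoopSystem.Refines.refl _, rfl,
    fun i _ => ⟨rfl, rfl, R.tgt_base.symm⟩, fun _ => 1, rfl, rfl, fun i hi => ⟨?_, fun x _ => ?_⟩,
    fun i _ => ?_⟩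
  · simp [GlobalOrbispace.structGroup]
  · simp [LoopSystem.const, push, R.h_base, F.map_base]
  · simp [LoopSystem.const, push, tran, R.h_base]

/-! ### Homotopy groups -/

/-- The map on homotopy groups (or sets, for an empty index type) induced by a continuous map of
based spaces. -/
def HomotopyGroup.induced {N X X' : Type*} [TopologicalSpace X] [TopologicalSpace X'] {x : X}
    {x' : X'} (φ : X → X') (hφ : Continuous φ) (h : φ x = x') :
    HomotopyGroup N X x → HomotopyGroup N X' x' :=
  Quotient.map (fun p : GenLoop N X x =>
      (⟨(⟨φ, hφ⟩ : C(X, X')).comp p.1, fun y hy => (congrArg φ (p.2 y hy)).trans h⟩ :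
        GenLoop N X' x'))
    fun _ _ hpq => hpq.map fun H => H.compContinuousMap ⟨φ, hφ⟩

/-- The product "first `x`, then `y`" of elements of the `n`-th homotopy group, `n ≥ 1`: the class
of the concatenation of representatives. -/
def HomotopyGroup.seqMul {N X : Type*} [DecidableEq N] [Nonempty N] [TopologicalSpace X] {x : X}
    (p q : HomotopyGroup N X x) : HomotopyGroup N X x := q * p

theorem HomotopyGroup.seqMul_mk {N X : Type*} [DecidableEq N] [Nonempty N] [TopologicalSpace X]
    {x : X} (i : N) (p q : GenLoop N X x) :
    HomotopyGroup.seqMul (Quotient.mk _ p : HomotopyGroup N X x) (Quotient.mk _ q) =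
      (Quotient.mk _ (GenLoop.transAt i p q) : HomotopyGroup N X x) :=
  HomotopyGroup.mul_spec

/-- `OrbiPi k A` is the homotopy group `π_{k+1}(X, o)` of the based global orbispace, by definition
`π_k(Ω(X, o), õ)`. For `k ≥ 1` it has the group structure of `π_k`. For `k = 0` it is the set of path
components of the based loop space, with the product induced by the concatenation `#` of loops. -/
abbrev OrbiPi (k : ℕ) (A : BasedGlobalOrbispace.{u, v}) : Type _ :=
  HomotopyGroup.Pi k (OrbiLoops A) (OrbiLoops.base A)

/-- The class in `π_1(X, o) = π_0(Ω(X, o))` of the based loop represented by a system. -/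
def LoopSystem.cls {A : BasedGlobalOrbispace.{u, v}} (s : LoopSystem A) : OrbiPi 0 A :=
  Quotient.mk _ ⟨ContinuousMap.const _ (OrbiLoops.mk s), fun _ ⟨i, _⟩ => i.elim0⟩

/-! ### Milnor's `EG` and the Borel space -/

/-- Formal expressions `(t₀ g₀, t₁ g₁, …)` with `g_i ∈ G`, `t_i ∈ [0, 1]`, only finitely many
`t_i ≠ 0` and `∑ t_i = 1`. -/
structure MilnorJoin (G : Type u) where
  t : ℕ → ℝ
  g : ℕ → G
  t_mem : ∀ i, t i ∈ Icc (0 : ℝ) 1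
  finite : {i | t i ≠ 0}.Finite
  sum_eq : ∑ i ∈ finite.toFinset, t i = 1

namespace MilnorJoin

/-- Two expressions are identified if `t_i = t'_i` for all `i` and `g_i = g'_i` whenever
`t_i = t'_i > 0`. -/
instance setoid (G : Type u) : Setoid (MilnorJoin G) where
  r p q := p.t = q.t ∧ ∀ i, 0 < p.t i → p.g i = q.g i
  iseqv :=
    { refl := fun _ => ⟨rfl, fun _ _ => rfl⟩
      symm := fun h => ⟨h.1.symm, fun i hi => (h.2 i (h.1 ▸ hi)).symm⟩
      trans := fun h h' => ⟨h.1.trans h'.1, fun i hi => (h.2 i hi).trans (h'.2 i (h.1 ▸ hi))⟩ }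

end MilnorJoin

/-- Milnor's space `EG`. -/
def MilnorE (G : Type u) : Type u := Quotient (MilnorJoin.setoid G)

namespace MilnorE

/-- The coordinate function `t_i : EG → [0, 1]`. -/
def t {G : Type u} (i : ℕ) : MilnorE G → ℝ :=
  Quotient.lift (fun p => p.t i) fun _ _ h => congrFun h.1 i

/-- `coordMem i e S`: `t_i(e) > 0` and `g_i(e) ∈ S`. -/
def coordMem {G : Type u} (i : ℕ) (S : Set G) : MilnorE G → Prop :=
  Quotient.lift (fun p => 0 < p.t i ∧ p.g i ∈ S) fun p q h => by
    have h1 : p.t i = q.t i := congrFun h.1 i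
    refine propext ⟨fun hp => ⟨h1 ▸ hp.1, h.2 i hp.1 ▸ hp.2⟩, fun hq => ?_⟩
    have h2 : 0 < p.t i := h1.symm ▸ hq.1
    exact ⟨h2, (h.2 i h2).symm ▸ hq.2⟩

/-- Milnor's topology on `EG`: the coarsest topology for which all `t_i : EG → [0, 1]` and all
`g_i : t_i⁻¹(0, 1] → G` are continuous (where the sets `t_i⁻¹(0, 1]` are open in `EG`). -/
instance instTopologicalSpace {G : Type u} [TopologicalSpace G] : TopologicalSpace (MilnorE G) :=
  TopologicalSpace.generateFrom
    ({O | ∃ (i : ℕ) (S : Set ℝ), IsOpen S ∧ O = {e | t i e ∈ S}} ∪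
      {O | ∃ (i : ℕ) (S : Set G), IsOpen S ∧ O = {e | coordMem i S e}})

/-- The map `ρ_! : EG → EG'`, `⟨g, t⟩ ↦ ⟨ρ(g), t⟩`, for any map `ρ : G → G'`. -/
def map {G G' : Type u} (φ : G → G') : MilnorE G → MilnorE G' :=
  Quotient.map (fun p => ⟨p.t, fun i => φ (p.g i), p.t_mem, p.finite, p.sum_eq⟩)
    fun _ _ h => ⟨h.1, fun i hi => congrArg φ (h.2 i hi)⟩

/-- The right action of `G` on `EG`, `⟨g, t⟩ h = ⟨g h, t⟩`. -/
def mulRight {G : Type u} [Group G] (e : MilnorE G) (h : G) : MilnorE G := map (fun g => g * h) e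

/-- The base point `(1 1_G, 0, 0, …)` of `EG`. -/
def base (G : Type u) [Group G] : MilnorE G :=
  Quotient.mk _
    { t := fun i => if i = 0 then 1 else 0
      g := fun _ => 1
      t_mem := fun i => by split_ifs <;> simp
      finite := (finite_singleton 0).subset fun i hi => by simpa using hi
      sum_eq := by
        have h : ∀ (h : {i : ℕ | (if i = 0 then (1 : ℝ) else 0) ≠ 0}.Finite),
            h.toFinset = {0} := fun h => by ext i; simp
        rw [h]; simp }

theorem map_map {G G' G'' : Type u} (φ : G → G') (ψ : G' → G'') (e : MilnorE G) :
    map ψ (map φ e) = map (fun g => ψ (φ g)) e := by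
  induction e using Quotient.inductionOn; rfl

theorem map_id {G : Type u} (e : MilnorE G) : map (fun g => g) e = e := by
  induction e using Quotient.inductionOn; rfl

theorem mulRight_one {G : Type u} [Group G] (e : MilnorE G) : e.mulRight 1 = e := by
  simp only [mulRight, mul_one, map_id]

theorem mulRight_mul {G : Type u} [Group G] (e : MilnorE G) (h k : G) :
    (e.mulRight h).mulRight k = e.mulRight (h * k) := by
  simp only [mulRight, map_map, mul_assoc]

theorem map_mulRight {G G' : Type u} [Group G] [Group G'] (φ : G →* G') (e : MilnorE G) (h : G) :
    map φ (e.mulRight h) = (map φ e).mulRight (φ h) := by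
  simp only [mulRight, map_map, map_mul]

theorem map_base {G G' : Type u} [Group G] [Group G'] (φ : G →* G') :
    map φ (base G) = base G' :=
  Quotient.sound ⟨rfl, fun _ _ => map_one φ⟩

theorem continuous_map {G G' : Type u} [TopologicalSpace G] [TopologicalSpace G'] {φ : G → G'}
    (hφ : Continuous φ) : Continuous (map φ) := by
  refine continuous_generateFrom_iff.2 ?_
  rintro O (⟨i, S, hS, rfl⟩ | ⟨i, S, hS, rfl⟩)
  · refine TopologicalSpace.isOpen_generateFrom_of_mem (Or.inl ⟨i, S, hS, ?_⟩)
    ext e; induction e using Quotient.inductionOn; rfl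
  · refine TopologicalSpace.isOpen_generateFrom_of_mem (Or.inr ⟨i, φ ⁻¹' S, hS.preimage hφ, ?_⟩)
    ext e; induction e using Quotient.inductionOn; rfl

end MilnorE

namespace GSpace

/-- The relation `(e h, y) ~ (e, h y)` on `EG × Y`. -/
instance borelSetoid (A : GSpace.{u, v}) : Setoid (MilnorE A.G × A.Y) where
  r p q := ∃ h : A.G, p.1 = q.1.mulRight h ∧ q.2 = h • p.2
  iseqv :=
    { refl := fun p => ⟨1, by simp [MilnorE.mulRight_one], by simp⟩
      symm := by
        rintro p q ⟨h, h1, h2⟩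
        exact ⟨h⁻¹, by simp [h1, MilnorE.mulRight_mul, MilnorE.mulRight_one], by simp [h2]⟩
      trans := by
        rintro p q r ⟨h, h1, h2⟩ ⟨k, h3, h4⟩
        exact ⟨k * h, by rw [h1, h3, MilnorE.mulRight_mul], by rw [h4, h2, mul_smul]⟩ }

/-- The Borel space `Y_G = EG ×_G Y`, the quotient of the product space `EG × Y`. -/
abbrev Borel (A : GSpace.{u, v}) : Type (max u v) := Quotient A.borelSetoid

end GSpace

/-- The base point `[(*, ô)]` of the Borel space. -/
def BasedGlobalOrbispace.borelBase (A : BasedGlobalOrbispace.{u, v}) : A.Borel :=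
  Quotient.mk _ (MilnorE.base A.G, A.basePt)

namespace EquivariantMap

variable {A B : BasedGlobalOrbispace.{u, v}} (F : EquivariantMap A B)

/-- The map `(f, ρ)_! : Y_G → Y'_{G'}` induced by `(ρ_!, f) : EG × Y → EG' × Y'`. -/
def borelMap : A.Borel → B.Borel :=
  Quotient.map (fun p => (MilnorE.map F.hom p.1, F.map p.2)) fun p q ⟨h, h1, h2⟩ =>
    ⟨F.hom h, by simp only [h1, MilnorE.map_mulRight], by simp only [h2, F.map_smul]⟩

theorem continuous_borelMap : Continuous F.borelMap :=
  Continuous.quotient_map' (s := A.borelSetoid) (t := B.borelSetoid)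
    (((MilnorE.continuous_map F.hom_cont).comp continuous_fst).prodMk
      (F.map_cont.comp continuous_snd)) _

theorem borelMap_base : F.borelMap A.borelBase = B.borelBase := by
  change Quotient.mk _ (MilnorE.map F.hom (MilnorE.base A.G), F.map A.basePt) = _
  rw [MilnorE.map_base, F.map_base]; rfl

end EquivariantMap

end

noncomputable section

open scoped unitInterval

/-! ### Horns of cubes and trivial Serre fibrations -/

/-! A based loop in the orbispace is the same thing as a `G`-path: a path `α` in `Y` starting at
`ô`, together with a group element `g` such that `g • α 1 = ô`. Given a loop system, let `hol i` be
the product of the group elements of its first `i` transition maps. The maps `(hol i)⁻¹ • f i` agree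
on the overlaps and glue to `α`, and `g` is `hol N`. Refinements and isomorphisms do not change `(α,
g)`. Conversely, two systems with the same `G`-path have a common refinement over a fine uniform
cover, and every `G`-path comes from a system (`toGPath_bijective`). The bijection is a
homeomorphism (`gpathHomeo`), so the based loop space may be replaced by `GPath`.

The space `GPath` is compared with the loop space of `Y_G` through `TotalGPath`, the same
construction for the action of `G` on `EG × Y`: there are projections from `TotalGPath` to `GPath`
and to the loops of `Y_G`. Both have the right lifting property for all pairs `(I^n, ∂I^n)`. For the
first, lifting a `G`-path means choosing a path in `EG` from the base point to its translate by `g`,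
and `EG` is contractible (`MilnorE.exists_contraction`). For the second, `EG × Y → Y_G` has local
sections and a continuous translation function, so that cubes lift relative to a horn
(`exists_lift_of_horn`) and the element `g` at the end of a lifted loop is unique and continuous.
Maps with the lifting property induce bijections of homotopy groups (`induced_bijective`), and `π_k`
of a loop space is `π_{k+1}` of the space (`loopEquiv`).

An equivariant map acts compatibly on every space of this zigzag, which gives naturality. For `k ≥
1` induced maps are multiplicative. For `π_1` the product is checked on representatives:
concatenation of paths in `EG × Y`, with the second one translated, lies above both the
concatenation of loop systems and that of loops in `Y_G`. -/

/-- The union of the bottom and of the sides of the prism `I^n × I`. -/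
def Cube.horn (n : ℕ) : Set ((Fin n → I) × I) := {p | p.2 = 0 ∨ p.1 ∈ Cube.boundary (Fin n)}

theorem Cube.isClosed_boundary (n : ℕ) : IsClosed (Cube.boundary (Fin n)) := by
  have : Cube.boundary (Fin n) = ⋃ i : Fin n, {y | y i = 0 ∨ y i = 1} := by
    ext y; simp [Cube.boundary]
  rw [this]
  refine isClosed_iUnion_of_finite fun i => ?_
  exact (isClosed_eq (continuous_apply i) continuous_const).union
    (isClosed_eq (continuous_apply i) continuous_const)

/-- Continuity on the boundary is later checked on these three closed pieces, with the coordinate 0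
in the role of time. -/
theorem Cube.boundary_succ (k : ℕ) : Cube.boundary (Fin (k + 1)) = {y | y 0 = 0} ∪ ({y | y 0 = 1} ∪
    Fin.tail ⁻¹' Cube.boundary (Fin k)) := by
  ext y
  refine ⟨fun ⟨i, hi⟩ => ?_, fun h => ?_⟩
  · induction i using Fin.cases with
    | zero => exact or_assoc.1 (Or.inl hi)
    | succ i => exact Or.inr (Or.inr ⟨i, hi⟩)
  · rcases h with h | h | ⟨i, hi⟩
    exacts [⟨0, Or.inl h⟩, ⟨0, Or.inr h⟩, ⟨i.succ, hi⟩]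

/-- The projection from a point above the prism retracts `I^n × I` onto the horn. -/
theorem Cube.exists_retraction_horn (n : ℕ) :
    ∃ r : (Fin n → I) × I → (Fin n → I) × I, Continuous r ∧ (∀ p, r p ∈ Cube.horn n) ∧
      ∀ p ∈ Cube.horn n, r p = p := by
  let y : (Fin n → I) → (Fin n → ℝ) := fun x i => (x i : ℝ) - 1 / 2
  have hy : Continuous y := by fun_prop
  have hy2 : ∀ x, 2 * ‖y x‖ ≤ 1 := fun x => by
    have : ‖y x‖ ≤ 1 / 2 := (pi_norm_le_iff_of_nonneg (by norm_num)).2 fun i => by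
      rw [Real.norm_eq_abs, abs_le]
      have := (x i).2.1; have := (x i).2.2
      constructor <;> simp only [y] <;> linarith
    linarith
  -- The ray from the point at height 2 above the centre through `p` meets the sides at the
  -- parameter `1 / (2 * ‖y‖)` and the bottom at `1 / (1 - p.2 / 2)`; `m` is the reciprocal of the
  -- smaller one. The uses of `projIcc` below only supply membership in `I`, they never truncate.
  let m : (Fin n → I) × I → ℝ := fun p => max (2 * ‖y p.1‖) (1 - p.2 / 2)
  have hm : Continuous m := by fun_prop
  have hm0 : ∀ p, 1 / 2 ≤ m p := fun p => le_max_of_le_right (by have := p.2.2.2; linarith)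
  have hm0' : ∀ p, m p ≠ 0 := fun p => by have := hm0 p; positivity
  refine ⟨fun p => (fun i => projIcc 0 1 zero_le_one (1 / 2 + y p.1 i / m p),
    projIcc 0 1 zero_le_one (2 - (2 - p.2) / m p)), ?_, fun p => ?_, fun p hp => ?_⟩
  · refine Continuous.prodMk (continuous_pi fun i => continuous_projIcc.comp ?_)
      (continuous_projIcc.comp ?_)
    · exact continuous_const.add (Continuous.div (by fun_prop) hm hm0')
    · exact continuous_const.sub (Continuous.div (by fun_prop) hm hm0')
  · rcases max_choice (2 * ‖y p.1‖) (1 - p.2 / 2 : ℝ) with h | h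
    · right
      have hpos : 0 < ‖y p.1‖ := by have := hm0 p; simp only [m, h] at this; linarith
      have hne : Nonempty (Fin n) := by
        by_contra hn
        rw [not_nonempty_iff] at hn
        have : y p.1 = 0 := Subsingleton.elim _ _
        rw [this, norm_zero] at hpos
        exact lt_irrefl _ hpos
      obtain ⟨i, hmax⟩ := Finite.exists_max fun i => ‖y p.1 i‖
      have hi : ‖y p.1 i‖ = ‖y p.1‖ := le_antisymm (norm_le_pi_norm _ _)
        ((pi_norm_le_iff_of_nonneg (norm_nonneg _)).2 hmax)
      have hmp : m p = 2 * ‖y p.1‖ := h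
      refine ⟨i, ?_⟩
      rcases abs_choice (y p.1 i) with h1 | h1
      · right
        rw [Real.norm_eq_abs, h1] at hi
        have : (1 : ℝ) ≤ 1 / 2 + y p.1 i / m p := by
          rw [hmp, ← hi]; rw [← hi] at hpos; field_simp; norm_num
        exact projIcc_of_right_le zero_le_one this
      · left
        rw [Real.norm_eq_abs, h1] at hi
        have : 1 / 2 + y p.1 i / m p ≤ (0 : ℝ) := by
          rw [hmp, ← hi]; rw [← hi] at hpos
          have : y p.1 i ≠ 0 := by intro h; simp [h] at hpos
          apply le_of_eq; field_simp; norm_num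
        exact projIcc_of_le_left zero_le_one this
    · left
      have hmp : m p = 1 - p.2 / 2 := h
      have : 2 - (2 - p.2) / m p ≤ (0 : ℝ) := by
        have := p.2.2.2
        rw [hmp]; apply le_of_eq
        have : (2 : ℝ) - p.2 ≠ 0 := by linarith
        field_simp; norm_num
      exact projIcc_of_le_left zero_le_one this
  · have hmp : m p = 1 := by
      rcases hp with h | ⟨i, hi⟩
      · have := hy2 p.1
        simp only [m, h]; simpa using this
      · have h1 : 2 * ‖y p.1‖ = 1 := by
          refine le_antisymm (hy2 _) ?_
          have := norm_le_pi_norm (y p.1) i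
          rcases hi with hi | hi <;> simp only [y, hi] at this <;> norm_num at this <;> linarith
        have := p.2.2.1
        rw [show m p = max (2 * ‖y p.1‖) (1 - p.2 / 2 : ℝ) from rfl, h1]
        exact max_eq_left (by linarith)
    refine Prod.ext (funext fun i => ?_) ?_
    · simp only [hmp, y, div_one]
      rw [add_sub_cancel]; exact projIcc_val _ _
    · simp only [hmp, div_one]
      rw [sub_sub_cancel]; exact projIcc_val _ _

/-- In a contractible space, maps of the boundary of a cube extend to the cube. -/
theorem Cube.exists_extension_of_contraction {Z : Type*} [TopologicalSpace Z] {c : Z × I → Z}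
    {z₀ : Z} (hc : Continuous c) (h0 : ∀ z, c (z, 0) = z) (h1 : ∀ z, c (z, 1) = z₀) {n : ℕ}
    {f : (Fin n → I) → Z} (hf : ContinuousOn f (Cube.boundary (Fin n))) :
    ∃ F : (Fin n → I) → Z, Continuous F ∧ ∀ x ∈ Cube.boundary (Fin n), F x = f x := by
  obtain ⟨r, hr, hrh, hri⟩ := Cube.exists_retraction_horn n
  -- On the sides the contraction runs backwards, from `z₀` at the bottom to `f` at the top; the
  -- extension is the top face of `K ∘ r`.
  let K : (Fin n → I) × I → Z := fun p => if p.2 = 0 then z₀ else c (f p.1, σ p.2)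
  have hK : ContinuousOn K (Cube.horn n) := by
    have e : Cube.horn n = {p | p.2 = 0} ∪ {p | p.1 ∈ Cube.boundary (Fin n)} := rfl
    rw [e]
    refine ContinuousOn.union_of_isClosed ?_ ?_ (isClosed_eq continuous_snd continuous_const)
      ((Cube.isClosed_boundary n).preimage continuous_fst)
    · exact (continuousOn_const (c := z₀)).congr fun p hp => if_pos hp
    · have : ContinuousOn (fun p : (Fin n → I) × I => c (f p.1, σ p.2))
          {p | p.1 ∈ Cube.boundary (Fin n)} :=
        hc.comp_continuousOn ((hf.comp continuousOn_fst fun p hp => hp).prodMk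
          (by fun_prop))
      refine this.congr fun p hp => ?_
      by_cases h : p.2 = 0
      · simp [K, h, h1]
      · simp [K, h]
  refine ⟨fun x => K (r (x, 1)), hK.comp_continuous (by fun_prop) fun x => hrh _, fun x hx => ?_⟩
  have e := hri (x, 1) (Or.inr hx)
  simp only [e]
  simp [K, h0]

/-- Maps with the right lifting property for all pairs `(I^n, ∂I^n)`. -/
def IsTrivialFibration {Q P : Type*} [TopologicalSpace Q] [TopologicalSpace P] (a : Q → P) : Prop :=
  ∀ (n : ℕ) (u : (Fin n → I) → P) (v : (Fin n → I) → Q), Continuous u →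
    ContinuousOn v (Cube.boundary (Fin n)) → (∀ x ∈ Cube.boundary (Fin n), a (v x) = u x) →
    ∃ w : (Fin n → I) → Q, Continuous w ∧ (∀ x, a (w x) = u x) ∧
      ∀ x ∈ Cube.boundary (Fin n), w x = v x

/-- The cube of dimension 0 is a point with empty boundary. A point of `Q` is needed only as the
value of the boundary datum, which is a total function. -/
theorem IsTrivialFibration.surjective {Q P : Type*} [TopologicalSpace Q] [TopologicalSpace P]
    [Nonempty Q] {a : Q → P} (ha : IsTrivialFibration a) : Function.Surjective a := by
  intro p
  obtain ⟨w, -, h, -⟩ := ha 0 (fun _ => p) (fun _ => Classical.arbitrary Q) continuous_const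
    continuousOn_const (fun x ⟨i, _⟩ => i.elim0)
  exact ⟨w finZeroElim, h _⟩

theorem Homeomorph.isTrivialFibration {Q P : Type*} [TopologicalSpace Q] [TopologicalSpace P]
    (e : Q ≃ₜ P) : IsTrivialFibration e := fun n u v hu _ h =>
  ⟨fun x => e.symm (u x), by fun_prop, fun x => by simp, fun x hx => by simp [← h x hx]⟩

/-! ### Induced maps on homotopy groups. -/

namespace HomotopyGroup

variable {X X' : Type*} [TopologicalSpace X] [TopologicalSpace X']
  {x : X} {x' : X'} {φ : X → X'} (hφ : Continuous φ) (h : φ x = x')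

theorem induced_mul {N : Type*} [DecidableEq N] [Nonempty N] (p q : HomotopyGroup N X x) :
    induced φ hφ h (p * q) = induced φ hφ h p * induced φ hφ h q := by
  induction p using Quotient.inductionOn with | _ p
  induction q using Quotient.inductionOn with | _ q
  let i : N := Classical.arbitrary N
  have e := HomotopyGroup.mul_spec (i := i) (p := p) (q := q)
  refine (congrArg (induced φ hφ h) e).trans (Eq.trans ?_ (HomotopyGroup.mul_spec (i := i)).symm)
  refine congrArg (Quotient.mk _) (GenLoop.ext _ _ fun y => ?_)
  -- The product of the classes of `p` and `q` is the concatenation with `q` first.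
  change φ (GenLoop.transAt i q p y) = GenLoop.transAt i _ _ y
  simp only [GenLoop.transAt, GenLoop.coe_copy]
  split_ifs <;> rfl

/-- Surjectivity lifts a cube whose boundary is prescribed to be constant. For injectivity, a
homotopy from `φ ∘ p` to `φ ∘ q` is a cube of one dimension more; its boundary is lifted by `p`, by
`q` and by the constant `x` on the sides, and the extended lift is a homotopy from `p` to `q`. -/
theorem induced_bijective (hf : IsTrivialFibration φ) (k : ℕ) :
    Function.Bijective (induced (N := Fin k) φ hφ h) := by
  constructor
  · intro p q hpq
    induction p using Quotient.inductionOn with | _ p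
    induction q using Quotient.inductionOn with | _ q
    obtain ⟨H⟩ := Quotient.exact hpq
    have hp : ∀ z ∈ Cube.boundary (Fin k), p z = x := p.2
    have hq : ∀ z ∈ Cube.boundary (Fin k), q z = x := q.2
    have ht : Continuous (Fin.tail : (Fin (k + 1) → I) → Fin k → I) :=
      continuous_pi fun i => continuous_apply _
    let v : (Fin (k + 1) → I) → X := fun y => if y 0 = 0 then p (Fin.tail y) else q (Fin.tail y)
    have v0 : ∀ y, y 0 = 0 → v y = p (Fin.tail y) := fun y hy => if_pos hy
    have v1 : ∀ y, y 0 = 1 → v y = q (Fin.tail y) := fun y hy => if_neg (by simp [hy])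
    have vb : ∀ y : Fin (k + 1) → I, Fin.tail y ∈ Cube.boundary (Fin k) → v y = x := fun y hy => by
      simp only [v]; split_ifs
      exacts [hp _ hy, hq _ hy]
    have hv : ContinuousOn v (Cube.boundary (Fin (k + 1))) := by
      have c1 : ∀ t : I, IsClosed {y : Fin (k + 1) → I | y 0 = t} := fun t =>
        isClosed_eq (continuous_apply 0) continuous_const
      have c2 := (Cube.isClosed_boundary k).preimage ht
      rw [Cube.boundary_succ]
      refine ContinuousOn.union_of_isClosed ?_ (ContinuousOn.union_of_isClosed ?_ ?_ (c1 _) c2)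
        (c1 _) ((c1 _).union c2)
      · exact (p.1.continuous.comp ht).continuousOn.congr v0
      · exact (q.1.continuous.comp ht).continuousOn.congr v1
      · exact (continuousOn_const (c := x)).congr vb
    have hv' : ∀ y ∈ Cube.boundary (Fin (k + 1)), φ (v y) = H (y 0, Fin.tail y) := by
      rw [Cube.boundary_succ]
      rintro y (hy | hy | hy)
      · rw [v0 y hy, show y 0 = 0 from hy]
        exact (H.apply_zero _).symm
      · rw [v1 y hy, show y 0 = 1 from hy]
        exact (H.apply_one _).symm
      · rw [vb y hy, H.eq_fst _ hy]
        exact congrArg φ (hp _ hy).symm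
    obtain ⟨w, hw, -, hw2⟩ := hf (k + 1) (fun y => H (y 0, Fin.tail y)) v (by fun_prop) hv hv'
    refine Quotient.sound ⟨⟨⟨⟨fun y => w (Fin.cons y.1 y.2), ?_⟩, fun z => ?_, fun z => ?_⟩, ?_⟩⟩
    · refine hw.comp (continuous_pi fun i => Fin.cases ?_ (fun i => ?_) i)
      · exact continuous_fst
      · exact (continuous_apply i).comp continuous_snd
    · exact (hw2 _ ⟨0, Or.inl rfl⟩).trans (v0 _ rfl)
    · exact (hw2 _ ⟨0, Or.inr rfl⟩).trans (v1 _ rfl)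
    · intro t z hz
      have hz' : Fin.tail (Fin.cons t z : Fin (k + 1) → I) ∈ Cube.boundary (Fin k) := hz
      refine (hw2 _ ?_).trans ((vb _ hz').trans (hp z hz).symm)
      rw [Cube.boundary_succ]
      exact Or.inr (Or.inr hz')
  · intro p
    induction p using Quotient.inductionOn with | _ p
    obtain ⟨w, hw, hw1, hw2⟩ := hf k p (fun _ => x) p.1.continuous continuousOn_const
      fun y hy => h.trans (p.2 y hy).symm
    exact ⟨Quotient.mk _ ⟨⟨w, hw⟩, hw2⟩, congrArg (Quotient.mk _) (GenLoop.ext _ _ hw1)⟩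

end HomotopyGroup

/-! ### The adjunction between loops and homotopy groups -/

namespace GenLoop

variable {X : Type*} [TopologicalSpace X] {x : X}

theorem continuous_cons (k : ℕ) :
    Continuous fun p : I × (Fin k → I) => (Fin.cons p.1 p.2 : Fin (k + 1) → I) :=
  continuous_pi fun i => Fin.cases continuous_fst
    (fun i => (continuous_apply i).comp continuous_snd) i

theorem continuous_tail (k : ℕ) : Continuous (Fin.tail : (Fin (k + 1) → I) → Fin k → I) :=
  continuous_pi fun _ => continuous_apply _

/-- Families of loops, indexed by a cube, are maps of a cube of one dimension more. -/
def loopAdjoint (k : ℕ) : GenLoop (Fin k) (Path x x) (Path.refl x) ≃ GenLoop (Fin (k + 1)) X x where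
  toFun p := ⟨⟨fun y => p (Fin.tail y) (y 0), by
      have := continuous_tail k
      fun_prop⟩, fun y hy => by
    rw [Cube.boundary_succ] at hy
    rcases hy with hy | hy | hy
    · change p (Fin.tail y) (y 0) = x
      rw [show y 0 = 0 from hy, Path.source]
    · change p (Fin.tail y) (y 0) = x
      rw [show y 0 = 1 from hy, Path.target]
    · change p (Fin.tail y) (y 0) = x
      rw [show p (Fin.tail y) = Path.refl x from p.2 _ hy]; rfl⟩
  invFun q := ⟨⟨fun z =>
      { toFun := fun s => q (Fin.cons s z)
        continuous_toFun := q.1.continuous.comp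
          ((continuous_cons k).comp (by fun_prop : Continuous fun s : I => (s, z)))
        source' := q.2 _ ⟨0, Or.inl rfl⟩
        target' := q.2 _ ⟨0, Or.inr rfl⟩ }, by
      refine Path.continuous_uncurry_iff.1 ?_
      exact q.1.continuous.comp ((continuous_cons k).comp continuous_swap)⟩, fun z hz => by
    ext s
    refine q.2 _ ?_
    rw [Cube.boundary_succ]
    exact Or.inr (Or.inr hz)⟩
  left_inv p := rfl
  right_inv q := by
    ext y
    change q (Fin.cons (y 0) (Fin.tail y)) = q y
    rw [Fin.cons_self_tail]

theorem loopAdjoint_apply {k : ℕ} (p : GenLoop (Fin k) (Path x x) (Path.refl x))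
    (y : Fin (k + 1) → I) : loopAdjoint k p y = p (Fin.tail y) (y 0) := rfl

/-- Both homotopies are the same function of homotopy time, parameter and loop time. The two
additional faces of the larger cube are the end points of the loops, where every path takes the
value `x`. -/
theorem loopAdjoint_homotopic {k : ℕ} {p q : GenLoop (Fin k) (Path x x) (Path.refl x)} :
    Homotopic p q ↔ Homotopic (loopAdjoint k p) (loopAdjoint k q) := by
  refine ⟨fun ⟨H⟩ => ⟨⟨⟨⟨fun z => H (z.1, Fin.tail z.2) (z.2 0), ?_⟩, fun y => ?_, fun y => ?_⟩, ?_⟩⟩,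
    fun ⟨H⟩ => ?_⟩
  · have := continuous_tail k
    fun_prop
  · change H (0, Fin.tail y) (y 0) = _
    rw [H.apply_zero]; rfl
  · change H (1, Fin.tail y) (y 0) = _
    rw [H.apply_one]; rfl
  · rw [Cube.boundary_succ]
    rintro t y (hy | hy | hy)
    · change H (t, Fin.tail y) (y 0) = p (Fin.tail y) (y 0)
      rw [show y 0 = 0 from hy, Path.source, Path.source]
    · change H (t, Fin.tail y) (y 0) = p (Fin.tail y) (y 0)
      rw [show y 0 = 1 from hy, Path.target, Path.target]
    · change H (t, Fin.tail y) (y 0) = p (Fin.tail y) (y 0)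
      rw [H.eq_fst t hy]; rfl
  · have hb : ∀ y ∈ Cube.boundary (Fin (k + 1)), ∀ t, H (t, y) = x := fun y hy t =>
      (H.eq_fst t hy).trans ((loopAdjoint k p).2 y hy)
    let K : I × (Fin k → I) → Path x x := fun z =>
      { toFun := fun s => H (z.1, Fin.cons s z.2)
        continuous_toFun := H.continuous.comp (continuous_const.prodMk
          ((continuous_cons k).comp (by fun_prop : Continuous fun s : I => (s, z.2))))
        source' := hb _ ⟨0, Or.inl rfl⟩ _
        target' := hb _ ⟨0, Or.inr rfl⟩ _ }
    have hK : Continuous K := by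
      refine Path.continuous_uncurry_iff.1 ?_
      exact H.continuous.comp ((by fun_prop : Continuous fun z : (I × (Fin k → I)) × I =>
        z.1.1).prodMk ((continuous_cons k).comp (by fun_prop :
          Continuous fun z : (I × (Fin k → I)) × I => (z.2, z.1.2))))
    refine ⟨⟨⟨⟨K, hK⟩, fun z => ?_, fun z => ?_⟩, fun t z hz => ?_⟩⟩
    · ext s; exact H.apply_zero _
    · ext s; exact H.apply_one _
    · ext s
      refine H.eq_fst t ?_
      rw [Cube.boundary_succ]
      exact Or.inr (Or.inr hz)

/-- Loop time occupies the coordinate 0, so the parameter coordinate `i` becomes `i.succ`, and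
changing it commutes with `Fin.tail`. -/
theorem loopAdjoint_transAt {k : ℕ} (i : Fin k) (p q : GenLoop (Fin k) (Path x x) (Path.refl x)) :
    loopAdjoint k (transAt i p q) = transAt i.succ (loopAdjoint k p) (loopAdjoint k q) := by
  have e : ∀ (y : Fin (k + 1) → I) (s : I),
      Fin.tail (Function.update y i.succ s) = Function.update (Fin.tail y) i s := fun y s => by
    simp
  ext y
  rw [loopAdjoint_apply]
  simp only [transAt, coe_copy, loopAdjoint_apply, e,
    Function.update_of_ne (Fin.succ_ne_zero i).symm]
  rw [show Fin.tail y i = y i.succ from rfl]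
  split_ifs <;> rfl

end GenLoop

namespace HomotopyGroup

variable {X X' : Type*} [TopologicalSpace X] [TopologicalSpace X'] {x : X} {x' : X'}

/-- The isomorphism `π_k(Ω X) ≃ π_{k+1}(X)`. -/
def loopEquiv (k : ℕ) (x : X) : HomotopyGroup.Pi k (Path x x) (Path.refl x) ≃
    HomotopyGroup.Pi (k + 1) X x :=
  Quotient.congr (GenLoop.loopAdjoint k) fun _ _ => GenLoop.loopAdjoint_homotopic

/-- The product may be computed by concatenation in any coordinate: here the parameter coordinate 0
on one side and its image `(0 : Fin (k + 1)).succ` on the other, so that no interchange of loop time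
with parameters is needed. -/
theorem loopEquiv_mul (k : ℕ) (p q : HomotopyGroup.Pi (k + 1) (Path x x) (Path.refl x)) :
    loopEquiv (k + 1) x (p * q) = loopEquiv (k + 1) x p * loopEquiv (k + 1) x q := by
  induction p using Quotient.inductionOn with | _ p
  induction q using Quotient.inductionOn with | _ q
  have e := HomotopyGroup.mul_spec (i := (0 : Fin (k + 1))) (p := p) (q := q)
  refine (congrArg (loopEquiv (k + 1) x) e).trans
    (Eq.trans ?_ (HomotopyGroup.mul_spec (i := (0 : Fin (k + 1)).succ)).symm)
  exact congrArg (Quotient.mk _) (GenLoop.loopAdjoint_transAt 0 q p)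

/-- The path component of a point, as an element of `π_0`. -/
def ofPoint (x y : X) : HomotopyGroup.Pi 0 X x :=
  Quotient.mk _ ⟨ContinuousMap.const _ y, fun _ ⟨i, _⟩ => i.elim0⟩

/-- Without parameters the only coordinate is loop time, and `Path.trans` is concatenation in it. -/
theorem loopEquiv_ofPoint_trans (p q : Path x x) :
    loopEquiv 0 x (ofPoint _ (p.trans q)) =
      seqMul (loopEquiv 0 x (ofPoint _ p)) (loopEquiv 0 x (ofPoint _ q)) := by
  refine Eq.trans ?_ (seqMul_mk 0 _ _).symm
  refine congrArg (Quotient.mk _) (GenLoop.ext _ _ fun y => ?_)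
  rw [GenLoop.loopAdjoint_apply]
  simp only [GenLoop.transAt, GenLoop.coe_copy, GenLoop.loopAdjoint_apply,
    Function.update_self]
  change p.trans q (y 0) = if _ then p _ else q _
  rw [Path.trans_apply]
  split_ifs with h
  · exact congrArg p (projIcc_of_mem _ _).symm
  · exact congrArg q (projIcc_of_mem _ _).symm

theorem loopEquiv_induced {φ : X → X'} (hφ : Continuous φ) (h : φ x = x') (k : ℕ)
    (ψ : Path x x → Path x' x') (hψ : Continuous ψ) (h' : ψ (Path.refl x) = Path.refl x')
    (hs : ∀ p s, ψ p s = φ (p s)) (p : HomotopyGroup.Pi k (Path x x) (Path.refl x)) :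
    loopEquiv k x' (induced ψ hψ h' p) = induced φ hφ h (loopEquiv k x p) := by
  induction p using Quotient.inductionOn with | _ p
  exact congrArg (Quotient.mk _) (GenLoop.ext _ _ fun y => hs _ _)

end HomotopyGroup

/-! ### Milnor's space -/

namespace MilnorE

variable {G : Type u}

/-- The coordinate function `g_i`, with an arbitrary value where `t_i = 0`. -/
def coord (i : ℕ) (e : MilnorE G) : G := (Quotient.out e).g i

theorem coord_mk (p : MilnorJoin G) {i : ℕ} (h : 0 < p.t i) :
    coord i (Quotient.mk _ p : MilnorE G) = p.g i := by
  have hq := Quotient.exact (Quotient.out_eq (Quotient.mk (MilnorJoin.setoid G) p))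
  exact hq.2 i (hq.1 ▸ h)

theorem coordMem_iff {i : ℕ} {S : Set G} {e : MilnorE G} :
    coordMem i S e ↔ 0 < t i e ∧ coord i e ∈ S := by
  induction e using Quotient.inductionOn with | _ p
  constructor
  · intro h
    exact ⟨h.1, by rw [coord_mk p h.1]; exact h.2⟩
  · rintro ⟨h1, h2⟩
    rw [coord_mk p h1] at h2
    exact ⟨h1, h2⟩

theorem ext {e e' : MilnorE G} (h : ∀ i, t i e = t i e')
    (h' : ∀ i, 0 < t i e → coord i e = coord i e') : e = e' := by
  induction e using Quotient.inductionOn with | _ p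
  induction e' using Quotient.inductionOn with | _ q
  refine Quotient.sound ⟨funext h, fun i hi => ?_⟩
  have hq : 0 < q.t i := by
    have := h i
    change p.t i = q.t i at this
    rwa [this] at hi
  rw [← coord_mk p hi, ← coord_mk q hq]
  exact h' i hi

theorem t_nonneg (i : ℕ) (e : MilnorE G) : 0 ≤ t i e := by
  induction e using Quotient.inductionOn with | _ p
  exact (p.t_mem i).1

theorem exists_range (e : MilnorE G) :
    ∃ n, (∀ i, n ≤ i → t i e = 0) ∧ ∑ i ∈ Finset.range n, t i e = 1 := by
  induction e using Quotient.inductionOn with | _ p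
  obtain ⟨n, hn⟩ := p.finite.toFinset.exists_nat_subset_range
  have h0 : ∀ i, n ≤ i → p.t i = 0 := fun i hi => by
    by_contra h
    have := hn (p.finite.mem_toFinset.2 h)
    rw [Finset.mem_range] at this
    omega
  refine ⟨n, h0, ?_⟩
  rw [← p.sum_eq]
  refine (Finset.sum_subset hn fun i _ hi => ?_).symm
  by_contra h
  exact hi (p.finite.mem_toFinset.2 h)

theorem exists_t_pos (e : MilnorE G) : ∃ i, 0 < t i e := by
  obtain ⟨n, -, h⟩ := e.exists_range
  by_contra! h'
  rw [Finset.sum_eq_zero fun i _ => le_antisymm (h' i) (t_nonneg i e)] at h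
  exact zero_ne_one h

/-- The point of `EG` with given coordinates. -/
def ofCoords (s : ℕ → ℝ) (g : ℕ → G) (h0 : ∀ i, 0 ≤ s i)
    (h : ∃ n, (∀ i, n ≤ i → s i = 0) ∧ ∑ i ∈ Finset.range n, s i = 1) : MilnorE G :=
  have hlt : ∀ n, (∀ i, n ≤ i → s i = 0) → ∀ i, s i ≠ 0 → i ∈ Finset.range n :=
    fun n hn i hi => by
      rw [Finset.mem_range]; by_contra hi'; exact hi (hn i (not_lt.1 hi'))
  have hfin : {i | s i ≠ 0}.Finite := by
    obtain ⟨n, hn, -⟩ := h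
    exact (Finset.range n).finite_toSet.subset (hlt n hn)
  Quotient.mk _
    { t := s
      g := g
      t_mem := fun i => ⟨h0 i, by
        obtain ⟨n, hn, hs⟩ := h
        by_cases hi : s i = 0
        · rw [hi]; exact zero_le_one
        · rw [← hs]; exact Finset.single_le_sum (fun j _ => h0 j) (hlt n hn i hi)⟩
      finite := hfin
      sum_eq := by
        obtain ⟨n, hn, hs⟩ := h
        rw [← hs]
        refine Finset.sum_subset (fun i hi => hlt n hn i (hfin.mem_toFinset.1 hi))
          fun i _ hi => ?_
        by_contra h
        exact hi (hfin.mem_toFinset.2 h) }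

theorem coord_ofCoords {s : ℕ → ℝ} {g : ℕ → G} {h0 h} {i : ℕ} (hi : 0 < s i) :
    coord i (ofCoords s g h0 h) = g i := coord_mk _ hi

theorem t_map {G' : Type u} (φ : G → G') (i : ℕ) (e : MilnorE G) : t i (map φ e) = t i e := by
  induction e using Quotient.inductionOn with | _ p
  rfl

theorem coord_map {G' : Type u} (φ : G → G') {i : ℕ} {e : MilnorE G} (h : 0 < t i e) :
    coord i (map φ e) = φ (coord i e) := by
  induction e using Quotient.inductionOn with | _ p
  rw [coord_mk p h]
  exact coord_mk _ h

section Topology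

variable [TopologicalSpace G]

theorem continuous_t (i : ℕ) : Continuous (t i : MilnorE G → ℝ) :=
  ⟨fun S hS => TopologicalSpace.isOpen_generateFrom_of_mem (Or.inl ⟨i, S, hS, rfl⟩)⟩

theorem isOpen_t_pos (i : ℕ) : IsOpen {e : MilnorE G | 0 < t i e} :=
  isOpen_lt continuous_const (continuous_t i)

theorem continuousAt_coord {i : ℕ} {e : MilnorE G} (h : 0 < t i e) :
    ContinuousAt (coord i) e := by
  intro S hS
  obtain ⟨S', hS', hSo, hm⟩ := mem_nhds_iff.1 hS
  have ho : IsOpen {e : MilnorE G | coordMem i S' e} :=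
    TopologicalSpace.isOpen_generateFrom_of_mem (Or.inr ⟨i, S', hSo, rfl⟩)
  have he : e ∈ {e : MilnorE G | coordMem i S' e} := coordMem_iff.2 ⟨h, hm⟩
  exact Filter.mem_map.2 (Filter.mem_of_superset (ho.mem_nhds he) fun e' he' =>
    hS' (coordMem_iff.1 (show coordMem i S' e' from he')).2)

/-- The generating open sets test one `t_i` or one `g_i` at a time, the latter only where `t_i > 0`.
The arbitrary values of `coord` elsewhere therefore play no role. -/
theorem continuous_of_coords {Z : Type*} [TopologicalSpace Z] {f : Z → MilnorE G}
    (ht : ∀ i, Continuous fun z => t i (f z))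
    (hg : ∀ i z, 0 < t i (f z) → ContinuousAt (fun z => coord i (f z)) z) : Continuous f := by
  refine continuous_generateFrom_iff.2 ?_
  rintro O (⟨i, S, hS, rfl⟩ | ⟨i, S, hS, rfl⟩)
  · exact hS.preimage (ht i)
  · refine isOpen_iff_mem_nhds.2 fun z hz => ?_
    obtain ⟨h1, h2⟩ := coordMem_iff.1 hz
    filter_upwards [(isOpen_lt continuous_const (ht i)).mem_nhds h1,
      (hg i z h1).preimage_mem_nhds (hS.mem_nhds h2)] with w hw1 hw2
    exact coordMem_iff.2 ⟨hw1, hw2⟩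

end Topology

section Action

variable [Group G]

theorem t_mulRight (i : ℕ) (e : MilnorE G) (h : G) : t i (e.mulRight h) = t i e := t_map _ _ _

theorem coord_mulRight {i : ℕ} {e : MilnorE G} (hi : 0 < t i e) (h : G) :
    coord i (e.mulRight h) = coord i e * h := coord_map _ hi

theorem continuous_mulRight [TopologicalSpace G] [ContinuousMul G] :
    Continuous fun p : MilnorE G × G => p.1.mulRight p.2 := by
  refine continuous_of_coords (fun i => ?_) fun i p hp => ?_
  · simp only [t_mulRight]
    exact (continuous_t i).comp continuous_fst
  · simp only [t_mulRight] at hp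
    have h1 : ContinuousAt (fun p : MilnorE G × G => coord i p.1) p :=
      (continuousAt_coord hp).comp continuous_fst.continuousAt
    refine (h1.mul continuous_snd.continuousAt).congr ?_
    filter_upwards [((isOpen_t_pos i).preimage continuous_fst).mem_nhds hp] with w hw
    exact (coord_mulRight hw _).symm

end Action

/-! ### Contractibility of `EG`. -/

/-- At time `s`, the fraction of the `i`-th coordinate that has been moved to the next place. -/
def moved (i : ℕ) (s : ℝ) : ℝ := projIcc (0 : ℝ) 1 zero_le_one (2 ^ (i + 1) * s - 1)

theorem moved_mem (i : ℕ) (s : ℝ) : moved i s ∈ Icc (0 : ℝ) 1 := Subtype.coe_prop _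

theorem continuous_moved (i : ℕ) : Continuous (moved i) := by
  unfold moved
  exact continuous_subtype_val.comp (continuous_projIcc.comp (by fun_prop))

theorem moved_zero (i : ℕ) : moved i 0 = 0 := by
  unfold moved
  rw [projIcc_of_le_left zero_le_one (by norm_num)]

theorem moved_one (i : ℕ) : moved i 1 = 1 := by
  unfold moved
  rw [projIcc_of_right_le zero_le_one]
  have : (1 : ℝ) ≤ 2 ^ i := one_le_pow₀ one_le_two
  rw [pow_succ]; linarith

/-- The coordinate `i` moves while `s` runs from `2⁻⁽ⁱ⁺¹⁾` to `2⁻ⁱ`, so later coordinates move first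
and the place `i + 1` has been vacated before the coordinate `i` starts to enter it. Thus no place
ever has to carry two group elements. -/
theorem moved_succ {i : ℕ} {s : ℝ} (h : 0 < moved i s) : moved (i + 1) s = 1 := by
  unfold moved at h ⊢
  have h' : 0 < 2 ^ (i + 1) * s - 1 := by
    by_contra! hn
    rw [projIcc_of_le_left zero_le_one hn] at h
    exact lt_irrefl _ h
  rw [projIcc_of_right_le zero_le_one]
  rw [pow_succ]; linarith

/-- The contribution of the preceding coordinate to the `i`-th coordinate at time `s`. -/
def received (e : MilnorE G) (s : ℝ) : ℕ → ℝ
  | 0 => 0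
  | i + 1 => moved i s * t i e

theorem received_nonneg (e : MilnorE G) (s : ℝ) (i : ℕ) : 0 ≤ received e s i := by
  cases i with
  | zero => exact le_rfl
  | succ i => exact mul_nonneg (moved_mem i s).1 (t_nonneg i e)

/-- The homotopy of the identity to the shift that moves one coordinate after another. -/
def shiftHomotopy (e : MilnorE G) (s : ℝ) : MilnorE G :=
  ofCoords (fun i => (1 - moved i s) * t i e + received e s i)
    (fun i => if moved i s < 1 then coord i e else coord (i - 1) e)
    (fun i => add_nonneg (mul_nonneg (sub_nonneg.2 (moved_mem i s).2) (t_nonneg i e))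
      (received_nonneg e s i))
    (by
      obtain ⟨n, hn, hs⟩ := e.exists_range
      -- What leaves one place arrives at the next, so the sum telescopes up to the part that has
      -- left the place `m`.
      have key : ∀ m, ∑ i ∈ Finset.range (m + 1), ((1 - moved i s) * t i e + received e s i) =
          ∑ i ∈ Finset.range (m + 1), t i e - moved m s * t m e := by
        intro m
        induction m with
        | zero => simp [received]; ring
        | succ m ih =>
          rw [Finset.sum_range_succ, ih, Finset.sum_range_succ _ (m + 1)]
          simp only [received]; ring
      refine ⟨n + 1, fun i hi => ?_, ?_⟩
      · obtain ⟨j, rfl⟩ : ∃ j, i = j + 1 := ⟨i - 1, by omega⟩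
        simp [received, hn j (by omega), hn (j + 1) (by omega)]
      · rw [key, Finset.sum_range_succ, hs, hn n le_rfl]; simp)

theorem t_shiftHomotopy (e : MilnorE G) (s : ℝ) (i : ℕ) :
    t i (shiftHomotopy e s) = (1 - moved i s) * t i e + received e s i := rfl

theorem coord_shiftHomotopy {e : MilnorE G} {s : ℝ} {i : ℕ} (h : 0 < t i (shiftHomotopy e s)) :
    coord i (shiftHomotopy e s) = if moved i s < 1 then coord i e else coord (i - 1) e :=
  coord_ofCoords (i := i) h

/-- For small `s > 0` all but finitely many coordinates have moved, but the topology of `EG` looks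
at one place at a time, and a place is affected by two moves only. Where a place has positive
weight, that weight is either its own or a received one, and by `moved_succ` the alternative used by
`coord` is locally constant. -/
theorem continuous_shiftHomotopy [TopologicalSpace G] :
    Continuous fun p : MilnorE G × ℝ => shiftHomotopy p.1 p.2 := by
  have hm : ∀ i, Continuous fun p : MilnorE G × ℝ => moved i p.2 := fun i =>
    (continuous_moved i).comp continuous_snd
  have ht : ∀ i, Continuous fun p : MilnorE G × ℝ => t i p.1 := fun i =>
    (continuous_t i).comp continuous_fst
  have hcont : ∀ i, Continuous fun p : MilnorE G × ℝ => t i (shiftHomotopy p.1 p.2) := by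
    intro i
    simp only [t_shiftHomotopy]
    refine ((continuous_const.sub (hm i)).mul (ht i)).add ?_
    cases i with
    | zero => exact continuous_const
    | succ i => exact (hm i).mul (ht i)
  refine continuous_of_coords hcont fun i p hp => ?_
  · have hnear := (isOpen_lt continuous_const (hcont i)).mem_nhds hp
    have hcomp : ∀ j, 0 < t j p.1 → ContinuousAt (fun p : MilnorE G × ℝ => coord j p.1) p :=
      fun j hj => (continuousAt_coord hj).comp continuous_fst.continuousAt
    rw [t_shiftHomotopy] at hp
    rcases (moved_mem i p.2).2.lt_or_eq with h | h
    · have h0 : received p.1 p.2 i = 0 := by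
        cases i with
        | zero => rfl
        | succ i =>
          rcases (moved_mem i p.2).1.lt_or_eq with h' | h'
          · exact absurd (moved_succ h') h.ne
          · simp [received, ← h']
      have hi : 0 < t i p.1 := by
        rw [h0, add_zero] at hp
        exact pos_of_mul_pos_right hp (sub_nonneg.2 (moved_mem i p.2).2)
      refine (hcomp i hi).congr ?_
      filter_upwards [hnear, (isOpen_lt (hm i) continuous_const).mem_nhds h] with w hw hw'
      exact ((coord_shiftHomotopy hw).trans (if_pos hw')).symm
    · cases i with
      | zero => simp [received, h] at hp
      | succ i =>
        simp only [h, sub_self, zero_mul, zero_add, received] at hp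
        have hi : 0 < t i p.1 := pos_of_mul_pos_right hp (moved_mem i p.2).1
        have hi' : 0 < moved i p.2 := pos_of_mul_pos_left hp (t_nonneg i p.1)
        refine (hcomp i hi).congr ?_
        filter_upwards [hnear, (isOpen_lt continuous_const (hm i)).mem_nhds hi'] with w hw hw'
        exact ((coord_shiftHomotopy hw).trans (if_neg (moved_succ hw').not_lt)).symm

/-- The linear homotopy of the shift to the base point. -/
def coneHomotopy [Group G] (e : MilnorE G) (s : I) : MilnorE G :=
  ofCoords (fun i => Nat.casesOn i (s : ℝ) fun i => (1 - s) * t i e)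
    (fun i => Nat.casesOn i 1 fun i => coord i e)
    (fun i => by
      cases i with
      | zero => exact s.2.1
      | succ i => exact mul_nonneg (sub_nonneg.2 s.2.2) (t_nonneg i e))
    (by
      obtain ⟨n, hn, hs⟩ := e.exists_range
      refine ⟨n + 1, fun i hi => ?_, ?_⟩
      · obtain ⟨j, rfl⟩ : ∃ j, i = j + 1 := ⟨i - 1, by omega⟩
        simp [hn j (by omega)]
      · rw [Finset.sum_range_succ']
        change ∑ i ∈ Finset.range n, (1 - (s : ℝ)) * t i e + s = 1
        rw [← Finset.mul_sum, hs]; ring)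

theorem t_coneHomotopy_zero [Group G] (e : MilnorE G) (s : I) : t 0 (coneHomotopy e s) = s := rfl

theorem t_coneHomotopy_succ [Group G] (e : MilnorE G) (s : I) (i : ℕ) :
    t (i + 1) (coneHomotopy e s) = (1 - s) * t i e := rfl

theorem coord_coneHomotopy_zero [Group G] {e : MilnorE G} {s : I} (h : 0 < t 0 (coneHomotopy e s)) :
    coord 0 (coneHomotopy e s) = 1 := coord_ofCoords (i := 0) h

theorem coord_coneHomotopy_succ [Group G] {e : MilnorE G} {s : I} {i : ℕ}
    (h : 0 < t (i + 1) (coneHomotopy e s)) :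
    coord (i + 1) (coneHomotopy e s) = coord i e := coord_ofCoords (i := i + 1) h

theorem continuous_coneHomotopy [TopologicalSpace G] [Group G] :
    Continuous fun p : MilnorE G × I => coneHomotopy p.1 p.2 := by
  have ht : ∀ i, Continuous fun p : MilnorE G × I => t i (coneHomotopy p.1 p.2) := by
    intro i
    cases i with
    | zero => exact continuous_subtype_val.comp continuous_snd
    | succ i =>
      simp only [t_coneHomotopy_succ]
      have : Continuous fun p : MilnorE G × I => 1 - (p.2 : ℝ) :=
        continuous_const.sub (continuous_subtype_val.comp continuous_snd)
      exact this.mul ((continuous_t i).comp continuous_fst)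
  refine continuous_of_coords ht fun i p hp => ?_
  have hnear := (isOpen_lt continuous_const (ht i)).mem_nhds hp
  cases i with
  | zero =>
    refine (continuousAt_const (y := (1 : G))).congr ?_
    filter_upwards [hnear] with w hw
    exact (coord_coneHomotopy_zero hw).symm
  | succ i =>
    rw [t_coneHomotopy_succ] at hp
    have hi : 0 < t i p.1 := pos_of_mul_pos_right hp (sub_nonneg.2 p.2.2.2)
    have h1 : ContinuousAt (fun p : MilnorE G × I => coord i p.1) p :=
      (continuousAt_coord hi).comp continuous_fst.continuousAt
    refine h1.congr ?_
    filter_upwards [hnear] with w hw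
    exact (coord_coneHomotopy_succ hw).symm

theorem shiftHomotopy_zero (e : MilnorE G) : shiftHomotopy e 0 = e := by
  have h : ∀ i, received e 0 i = 0 := fun i => by cases i <;> simp [received, moved_zero]
  refine ext (fun i => ?_) fun i hi => ?_
  · simp [t_shiftHomotopy, h, moved_zero]
  · exact (coord_shiftHomotopy hi).trans (if_pos (by simp [moved_zero]))

theorem shiftHomotopy_one [Group G] (e : MilnorE G) : shiftHomotopy e 1 = coneHomotopy e 0 := by
  refine ext (fun i => ?_) fun i hi => ?_
  · cases i <;> simp [t_shiftHomotopy, t_coneHomotopy_zero, t_coneHomotopy_succ, received, moved_one]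
  · have h := coord_shiftHomotopy hi
    rw [t_shiftHomotopy, moved_one, sub_self, zero_mul, zero_add] at hi
    rw [h, if_neg (moved_one i).not_lt]
    cases i with
    | zero => exact absurd hi (lt_irrefl _)
    | succ i =>
      refine (coord_coneHomotopy_succ ?_).symm
      simpa [t_coneHomotopy_succ, received, moved_one] using hi

theorem t_base [Group G] (i : ℕ) : t i (base G) = if i = 0 then 1 else 0 := rfl

theorem coneHomotopy_one [Group G] (e : MilnorE G) : coneHomotopy e 1 = base G := by
  refine ext (fun i => ?_) fun i hi => ?_
  · cases i <;> simp [t_coneHomotopy_zero, t_coneHomotopy_succ, t_base]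
  · cases i with
    | zero =>
      refine (coord_coneHomotopy_zero hi).trans (Eq.symm ?_)
      exact coord_mk _ (by norm_num)
    | succ i => simp [t_coneHomotopy_succ] at hi

/-- `EG` is contractible. -/
theorem exists_contraction [TopologicalSpace G] [Group G] :
    ∃ c : MilnorE G × I → MilnorE G, Continuous c ∧
    (∀ e, c (e, 0) = e) ∧ ∀ e, c (e, 1) = base G := by
  have hs : Continuous fun p : MilnorE G × I => (p.2 : ℝ) :=
    continuous_subtype_val.comp continuous_snd
  have h1 : Continuous fun p : MilnorE G × I => shiftHomotopy p.1 (2 * (p.2 : ℝ)) := by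
    have : Continuous fun p : MilnorE G × I => (p.1, 2 * (p.2 : ℝ)) :=
      continuous_fst.prodMk (continuous_const.mul hs)
    have h := (continuous_shiftHomotopy (G := G)).comp this
    exact h
  have h2 : Continuous fun p : MilnorE G × I =>
      coneHomotopy p.1 (projIcc 0 1 zero_le_one (2 * (p.2 : ℝ) - 1)) := by
    have : Continuous fun p : MilnorE G × I =>
        (p.1, projIcc (0 : ℝ) 1 zero_le_one (2 * (p.2 : ℝ) - 1)) :=
      continuous_fst.prodMk (continuous_projIcc.comp (by fun_prop))
    have h := (continuous_coneHomotopy (G := G)).comp this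
    exact h
  refine ⟨fun p => if (p.2 : ℝ) ≤ 1 / 2 then shiftHomotopy p.1 (2 * (p.2 : ℝ))
    else coneHomotopy p.1 (projIcc 0 1 zero_le_one (2 * (p.2 : ℝ) - 1)), ?_, fun e => ?_, fun e => ?_⟩
  · refine Continuous.if_le h1 h2 hs continuous_const fun p hp => ?_
    rw [hp, projIcc_of_le_left zero_le_one (by norm_num), show (2 : ℝ) * (1 / 2) = 1 by norm_num]
    exact shiftHomotopy_one _
  · simp [shiftHomotopy_zero]
  · have h : ¬ ((1 : I) : ℝ) ≤ 1 / 2 := by norm_num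
    change (if _ then _ else _) = _
    rw [if_neg h, projIcc_of_right_le zero_le_one (by norm_num)]
    exact coneHomotopy_one e

end MilnorE

/-! ### The principal bundle over the Borel space -/

namespace GSpace

variable (A : GSpace.{u, v})

/-- The projection `EG × Y → Y_G`. -/
def borelProj (z : MilnorE A.G × A.Y) : A.Borel := Quotient.mk _ z

/-- The action of `G` on `EG × Y` with orbit space `Y_G`. -/
def borelAct (g : A.G) (z : MilnorE A.G × A.Y) : MilnorE A.G × A.Y := (z.1.mulRight g⁻¹, g • z.2)

variable {A}

theorem borelAct_one (z : MilnorE A.G × A.Y) : A.borelAct 1 z = z := by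
  simp [borelAct, MilnorE.mulRight_one]

theorem borelAct_mul (g h : A.G) (z : MilnorE A.G × A.Y) :
    A.borelAct (g * h) z = A.borelAct g (A.borelAct h z) := by
  simp [borelAct, MilnorE.mulRight_mul, mul_smul]

theorem borelProj_borelAct (g : A.G) (z : MilnorE A.G × A.Y) :
    A.borelProj (A.borelAct g z) = A.borelProj z :=
  Quotient.sound ⟨g⁻¹, rfl, by simp [borelAct]⟩

theorem exists_borelAct_eq {z w : MilnorE A.G × A.Y} (h : A.borelProj z = A.borelProj w) :
    ∃ g, A.borelAct g z = w := by
  obtain ⟨g, h1, h2⟩ := Quotient.exact h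
  exact ⟨g, Prod.ext (by simp [borelAct, h1, MilnorE.mulRight_mul, MilnorE.mulRight_one]) h2.symm⟩

theorem continuous_borelAct : Continuous fun p : A.G × (MilnorE A.G × A.Y) => A.borelAct p.1 p.2 := by
  have h1 : Continuous fun p : A.G × (MilnorE A.G × A.Y) => (p.2.1, p.1⁻¹) :=
    (continuous_fst.comp continuous_snd).prodMk continuous_fst.inv
  have h2 := (MilnorE.continuous_mulRight (G := A.G)).comp h1
  exact h2.prodMk (continuous_fst.smul (continuous_snd.comp continuous_snd))

theorem continuous_borelAct_const (g : A.G) : Continuous (A.borelAct g) :=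
  continuous_borelAct.comp (continuous_const.prodMk continuous_id)

theorem continuous_borelProj : Continuous A.borelProj := continuous_quotient_mk'

theorem isOpenMap_borelProj : IsOpenMap A.borelProj := by
  intro V hV
  have e : A.borelProj ⁻¹' (A.borelProj '' V) = ⋃ g : A.G, A.borelAct g ⁻¹' V := by
    ext z
    simp only [mem_preimage, mem_image, mem_iUnion]
    constructor
    · rintro ⟨w, hw, h⟩
      obtain ⟨g, rfl⟩ := exists_borelAct_eq h.symm
      exact ⟨g, hw⟩
    · rintro ⟨g, hg⟩
      exact ⟨_, hg, borelProj_borelAct g z⟩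
  have : IsOpen (A.borelProj ⁻¹' (A.borelProj '' V)) := by
    rw [e]
    exact isOpen_iUnion fun g => hV.preimage (continuous_borelAct_const g)
  exact this

/-! ### The translation function of the free action. -/

variable (A) in
/-- The group element that takes `z` to `w`, for points `z, w` over the same point of `Y_G`. -/
def borelDiff (z w : MilnorE A.G × A.Y) : A.G :=
  (MilnorE.coord z.1.exists_t_pos.choose w.1)⁻¹ * MilnorE.coord z.1.exists_t_pos.choose z.1

/-- The action multiplies every coordinate by `g⁻¹` on the right, so `g` can be read off from any
coordinate of positive weight. In particular the action is free. -/
theorem eq_coord_of_borelAct {g : A.G} {z w : MilnorE A.G × A.Y} (h : A.borelAct g z = w) {i : ℕ}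
    (hi : 0 < MilnorE.t i z.1) : g = (MilnorE.coord i w.1)⁻¹ * MilnorE.coord i z.1 := by
  subst h
  simp [borelAct, MilnorE.coord_mulRight hi]

theorem borelAct_borelDiff {z w : MilnorE A.G × A.Y} (h : A.borelProj z = A.borelProj w) :
    A.borelAct (A.borelDiff z w) z = w := by
  obtain ⟨g, hg⟩ := exists_borelAct_eq h
  rwa [borelDiff, ← eq_coord_of_borelAct hg z.1.exists_t_pos.choose_spec]

theorem borelDiff_eq {z w : MilnorE A.G × A.Y} {g : A.G} (h : A.borelAct g z = w) :
    A.borelDiff z w = g :=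
  (eq_coord_of_borelAct h z.1.exists_t_pos.choose_spec).symm

/-- The index chosen in `borelDiff` may jump from point to point, but every index of positive weight
yields the same element. Near a given point one fixed index serves, and its formula is continuous.
-/
theorem continuousOn_borelDiff {X : Type*} [TopologicalSpace X] {D : Set X}
    {f g : X → MilnorE A.G × A.Y} (hf : ContinuousOn f D) (hg : ContinuousOn g D)
    (h : ∀ x ∈ D, A.borelProj (f x) = A.borelProj (g x)) :
    ContinuousOn (fun x => A.borelDiff (f x) (g x)) D := by
  intro x hx
  obtain ⟨i, hi⟩ := (f x).1.exists_t_pos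
  have key : ∀ y ∈ D, 0 < MilnorE.t i (f y).1 →
      A.borelDiff (f y) (g y) = (MilnorE.coord i (g y).1)⁻¹ * MilnorE.coord i (f y).1 :=
    fun y hy hiy => eq_coord_of_borelAct (borelAct_borelDiff (h y hy)) hiy
  have hi' : 0 < MilnorE.t i (g x).1 := by
    rw [← borelAct_borelDiff (h x hx)]
    exact hi.trans_eq (MilnorE.t_mulRight _ _ _).symm
  have cf := continuous_fst.continuousAt.comp_continuousWithinAt (hf x hx)
  have cg := continuous_fst.continuousAt.comp_continuousWithinAt (hg x hx)
  have c1 := ContinuousAt.comp_continuousWithinAt (f := Prod.fst ∘ f) (x := x)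
    (MilnorE.continuousAt_coord hi) cf
  have c2 := ContinuousAt.comp_continuousWithinAt (f := Prod.fst ∘ g) (x := x)
    (MilnorE.continuousAt_coord hi') cg
  refine (c2.inv.mul c1).congr_of_eventuallyEq ?_ (key x hx hi)
  filter_upwards [self_mem_nhdsWithin,
    cf.preimage_mem_nhdsWithin ((MilnorE.isOpen_t_pos i).mem_nhds hi)] with y hy hy'
  exact key y hy hy'

/-! ### Local sections, and lifts of cubes and homotopies. -/

variable (A) in
/-- The image in `Y_G` of the set of points with `t_i > 0`. -/
def chart (i : ℕ) : Set A.Borel := A.borelProj '' {z | 0 < MilnorE.t i z.1}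

theorem isOpen_chart (i : ℕ) : IsOpen (A.chart i) :=
  isOpenMap_borelProj _ ((MilnorE.isOpen_t_pos i).preimage continuous_fst)

theorem exists_mem_chart (b : A.Borel) : ∃ i, b ∈ A.chart i := by
  induction b using Quotient.inductionOn with | _ z
  obtain ⟨i, hi⟩ := z.1.exists_t_pos
  exact ⟨i, z, hi, rfl⟩

/-- The Borel space has local sections. -/
theorem exists_section (i : ℕ) : ∃ s : A.Borel → MilnorE A.G × A.Y, ContinuousOn s (A.chart i) ∧
    ∀ b ∈ A.chart i, A.borelProj (s b) = b := by
  -- Acting by `g_i` turns the `i`-th coordinate into 1. This normal form depends only on the orbit,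
  -- hence it descends to a section; its continuity follows as `borelProj` is open.
  let N : MilnorE A.G × A.Y → MilnorE A.G × A.Y := fun z => A.borelAct (MilnorE.coord i z.1) z
  have hN : ∀ z, 0 < MilnorE.t i z.1 → ContinuousAt N z := fun z hz =>
    continuous_borelAct.continuousAt.comp
      (((MilnorE.continuousAt_coord hz).comp continuous_fst.continuousAt).prodMk continuousAt_id)
  have hinv : ∀ z w, 0 < MilnorE.t i z.1 → A.borelProj z = A.borelProj w → N w = N z := by
    intro z w hz h
    obtain ⟨g, rfl⟩ := exists_borelAct_eq h
    have : MilnorE.coord i (A.borelAct g z).1 = MilnorE.coord i z.1 * g⁻¹ :=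
      MilnorE.coord_mulRight hz _
    simp only [N, this]
    rw [← borelAct_mul, inv_mul_cancel_right]
  have hs : ∀ z, 0 < MilnorE.t i z.1 → N (Quotient.out (A.borelProj z)) = N z := fun z hz =>
    hinv z _ hz (Quotient.out_eq (A.borelProj z)).symm
  refine ⟨fun b => N (Quotient.out b), ?_, fun b _ => ?_⟩
  · rintro _ ⟨z, hz, rfl⟩
    refine ContinuousAt.continuousWithinAt ?_
    intro V hV
    simp only [hs z hz] at hV
    have h1 := Filter.inter_mem ((hN z hz).preimage_mem_nhds hV)
      (((MilnorE.isOpen_t_pos i).preimage continuous_fst).mem_nhds hz)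
    have h2 := isOpenMap_borelProj.image_mem_nhds h1
    refine Filter.mem_map.2 (Filter.mem_of_superset h2 ?_)
    rintro _ ⟨w, ⟨hw, hwi⟩, rfl⟩
    rw [mem_preimage, hs w hwi]
    exact hw
  · exact (borelProj_borelAct _ _).trans (Quotient.out_eq b)

/-- Partial lifts over two adjacent parts of a cube can be glued. -/
theorem exists_lift_union {n : ℕ} {F : (Fin n → I) → A.Borel} {D₁ D₂ : Set (Fin n → I)} {j : Fin n}
    {c : I} (c₁ : IsClosed D₁) (c₂ : IsClosed D₂) (h₁ : ∀ x ∈ D₁, x j ≤ c) (h₂ : ∀ x ∈ D₂, c ≤ x j)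
    (h₁₂ : ∀ x ∈ D₂, Function.update x j c ∈ D₁ ∩ D₂)
    (l₁ : ∃ L : (Fin n → I) → MilnorE A.G × A.Y, ContinuousOn L D₁ ∧ ∀ x ∈ D₁, A.borelProj (L x) = F x)
    (l₂ : ∃ L : (Fin n → I) → MilnorE A.G × A.Y, ContinuousOn L D₂ ∧ ∀ x ∈ D₂, A.borelProj (L x) = F x) :
    ∃ L : (Fin n → I) → MilnorE A.G × A.Y, ContinuousOn L (D₁ ∪ D₂) ∧
      ∀ x ∈ D₁ ∪ D₂, A.borelProj (L x) = F x := by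
  obtain ⟨L₁, k₁, p₁⟩ := l₁
  obtain ⟨L₂, k₂, p₂⟩ := l₂
  let q : (Fin n → I) → Fin n → I := fun x => Function.update x j c
  have hq : Continuous q := continuous_id.update j continuous_const
  -- The second lift is corrected by the group element that takes it to the first one on the common
  -- face. The correction is extended to `D₂` independently of the coordinate `j`.
  let M : (Fin n → I) → MilnorE A.G × A.Y := fun x =>
    A.borelAct (A.borelDiff (L₂ (q x)) (L₁ (q x))) (L₂ x)
  have kM : ContinuousOn M D₂ := by
    have kd : ContinuousOn (fun x => A.borelDiff (L₂ (q x)) (L₁ (q x))) D₂ :=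
      continuousOn_borelDiff (k₂.comp hq.continuousOn fun x hx => (h₁₂ x hx).2)
        (k₁.comp hq.continuousOn fun x hx => (h₁₂ x hx).1)
        fun x hx => (p₂ _ (h₁₂ x hx).2).trans (p₁ _ (h₁₂ x hx).1).symm
    exact continuous_borelAct.comp_continuousOn (kd.prodMk k₂)
  have hM : ∀ x ∈ D₁, x ∈ D₂ → M x = L₁ x := fun x hx hx' => by
    have : q x = x := by
      simp only [q, ← le_antisymm (h₁ x hx) (h₂ x hx'), Function.update_eq_self]
    simp only [M, this]
    exact borelAct_borelDiff ((p₂ x hx').trans (p₁ x hx).symm)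
  classical
  refine ⟨fun x => if x ∈ D₁ then L₁ x else M x, ContinuousOn.union_of_isClosed ?_ ?_ c₁ c₂, ?_⟩
  · exact k₁.congr fun x hx => if_pos hx
  · refine kM.congr fun x hx => ?_
    by_cases h : x ∈ D₁
    · simp only [if_pos h, hM x h hx]
    · simp only [if_neg h]
  · intro x hx
    by_cases h : x ∈ D₁
    · simp only [if_pos h, p₁ x h]
    · simp only [if_neg h]
      exact (borelProj_borelAct _ _).trans (p₂ x (hx.resolve_left h))

/-- Maps of cubes into the Borel space lift to `EG × Y`. -/
theorem exists_lift {n : ℕ} {F : (Fin n → I) → A.Borel} (hF : Continuous F) :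
    ∃ L : (Fin n → I) → MilnorE A.G × A.Y, Continuous L ∧ ∀ x, A.borelProj (L x) = F x := by
  obtain ⟨δ, hδ, hball⟩ := lebesgue_number_lemma_of_metric (isCompact_univ (X := Fin n → I))
    (fun i => (isOpen_chart (A := A) i).preimage hF)
    (fun x _ => mem_iUnion.2 (exists_mem_chart (F x)))
  obtain ⟨m, hm⟩ := exists_nat_one_div_lt hδ
  set M : ℝ := m + 1 with hM
  have hM0 : 0 < M := by positivity
  -- The cube is cut into `(m + 1)^n` small ones, each inside one chart. The coordinates in `S` are
  -- free, the others stay in the interval number `a i`. Induction on `S` leads from a small cube to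
  -- the whole cube.
  let box : Finset (Fin n) → (Fin n → ℕ) → Set (Fin n → I) := fun S a =>
    {x | ∀ i ∉ S, a i / M ≤ x i ∧ (x i : ℝ) ≤ (a i + 1) / M}
  have hclosed : ∀ S a, IsClosed (box S a) := fun S a => by
    have e : box S a = ⋂ i, ⋂ (_ : i ∉ S), {x : Fin n → I | (a i / M : ℝ) ≤ x i} ∩
        {x | (x i : ℝ) ≤ (a i + 1) / M} := by
      ext x; simp [box]
    rw [e]
    exact isClosed_iInter fun i => isClosed_iInter fun _ =>
      (isClosed_le (by fun_prop) (by fun_prop)).inter (isClosed_le (by fun_prop) (by fun_prop))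
  have key : ∀ (S : Finset (Fin n)) (a : Fin n → ℕ), (∀ i, a i ≤ m) →
      ∃ L : (Fin n → I) → MilnorE A.G × A.Y, ContinuousOn L (box S a) ∧
        ∀ x ∈ box S a, A.borelProj (L x) = F x := by
    intro S
    induction S using Finset.induction_on with
    | empty =>
      intro a ha
      have hz : ∀ i, (a i / M : ℝ) ∈ I := fun i => by
        have : (a i : ℝ) ≤ m := by exact_mod_cast ha i
        exact ⟨by positivity, (div_le_one hM0).2 (by linarith)⟩
      obtain ⟨i, hi⟩ := hball (fun i => ⟨a i / M, hz i⟩) (mem_univ _)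
      have hsub : ∀ x ∈ box ∅ a, F x ∈ A.chart i := fun x hx => by
        refine hi ?_
        rw [Metric.mem_ball]
        refine lt_of_le_of_lt ((dist_pi_le_iff (by positivity)).2 fun k => ?_) hm
        have := hx k (by simp)
        rw [Subtype.dist_eq, Real.dist_eq, abs_le]
        rw [add_div] at this
        constructor <;> linarith [this.1, this.2, one_div_pos.2 hM0]
      obtain ⟨s, hs, hs'⟩ := exists_section (A := A) i
      exact ⟨fun x => s (F x), hs.comp hF.continuousOn hsub, fun x hx => hs' _ (hsub x hx)⟩
    | insert j S hj ih =>
      intro a ha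
      -- To free the coordinate `j`, the slabs `b / M ≤ x j ≤ (b + 1) / M` are added one after
      -- another.
      have step : ∀ b : ℕ, b ≤ m + 1 → ∃ L : (Fin n → I) → MilnorE A.G × A.Y,
          ContinuousOn L (box (insert j S) a ∩ {x | (x j : ℝ) ≤ b / M}) ∧
          ∀ x ∈ box (insert j S) a ∩ {x | (x j : ℝ) ≤ b / M}, A.borelProj (L x) = F x := by
        intro b
        induction b with
        | zero =>
          intro _
          -- For `b = 0` only the face `x j = 0` remains, which is part of the first slab.
          obtain ⟨L, h1, h2⟩ := ih (Function.update a j 0) fun i => by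
            rcases eq_or_ne i j with rfl | h
            · simp
            · simpa [h] using ha i
          have hsub : box (insert j S) a ∩ {x | (x j : ℝ) ≤ (0 : ℕ) / M} ⊆
              box S (Function.update a j 0) := by
            rintro x ⟨hx, hxj⟩ i hi
            rcases eq_or_ne i j with rfl | h
            · have hxj' : (x i : ℝ) ≤ (0 : ℕ) / M := hxj
              rw [Nat.cast_zero, zero_div] at hxj'
              simp only [Function.update_self, Nat.cast_zero, zero_div]
              exact ⟨(x i).2.1, hxj'.trans (by positivity)⟩
            · rw [Function.update_of_ne h]
              exact hx i (by simp [h, hi])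
          exact ⟨L, h1.mono hsub, fun x hx => h2 x (hsub hx)⟩
        | succ b ihb =>
          intro hb
          have hbI : (b / M : ℝ) ∈ I := by
            have : (b : ℝ) + 1 ≤ m + 1 := by exact_mod_cast hb
            exact ⟨by positivity, (div_le_one hM0).2 (by linarith)⟩
          have hle : (b / M : ℝ) ≤ (b + 1) / M := by gcongr; linarith
          have e : box (insert j S) a ∩ {x | (x j : ℝ) ≤ (b + 1 : ℕ) / M} =
              (box (insert j S) a ∩ {x | (x j : ℝ) ≤ b / M}) ∪ box S (Function.update a j b) := by
            ext x
            constructor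
            · rintro ⟨hx, hxj⟩
              rcases le_total (x j : ℝ) (b / M) with h | h
              · exact Or.inl ⟨hx, h⟩
              · refine Or.inr fun i hi => ?_
                rcases eq_or_ne i j with rfl | h'
                · simp only [Function.update_self]
                  exact ⟨h, by simpa using hxj⟩
                · rw [Function.update_of_ne h']
                  exact hx i (by simp [h', hi])
            · rintro (⟨hx, hxj⟩ | hx)
              · exact ⟨hx, by simpa using le_trans hxj hle⟩
              · refine ⟨fun i hi => ?_, ?_⟩
                · have hi' : i ≠ j ∧ i ∉ S := by simpa using hi
                  have := hx i hi'.2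
                  rwa [Function.update_of_ne hi'.1] at this
                · simpa using (hx j hj).2
          rw [e]
          refine exists_lift_union (j := j) (c := ⟨b / M, hbI⟩) ?_ (hclosed _ _) (fun x hx => hx.2)
            (fun x hx => ?_) (fun x hx => ⟨⟨fun i hi => ?_, ?_⟩, fun i hi => ?_⟩)
            (ihb (by omega)) (ih _ fun i => ?_)
          · exact (hclosed _ _).inter (isClosed_le (by fun_prop) (by fun_prop))
          · refine Subtype.coe_le_coe.1 ?_
            simpa using (hx j hj).1
          · have hi' : i ≠ j ∧ i ∉ S := by simpa using hi
            have := hx i hi'.2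
            rw [Function.update_of_ne hi'.1] at this ⊢
            exact this
          · simp
          · have := hx i hi
            rcases eq_or_ne i j with rfl | h
            · simpa using hle
            · rw [Function.update_of_ne h] at this ⊢
              rwa [Function.update_of_ne h]
          · rcases eq_or_ne i j with rfl | h
            · simp; omega
            · simpa [h] using ha i
      obtain ⟨L, h1, h2⟩ := step (m + 1) le_rfl
      have hsub : box (insert j S) a ⊆
          box (insert j S) a ∩ {x | (x j : ℝ) ≤ (m + 1 : ℕ) / M} := fun x hx => ⟨hx, by
        have : ((m + 1 : ℕ) : ℝ) / M = 1 := by rw [hM]; push_cast; exact div_self hM0.ne'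
        exact this ▸ (x j).2.2⟩
      exact ⟨L, h1.mono hsub, fun x hx => h2 x (hsub hx)⟩
  obtain ⟨L, h1, h2⟩ := key Finset.univ (fun _ => 0) (by simp)
  have huniv : box Finset.univ (fun _ => 0) = univ := by ext; simp [box]
  rw [huniv] at h1 h2
  exact ⟨L, continuousOn_univ.1 h1, fun x => h2 x (mem_univ x)⟩

/-- Homotopies of cubes in the Borel space lift to `EG × Y`, with prescribed values on the horn. -/
theorem exists_lift_of_horn {n : ℕ} {F : (Fin n → I) × I → A.Borel} (hF : Continuous F)
    {K : (Fin n → I) × I → MilnorE A.G × A.Y} (hK : ContinuousOn K (Cube.horn n))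
    (hKF : ∀ p ∈ Cube.horn n, A.borelProj (K p) = F p) :
    ∃ L : (Fin n → I) × I → MilnorE A.G × A.Y, Continuous L ∧ (∀ p, A.borelProj (L p) = F p) ∧
      ∀ p ∈ Cube.horn n, L p = K p := by
  obtain ⟨r, hr, hrh, hri⟩ := Cube.exists_retraction_horn n
  have hc : Continuous fun p : (Fin n → I) × I => (Fin.cons p.2 p.1 : Fin (n + 1) → I) :=
    (GenLoop.continuous_cons n).comp continuous_swap
  obtain ⟨L₀, k₀, p₀⟩ := exists_lift (F := fun y : Fin (n + 1) → I => F (Fin.tail y, y 0))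
    (hF.comp ((GenLoop.continuous_tail n).prodMk (continuous_apply 0)))
  let L₁ : (Fin n → I) × I → MilnorE A.G × A.Y := fun p => L₀ (Fin.cons p.2 p.1)
  have k₁ : Continuous L₁ := k₀.comp hc
  have p₁ : ∀ p, A.borelProj (L₁ p) = F p := fun p => p₀ _
  -- An unrestricted lift `L₁` differs from `K` on the horn by a continuous function to `G`. The
  -- retraction extends this function to the prism.
  have hd : Continuous fun p => A.borelDiff (L₁ (r p)) (K (r p)) :=
    continuousOn_univ.1 (continuousOn_borelDiff (k₁.comp hr).continuousOn
      (hK.comp hr.continuousOn fun p _ => hrh p)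
      fun p _ => (p₁ _).trans (hKF _ (hrh p)).symm)
  refine ⟨fun p => A.borelAct (A.borelDiff (L₁ (r p)) (K (r p))) (L₁ p),
    continuous_borelAct.comp (hd.prodMk k₁), fun p => (borelProj_borelAct _ _).trans (p₁ p),
    fun p hp => ?_⟩
  simp only [hri p hp]
  exact borelAct_borelDiff ((p₁ p).trans (hKF p hp).symm)

end GSpace

/-! ### The space of `G`-paths and the loop space of the Borel space -/

namespace BasedGlobalOrbispace

variable (A : BasedGlobalOrbispace.{u, v})

/-- The base point of `EG × Y`. -/
def totalBase : MilnorE A.G × A.Y := (MilnorE.base A.G, A.basePt)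

/-- Paths `α` in `Y` from `ô`, together with an element `g` of `G` that takes `α 1` to `ô`. -/
abbrev GPath : Type (max u v) :=
  {p : C(I, A.Y) × A.G // p.1 0 = A.basePt ∧ p.2 • p.1 1 = A.basePt}

/-- Paths `β` in `EG × Y` from the base point, together with an element `g` of `G` that takes `β 1`
to the base point. -/
abbrev TotalGPath : Type (max u v) :=
  {p : C(I, MilnorE A.G × A.Y) × A.G // p.1 0 = A.totalBase ∧ A.borelAct p.2 (p.1 1) = A.totalBase}

/-- The constant `G`-path. -/
def gpathBase : A.GPath := ⟨(ContinuousMap.const _ A.basePt, 1), rfl, one_smul _ _⟩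

/-- The constant path in `EG × Y`. -/
def totalGPathBase : A.TotalGPath :=
  ⟨(ContinuousMap.const _ A.totalBase, 1), rfl, GSpace.borelAct_one _⟩

instance : Nonempty A.TotalGPath := ⟨A.totalGPathBase⟩

variable {A}

theorem totalGPath_one (z : A.TotalGPath) : z.1.1 1 = A.borelAct z.1.2⁻¹ A.totalBase := by
  refine Eq.trans ?_ (congrArg (A.borelAct z.1.2⁻¹) z.2.2)
  rw [← GSpace.borelAct_mul, inv_mul_cancel, GSpace.borelAct_one]

/-- The projection of paths in `EG × Y` to paths in `Y`. -/
def toGPath (z : A.TotalGPath) : A.GPath :=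
  ⟨((⟨Prod.snd, continuous_snd⟩ : C(MilnorE A.G × A.Y, A.Y)).comp z.1.1, z.1.2),
    congrArg Prod.snd z.2.1, congrArg Prod.snd z.2.2⟩

/-- The projection of paths in `EG × Y` to loops in the Borel space. -/
def toBorelLoop (z : A.TotalGPath) : Path A.borelBase A.borelBase where
  toFun t := A.borelProj (z.1.1 t)
  continuous_toFun := GSpace.continuous_borelProj.comp z.1.1.continuous
  source' := congrArg A.borelProj z.2.1
  target' := (GSpace.borelProj_borelAct _ _).symm.trans (congrArg A.borelProj z.2.2)

theorem continuous_toGPath : Continuous (toGPath (A := A)) := by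
  refine Continuous.subtype_mk (Continuous.prodMk ?_ (continuous_snd.comp continuous_subtype_val)) _
  exact (ContinuousMap.continuous_postcomp _).comp (continuous_fst.comp continuous_subtype_val)

theorem continuous_totalGPath_eval :
    Continuous fun p : A.TotalGPath × I => p.1.1.1 p.2 :=
  ContinuousEval.continuous_eval.comp
    ((continuous_fst.comp (continuous_subtype_val.comp continuous_fst)).prodMk continuous_snd)

theorem continuous_toBorelLoop : Continuous (toBorelLoop (A := A)) :=
  Path.continuous_uncurry_iff.1 (GSpace.continuous_borelProj.comp continuous_totalGPath_eval)

theorem toGPath_base : toGPath A.totalGPathBase = A.gpathBase := rfl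

theorem toBorelLoop_base : toBorelLoop A.totalGPathBase = Path.refl A.borelBase := rfl

/-- The component in `Y` and the group element of the lift are prescribed by `u`. What is missing is
a family of paths in `EG` from the base point to its translate by the group element, already given
by `v` over the boundary. This is an extension problem from `∂I^(n+1)`, solvable as `EG` is
contractible. -/
theorem isTrivialFibration_toGPath : IsTrivialFibration (toGPath (A := A)) := by
  classical
  intro n u v hu hv huv
  obtain ⟨c, hc, hc0, hc1⟩ := MilnorE.exists_contraction (G := A.G)
  -- The coordinate 0 is path time. On the edges the three prescriptions agree because of the end
  -- point conditions of `v`; off the boundary the value is irrelevant.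
  let f : (Fin (n + 1) → I) → MilnorE A.G := fun y =>
    if Fin.tail y ∈ Cube.boundary (Fin n) then ((v (Fin.tail y)).1.1 (y 0)).1
    else if y 0 = 0 then MilnorE.base A.G else (MilnorE.base A.G).mulRight (u (Fin.tail y)).1.2
  have hv0 : ∀ x, ((v x).1.1 0).1 = MilnorE.base A.G := fun x => congrArg Prod.fst (v x).2.1
  have hv1 : ∀ x ∈ Cube.boundary (Fin n), ((v x).1.1 1).1 =
      (MilnorE.base A.G).mulRight (u x).1.2 := fun x hx => by
    rw [totalGPath_one, ← huv x hx]
    simp [GSpace.borelAct, totalBase, toGPath]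
  have f0 : ∀ y, y 0 = 0 → f y = MilnorE.base A.G := fun y hy => by
    simp only [f, hy, hv0, if_true, ite_self]
  have f1 : ∀ y, y 0 = 1 → f y = (MilnorE.base A.G).mulRight (u (Fin.tail y)).1.2 := fun y hy => by
    by_cases h : Fin.tail y ∈ Cube.boundary (Fin n)
    · simp only [f, hy, h, if_true, hv1 _ h]
    · simp only [f, hy, h, if_false, one_ne_zero]
  have fb : ∀ y : Fin (n + 1) → I, Fin.tail y ∈ Cube.boundary (Fin n) →
      f y = ((v (Fin.tail y)).1.1 (y 0)).1 := fun y hy => if_pos hy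
  have ht := GenLoop.continuous_tail n
  have hf : ContinuousOn f (Cube.boundary (Fin (n + 1))) := by
    have c1 : ∀ t : I, IsClosed {y : Fin (n + 1) → I | y 0 = t} := fun t =>
      isClosed_eq (continuous_apply 0) continuous_const
    have c2 := (Cube.isClosed_boundary n).preimage ht
    rw [Cube.boundary_succ]
    refine ContinuousOn.union_of_isClosed ?_ (ContinuousOn.union_of_isClosed ?_ ?_ (c1 _) c2)
      (c1 _) ((c1 _).union c2)
    · exact continuousOn_const.congr f0
    · have h : Continuous fun y : Fin (n + 1) → I =>
          (MilnorE.base A.G, (u (Fin.tail y)).1.2) := continuous_const.prodMk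
        (continuous_snd.comp (continuous_subtype_val.comp (hu.comp ht)))
      have h' := (MilnorE.continuous_mulRight (G := A.G)).comp h
      exact h'.continuousOn.congr f1
    · have h : ContinuousOn (fun y : Fin (n + 1) → I => (v (Fin.tail y), y 0))
          (Fin.tail ⁻¹' Cube.boundary (Fin n)) :=
        (hv.comp ht.continuousOn fun y hy => hy).prodMk (continuous_apply 0).continuousOn
      have h' := (continuous_totalGPath_eval (A := A)).comp_continuousOn h
      exact (continuous_fst.comp_continuousOn h').congr fb
  obtain ⟨F, hF, hFf⟩ := Cube.exists_extension_of_contraction hc hc0 hc1 hf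
  have hF0 : ∀ x, F (Fin.cons 0 x) = MilnorE.base A.G := fun x =>
    (hFf _ ⟨0, Or.inl rfl⟩).trans (f0 _ rfl)
  have hF1 : ∀ x, F (Fin.cons 1 x) = (MilnorE.base A.G).mulRight (u x).1.2 := fun x =>
    (hFf _ ⟨0, Or.inr rfl⟩).trans (f1 _ rfl)
  have hcons : Continuous fun p : (Fin n → I) × I => F (Fin.cons p.2 p.1) :=
    hF.comp ((GenLoop.continuous_cons n).comp continuous_swap)
  have hu' : Continuous fun p : (Fin n → I) × I => (u p.1).1.1 p.2 :=
    ContinuousEval.continuous_eval.comp ((continuous_fst.comp (continuous_subtype_val.comp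
      (hu.comp continuous_fst))).prodMk continuous_snd)
  let β : (Fin n → I) → C(I, MilnorE A.G × A.Y) := fun x =>
    ⟨fun t => (F (Fin.cons t x), (u x).1.1 t),
      (hcons.prodMk hu').comp (continuous_const.prodMk continuous_id)⟩
  refine ⟨fun x => ⟨(β x, (u x).1.2), ?_, ?_⟩, ?_, fun x => ?_, fun x hx => ?_⟩
  · exact Prod.ext (hF0 x) (u x).2.1
  · refine Prod.ext ?_ (u x).2.2
    change (F (Fin.cons 1 x)).mulRight _ = _
    rw [hF1, MilnorE.mulRight_mul, mul_inv_cancel, MilnorE.mulRight_one]; rfl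
  · refine Continuous.subtype_mk (Continuous.prodMk ?_
      (continuous_snd.comp (continuous_subtype_val.comp hu))) _
    exact ContinuousMap.continuous_of_continuous_uncurry _ (hcons.prodMk hu')
  · rfl
  · have hb : ∀ t, (Fin.cons t x : Fin (n + 1) → I) ∈ Cube.boundary (Fin (n + 1)) := fun t => by
      rw [Cube.boundary_succ]; exact Or.inr (Or.inr hx)
    have e := huv x hx
    refine Subtype.ext (Prod.ext (ContinuousMap.ext fun t => Prod.ext ?_ ?_) ?_)
    · exact (hFf _ (hb t)).trans (fb _ hx)
    · change (u x).1.1 t = _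
      rw [← e]; rfl
    · change (u x).1.2 = _
      rw [← e]; rfl

/-- A family of loops is a homotopy, lifted with the base point as initial value and with the paths
of `v` on the sides. The end of every lifted path lies over the base point, so `borelDiff` supplies
the required group element. Over the boundary it is the element of `v`, since the action is free. -/
theorem isTrivialFibration_toBorelLoop : IsTrivialFibration (toBorelLoop (A := A)) := by
  intro n u v hu hv huv
  have hF : Continuous fun p : (Fin n → I) × I => u p.1 p.2 := Path.continuous_uncurry_iff.2 hu
  let K : (Fin n → I) × I → MilnorE A.G × A.Y := fun p =>
    if p.2 = 0 then A.totalBase else (v p.1).1.1 p.2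
  have K0 : ∀ p, p.2 = 0 → K p = A.totalBase := fun p hp => if_pos hp
  have K1 : ∀ p, K p = (v p.1).1.1 p.2 := fun p => by
    by_cases h : p.2 = 0
    · rw [K0 p h, h, (v p.1).2.1]
    · exact if_neg h
  have hK : ContinuousOn K (Cube.horn n) := by
    refine ContinuousOn.union_of_isClosed (s := {p : (Fin n → I) × I | p.2 = 0})
      (t := {p : (Fin n → I) × I | p.1 ∈ Cube.boundary (Fin n)}) ?_ ?_
      (isClosed_eq continuous_snd continuous_const)
      ((Cube.isClosed_boundary n).preimage continuous_fst)
    · exact continuousOn_const.congr K0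
    · have h : ContinuousOn (fun p : (Fin n → I) × I => (v p.1, p.2))
          {p | p.1 ∈ Cube.boundary (Fin n)} :=
        (hv.comp continuousOn_fst fun p hp => hp).prodMk continuousOn_snd
      exact ((continuous_totalGPath_eval (A := A)).comp_continuousOn h).congr fun p _ => K1 p
  have hKF : ∀ p ∈ Cube.horn n, A.borelProj (K p) = u p.1 p.2 := by
    rintro p (hp | hp)
    · rw [K0 p hp, hp, Path.source]; rfl
    · rw [K1, ← huv _ hp]; rfl
  obtain ⟨L, hL, hLF, hLK⟩ := GSpace.exists_lift_of_horn hF hK hKF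
  have hend : ∀ x, A.borelProj (L (x, 1)) = A.borelProj A.totalBase := fun x => by
    rw [hLF, Path.target]; rfl
  have hL1 : Continuous fun x => L (x, 1) := hL.comp (continuous_id.prodMk continuous_const)
  let β : (Fin n → I) → C(I, MilnorE A.G × A.Y) := fun x =>
    ⟨fun t => L (x, t), hL.comp (continuous_const.prodMk continuous_id)⟩
  refine ⟨fun x => ⟨(β x, A.borelDiff (L (x, 1)) A.totalBase), ?_, ?_⟩, ?_, fun x => ?_,
    fun x hx => ?_⟩
  · exact (hLK (x, 0) (Or.inl rfl)).trans (K0 _ rfl)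
  · exact GSpace.borelAct_borelDiff (hend x)
  · refine Continuous.subtype_mk (Continuous.prodMk ?_ ?_) _
    · exact ContinuousMap.continuous_of_continuous_uncurry _ hL
    · exact continuousOn_univ.1 (GSpace.continuousOn_borelDiff hL1.continuousOn continuousOn_const
        fun x _ => hend x)
  · ext t; exact hLF (x, t)
  · have e : ∀ t, L (x, t) = (v x).1.1 t := fun t => (hLK (x, t) (Or.inr hx)).trans (K1 _)
    refine Subtype.ext (Prod.ext (ContinuousMap.ext e) ?_)
    change A.borelDiff (L (x, 1)) A.totalBase = _
    rw [e 1]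
    exact GSpace.borelDiff_eq (v x).2.2

/-- The underlying path of the concatenation of paths in `EG × Y`. -/
def totalConcatPath (z w : A.TotalGPath) : C(I, MilnorE A.G × A.Y) where
  -- The first path ends at the translate of the base point by `z.1.2⁻¹`; the second path is
  -- translated so as to start there.
  toFun t := if (t : ℝ) ≤ 1 / 2 then z.1.1 (projIcc 0 1 zero_le_one (2 * (t : ℝ)))
    else A.borelAct z.1.2⁻¹ (w.1.1 (projIcc 0 1 zero_le_one (2 * (t : ℝ) - 1)))
  continuous_toFun := by
    have h1 : Continuous fun t : I => z.1.1 (projIcc 0 1 zero_le_one (2 * (t : ℝ))) :=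
      z.1.1.continuous.comp (continuous_projIcc.comp (by fun_prop))
    have h2 : Continuous fun t : I => w.1.1 (projIcc 0 1 zero_le_one (2 * (t : ℝ) - 1)) :=
      w.1.1.continuous.comp (continuous_projIcc.comp (by fun_prop))
    refine Continuous.if_le h1 ((GSpace.continuous_borelAct_const _).comp h2)
      continuous_subtype_val continuous_const fun t ht => ?_
    simp only [ht]
    rw [projIcc_of_right_le zero_le_one (by norm_num),
      projIcc_of_le_left zero_le_one (by norm_num)]
    exact (totalGPath_one z).trans (congrArg _ w.2.1.symm)

theorem totalConcatPath_zero (z w : A.TotalGPath) : totalConcatPath z w 0 = A.totalBase := by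
  refine (if_pos (by norm_num)).trans ?_
  rw [projIcc_of_le_left zero_le_one (by norm_num)]
  exact z.2.1

theorem totalConcatPath_one (z w : A.TotalGPath) :
    totalConcatPath z w 1 = A.borelAct z.1.2⁻¹ (w.1.1 1) := by
  refine (if_neg (by norm_num)).trans ?_
  rw [projIcc_of_right_le zero_le_one (by norm_num)]
  rfl

/-- The concatenation of paths in `EG × Y`. -/
def totalConcat (z w : A.TotalGPath) : A.TotalGPath :=
  ⟨(totalConcatPath z w, w.1.2 * z.1.2), totalConcatPath_zero z w, by
    rw [totalConcatPath_one, ← GSpace.borelAct_mul, mul_inv_cancel_right]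
    exact w.2.2⟩

theorem toBorelLoop_totalConcat (z w : A.TotalGPath) :
    toBorelLoop (totalConcat z w) = (toBorelLoop z).trans (toBorelLoop w) := by
  ext t
  rw [Path.trans_apply]
  change A.borelProj (if _ then _ else _) = _
  split_ifs with h
  · exact congrArg (fun s => A.borelProj (z.1.1 s)) (projIcc_of_mem _ _)
  · rw [GSpace.borelProj_borelAct]
    exact congrArg (fun s => A.borelProj (w.1.1 s)) (projIcc_of_mem _ _)

end BasedGlobalOrbispace

/-! ### The action of equivariant maps on the zigzag. -/

namespace EquivariantMap

variable {A B : BasedGlobalOrbispace.{u, v}} (F : EquivariantMap A B)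

/-- The map of `G`-paths induced by an equivariant map. -/
def gpathMap (p : A.GPath) : B.GPath :=
  ⟨((⟨F.map, F.map_cont⟩ : C(A.Y, B.Y)).comp p.1.1, F.hom p.1.2),
    (congrArg F.map p.2.1).trans F.map_base,
    (F.map_smul _ _).symm.trans ((congrArg F.map p.2.2).trans F.map_base)⟩

theorem continuous_gpathMap : Continuous F.gpathMap := by
  refine Continuous.subtype_mk (Continuous.prodMk ?_
    (F.hom_cont.comp (continuous_snd.comp continuous_subtype_val))) _
  exact (ContinuousMap.continuous_postcomp _).comp (continuous_fst.comp continuous_subtype_val)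

theorem gpathMap_base : F.gpathMap A.gpathBase = B.gpathBase :=
  Subtype.ext (Prod.ext (ContinuousMap.ext fun _ => F.map_base) (map_one F.hom))

/-- The map `EG × Y → EG' × Y'` induced by an equivariant map. -/
def totalMap (z : MilnorE A.G × A.Y) : MilnorE B.G × B.Y := (MilnorE.map F.hom z.1, F.map z.2)

theorem continuous_totalMap : Continuous F.totalMap :=
  ((MilnorE.continuous_map F.hom_cont).comp continuous_fst).prodMk
    (F.map_cont.comp continuous_snd)

theorem totalMap_borelAct (g : A.G) (z : MilnorE A.G × A.Y) :
    F.totalMap (A.borelAct g z) = B.borelAct (F.hom g) (F.totalMap z) := by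
  simp [totalMap, GSpace.borelAct, MilnorE.map_mulRight, F.map_smul]

theorem totalMap_base : F.totalMap A.totalBase = B.totalBase :=
  Prod.ext (MilnorE.map_base F.hom) F.map_base

/-- The map of paths in `EG × Y` induced by an equivariant map. -/
def totalGPathMap (z : A.TotalGPath) : B.TotalGPath :=
  ⟨((⟨F.totalMap, F.continuous_totalMap⟩ : C(MilnorE A.G × A.Y, MilnorE B.G × B.Y)).comp z.1.1,
      F.hom z.1.2),
    (congrArg F.totalMap z.2.1).trans F.totalMap_base,
    (F.totalMap_borelAct _ _).symm.trans ((congrArg F.totalMap z.2.2).trans F.totalMap_base)⟩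

theorem continuous_totalGPathMap : Continuous F.totalGPathMap := by
  refine Continuous.subtype_mk (Continuous.prodMk ?_
    (F.hom_cont.comp (continuous_snd.comp continuous_subtype_val))) _
  exact (ContinuousMap.continuous_postcomp _).comp (continuous_fst.comp continuous_subtype_val)

theorem totalGPathMap_base : F.totalGPathMap A.totalGPathBase = B.totalGPathBase :=
  Subtype.ext (Prod.ext (ContinuousMap.ext fun _ => F.totalMap_base) (map_one F.hom))

/-- The map of loops of the Borel spaces induced by an equivariant map. -/
def borelLoopMap (p : Path A.borelBase A.borelBase) : Path B.borelBase B.borelBase where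
  toFun t := F.borelMap (p t)
  continuous_toFun := F.continuous_borelMap.comp p.continuous
  source' := by rw [p.source, F.borelMap_base]
  target' := by rw [p.target, F.borelMap_base]

theorem continuous_borelLoopMap : Continuous F.borelLoopMap := by
  refine Path.continuous_uncurry_iff.1 ?_
  exact F.continuous_borelMap.comp (Path.continuous_uncurry_iff.2 continuous_id)

theorem borelLoopMap_refl : F.borelLoopMap (Path.refl _) = Path.refl _ := by
  ext t; exact F.borelMap_base

end EquivariantMap

/-! ### From `G`-paths to homotopy groups of the Borel space. -/

namespace BasedGlobalOrbispace

open HomotopyGroup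

/-- The isomorphism of `π_k` of the space of `G`-paths with `π_{k+1}` of the Borel space. -/
def gpathEquiv (k : ℕ) (A : BasedGlobalOrbispace.{u, v}) :
    HomotopyGroup.Pi k A.GPath A.gpathBase ≃ HomotopyGroup.Pi (k + 1) A.Borel A.borelBase :=
  (Equiv.ofBijective _ (induced_bijective continuous_toGPath toGPath_base
    isTrivialFibration_toGPath k)).symm.trans
  ((Equiv.ofBijective _ (induced_bijective continuous_toBorelLoop toBorelLoop_base
    isTrivialFibration_toBorelLoop k)).trans (loopEquiv k _))

variable {A : BasedGlobalOrbispace.{u, v}}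

/-- Every class of `G`-paths comes from `TotalGPath`, so this formula eliminates the inverse
bijection in the definition of `gpathEquiv` from all later arguments. -/
theorem gpathEquiv_induced (k : ℕ) (p : HomotopyGroup.Pi k A.TotalGPath A.totalGPathBase) :
    gpathEquiv k A (induced toGPath continuous_toGPath toGPath_base p) =
      loopEquiv k _ (induced toBorelLoop continuous_toBorelLoop toBorelLoop_base p) := by
  unfold gpathEquiv
  simp only [Equiv.trans_apply]
  rw [Equiv.ofBijective_symm_apply_apply]
  rfl

theorem exists_induced_toGPath_eq {k : ℕ} (x : HomotopyGroup.Pi k A.GPath A.gpathBase) :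
    ∃ p, induced toGPath continuous_toGPath toGPath_base p = x :=
  (induced_bijective continuous_toGPath toGPath_base isTrivialFibration_toGPath k).2 x

theorem gpathEquiv_mul (k : ℕ) (x y : HomotopyGroup.Pi (k + 1) A.GPath A.gpathBase) :
    gpathEquiv (k + 1) A (x * y) = gpathEquiv (k + 1) A x * gpathEquiv (k + 1) A y := by
  obtain ⟨p, rfl⟩ := exists_induced_toGPath_eq x
  obtain ⟨q, rfl⟩ := exists_induced_toGPath_eq y
  rw [← induced_mul]
  simp only [gpathEquiv_induced]
  rw [induced_mul, loopEquiv_mul]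

/-- On `π_0` there is no product to be preserved by induced maps. Instead, representatives are
concatenated in `TotalGPath`, whose projection to the loops of the Borel space respects
concatenation. -/
theorem gpathEquiv_ofPoint (z w : A.TotalGPath) :
    gpathEquiv 0 A (ofPoint _ (toGPath (totalConcat z w))) =
      seqMul (gpathEquiv 0 A (ofPoint _ (toGPath z))) (gpathEquiv 0 A (ofPoint _ (toGPath w))) := by
  have h : ∀ z : A.TotalGPath, gpathEquiv 0 A (ofPoint _ (toGPath z)) =
      loopEquiv 0 _ (ofPoint _ (toBorelLoop z)) := fun z =>
    gpathEquiv_induced 0 (ofPoint _ z)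
  rw [h, h, h, toBorelLoop_totalConcat, loopEquiv_ofPoint_trans]

/-- The squares formed by `totalGPathMap` with the two projections commute on the nose, already for
paths. -/
theorem gpathEquiv_natural {B : BasedGlobalOrbispace.{u, v}} (F : EquivariantMap A B) (k : ℕ)
    (x : HomotopyGroup.Pi k A.GPath A.gpathBase) :
    gpathEquiv k B (induced F.gpathMap F.continuous_gpathMap F.gpathMap_base x) =
      induced F.borelMap F.continuous_borelMap F.borelMap_base (gpathEquiv k A x) := by
  obtain ⟨p, rfl⟩ := exists_induced_toGPath_eq x
  have e : induced F.gpathMap F.continuous_gpathMap F.gpathMap_base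
      (induced toGPath continuous_toGPath toGPath_base p) =
      induced toGPath continuous_toGPath toGPath_base
        (induced F.totalGPathMap F.continuous_totalGPathMap F.totalGPathMap_base p) := by
    induction p using Quotient.inductionOn
    rfl
  rw [e, gpathEquiv_induced, gpathEquiv_induced]
  rw [← loopEquiv_induced F.continuous_borelMap F.borelMap_base k F.borelLoopMap
    F.continuous_borelLoopMap F.borelLoopMap_refl fun _ _ => rfl]
  congr 1
  induction p using Quotient.inductionOn
  rfl

end BasedGlobalOrbispace

/-! ### Covers of the circle by arcs -/

/-- A cyclic chain of open arcs covering the circle, as in `LoopSystem`. -/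
structure CircleArcs where
  N : ℕ
  three_le : 3 ≤ N
  a : ℕ → ℝ
  b : ℕ → ℝ
  a_zero : a 0 < 0
  b_zero : 0 < b 0
  a_one : 0 ≤ a 1
  b_pred : b (N - 1) ≤ 1
  a_last : a N = a 0 + 1
  b_last : b N = b 0 + 1
  overlap : ∀ i < N, a (i + 1) < b i
  separate : ∀ i, i + 2 ≤ N → b i ≤ a (i + 2)

namespace CircleArcs

variable (C : CircleArcs)

/-- The (lifted) arc number `i`. -/
def arc (i : ℕ) : Set ℝ := Ioo (C.a i) (C.b i)

theorem a_lt_succ {i : ℕ} (hi : i < C.N) : C.a i < C.a (i + 1) := by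
  cases i with
  | zero => exact C.a_zero.trans_le C.a_one
  | succ i => exact (C.overlap i (by omega)).trans_le (C.separate i (by omega))

theorem b_lt_succ {i : ℕ} (hi : i < C.N) : C.b i < C.b (i + 1) := by
  rcases lt_or_ge (i + 1) C.N with h | h
  · exact (C.separate i (by omega)).trans_lt (C.overlap (i + 1) h)
  · have e : i = C.N - 1 := by omega
    have h1 := C.b_pred
    have h2 := C.b_last
    have h3 := C.b_zero
    rw [← e] at h1
    rw [show i + 1 = C.N by omega]
    linarith

theorem a_le {i j : ℕ} (hij : i ≤ j) (hj : j ≤ C.N) : C.a i ≤ C.a j := by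
  induction j, hij using Nat.le_induction with
  | base => exact le_rfl
  | succ j _ ih => exact (ih (by omega)).trans (C.a_lt_succ (by omega)).le

theorem b_le {i j : ℕ} (hij : i ≤ j) (hj : j ≤ C.N) : C.b i ≤ C.b j := by
  induction j, hij using Nat.le_induction with
  | base => exact le_rfl
  | succ j _ ih => exact (ih (by omega)).trans (C.b_lt_succ (by omega)).le

theorem b_le_a {i j : ℕ} (hij : i + 2 ≤ j) (hj : j ≤ C.N) : C.b i ≤ C.a j :=
  (C.separate i (by omega)).trans (C.a_le hij hj)

/-- The arcs `0` and `N` are disjoint and differ by a translation by 1, so the arc `0` has length at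
most 1. As it contains 0, it lies in `(-1, 1)`, where the shift by one turn is governed by
`gpathExt_add_one`. -/
theorem neg_one_lt_a : -1 < C.a 0 := by
  have h1 := C.a_last
  have h2 := C.b_zero
  have h3 := C.b_le_a (i := 0) (j := C.N) (by have := C.three_le; omega) le_rfl
  linarith

theorem b_zero_lt_one : C.b 0 < 1 := by
  have h1 := C.a_last
  have h2 := C.a_zero
  have h3 := C.b_le_a (i := 0) (j := C.N) (by have := C.three_le; omega) le_rfl
  linarith

theorem eq_or_eq_succ {i j : ℕ} {x : ℝ} (hij : i ≤ j) (hj : j ≤ C.N) (hi : x ∈ C.arc i)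
    (hxj : x ∈ C.arc j) : j = i ∨ j = i + 1 := by
  by_contra! h
  have := C.b_le_a (i := i) (j := j) (by omega) hj
  linarith [hi.2, hxj.1]

theorem exists_mem_arc {n : ℕ} (hn : n ≤ C.N) {x : ℝ} (h0 : C.a 0 < x) (h1 : x < C.b n) :
    ∃ i ≤ n, x ∈ C.arc i := by
  induction n with
  | zero => exact ⟨0, le_rfl, h0, h1⟩
  | succ n ih =>
    rcases lt_or_ge (C.a (n + 1)) x with h | h
    · exact ⟨n + 1, le_rfl, h, h1⟩
    · obtain ⟨i, hi, hx⟩ := ih (by omega) (h.trans_lt (C.overlap n (by omega)))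
      exact ⟨i, by omega, hx⟩

theorem one_lt_b_last : 1 < C.b C.N := by linarith [C.b_last, C.b_zero]

theorem exists_mem_arc_unitInterval (x : I) : ∃ i ≤ C.N, (x : ℝ) ∈ C.arc i :=
  C.exists_mem_arc le_rfl (C.a_zero.trans_le x.2.1) (x.2.2.trans_lt C.one_lt_b_last)

theorem mem_arc_last {x : ℝ} : x + 1 ∈ C.arc C.N ↔ x ∈ C.arc 0 := by
  unfold arc
  rw [C.a_last, C.b_last]
  simp

/-- The midpoint of the overlap of two consecutive arcs. -/
def mid (i : ℕ) : ℝ := (C.a (i + 1) + C.b i) / 2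

theorem mid_mem {i : ℕ} (hi : i < C.N) : C.mid i ∈ Ioo (C.a (i + 1)) (C.b i) := by
  have := C.overlap i hi
  constructor <;> unfold mid <;> linarith

theorem overlap_subset {i : ℕ} (hi : i < C.N) : Ioo (C.a (i + 1)) (C.b i) ⊆ C.arc i :=
  Ioo_subset_Ioo_left (C.a_lt_succ hi).le

theorem overlap_subset_succ {i : ℕ} (hi : i < C.N) :
    Ioo (C.a (i + 1)) (C.b i) ⊆ C.arc (i + 1) :=
  Ioo_subset_Ioo_right (C.b_lt_succ hi).le

/-- The cover by `n` arcs of equal length. -/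
def uniform (n : ℕ) (hn : 3 ≤ n) : CircleArcs where
  N := n
  three_le := hn
  -- In units of `1 / n`, a half-width above `1/2` makes neighbours overlap, and one of at most 1
  -- keeps all other arcs apart; `2/3` is such a value.
  a i := (i - 2 / 3) / n
  b i := (i + 2 / 3) / n
  a_zero := by
    have : (0 : ℝ) < n := by positivity
    apply div_neg_of_neg_of_pos <;> norm_num [this]
  b_zero := by positivity
  a_one := by norm_num; positivity
  b_pred := by
    have : (0 : ℝ) < n := by positivity
    rw [div_le_one this, Nat.cast_sub (by omega)]
    push_cast; linarith
  a_last := by have : (n : ℝ) ≠ 0 := by positivity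
               field_simp; push_cast; ring
  b_last := by have : (n : ℝ) ≠ 0 := by positivity
               field_simp; push_cast; ring
  overlap i _ := by gcongr ?_ / _; push_cast; linarith
  separate i _ := by gcongr ?_ / _; push_cast; linarith

/-- The cover by slightly smaller arcs. -/
def shrink (ε : ℝ) (hε : 0 ≤ ε) (ha : C.a 0 + ε < 0) (hb : 0 < C.b 0 - ε)
    (h : ∀ i < C.N, C.a (i + 1) + ε < C.b i - ε) : CircleArcs where
  N := C.N
  three_le := C.three_le
  a i := C.a i + ε
  b i := C.b i - ε
  a_zero := ha
  b_zero := hb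
  a_one := add_nonneg C.a_one hε
  b_pred := by linarith [C.b_pred]
  a_last := by linarith [C.a_last]
  b_last := by linarith [C.b_last]
  overlap := h
  separate i hi := by linarith [C.separate i hi]

end CircleArcs

/-! ### The `G`-path of a based loop system -/

namespace BasedGlobalOrbispace

variable {A : BasedGlobalOrbispace.{u, v}}

/-- The periodic extension of a `G`-path to the line (or rather, to the interval `[-1, 2]`). -/
def gpathExt (p : A.GPath) (x : ℝ) : A.Y :=
  if x ≤ 0 then p.1.2 • p.1.1 (projIcc 0 1 zero_le_one (x + 1))
  else if x ≤ 1 then p.1.1 (projIcc 0 1 zero_le_one x)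
  else p.1.2⁻¹ • p.1.1 (projIcc 0 1 zero_le_one (x - 1))

theorem gpath_one (p : A.GPath) : p.1.1 1 = p.1.2⁻¹ • A.basePt := by
  rw [eq_inv_smul_iff]; exact p.2.2

theorem gpathExt_of_mem (p : A.GPath) (t : I) : gpathExt p t = p.1.1 t := by
  unfold gpathExt
  split_ifs with h1 h2
  · have e : t = 0 := Subtype.ext (le_antisymm h1 t.2.1)
    rw [e, projIcc_of_right_le zero_le_one (by simp), p.2.1]
    exact p.2.2
  · rw [projIcc_val]
  · exact absurd t.2.2 h2

theorem gpathExt_zero (p : A.GPath) : gpathExt p 0 = A.basePt :=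
  (gpathExt_of_mem p 0).trans p.2.1

theorem gpathExt_add_one (p : A.GPath) {x : ℝ} (h0 : -1 < x) (h1 : x ≤ 1) :
    p.1.2 • gpathExt p (x + 1) = gpathExt p x := by
  unfold gpathExt
  by_cases h : x ≤ 0
  · rw [if_pos h, if_neg (by linarith), if_pos (by linarith)]
  · rw [if_neg h, if_pos h1, if_neg (by linarith), if_neg (by linarith), smul_inv_smul,
      add_sub_cancel_right]

/-- At 0 the pieces fit by `g • α 1 = ô = α 0`, at 1 by the same equation multiplied by `g⁻¹`. -/
theorem continuous_gpathExt : Continuous fun q : A.GPath × ℝ => gpathExt q.1 q.2 := by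
  have h : ∀ φ : ℝ → ℝ, Continuous φ → Continuous fun q : A.GPath × ℝ =>
      q.1.1.1 (projIcc 0 1 zero_le_one (φ q.2)) := fun φ hφ =>
    ContinuousEval.continuous_eval.comp
      ((continuous_fst.comp (continuous_subtype_val.comp continuous_fst)).prodMk
        ((continuous_projIcc (h := zero_le_one)).comp (hφ.comp continuous_snd)))
  have hg : Continuous fun q : A.GPath × ℝ => q.1.1.2 :=
    continuous_snd.comp (continuous_subtype_val.comp continuous_fst)
  refine Continuous.if_le (hg.smul (h (fun x => x + 1) (by fun_prop)))
    (Continuous.if_le (h (fun x => x) (by fun_prop))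
      (hg.inv.smul (h (fun x => x - 1) (by fun_prop))) continuous_snd continuous_const ?_)
    continuous_snd continuous_const ?_
  · intro q hq
    rw [hq, projIcc_of_right_le zero_le_one le_rfl, sub_self, projIcc_of_le_left zero_le_one le_rfl]
    exact (gpath_one q.1).trans (congrArg (q.1.1.2⁻¹ • ·) q.1.2.1.symm)
  · intro q hq
    rw [hq, if_pos zero_le_one, projIcc_of_right_le zero_le_one (by simp),
      projIcc_of_le_left zero_le_one le_rfl]
    exact q.1.2.2.trans q.1.2.1.symm

theorem continuous_gpathExt_const (p : A.GPath) : Continuous (gpathExt p) :=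
  continuous_gpathExt.comp (continuous_const.prodMk continuous_id)

end BasedGlobalOrbispace

namespace LoopSystem

open BasedGlobalOrbispace

variable {A : BasedGlobalOrbispace.{u, v}} (s : LoopSystem A)

/-- The cover of the circle underlying a loop system. -/
def arcs : CircleArcs where
  N := s.N
  three_le := s.three_le
  a := s.a
  b := s.b
  a_zero := s.a_zero
  b_zero := s.b_zero
  a_one := s.a_one
  b_pred := s.b_pred
  a_last := s.a_last
  b_last := s.b_last
  overlap := s.overlap
  separate := s.separate

/-- The product of the group elements of the first `i` transition maps. -/
def hol : ℕ → A.G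
  | 0 => 1
  | i + 1 => (s.ρ i).elt * hol i

/-- Only consecutive arcs meet, and there the transition element by which the two maps differ is
exactly the factor by which the two products differ. -/
theorem hol_smul_compat {i j : ℕ} {x : ℝ} (hij : i ≤ j) (hj : j ≤ s.N) (hi : x ∈ s.arc i)
    (hxj : x ∈ s.arc j) : (s.hol j)⁻¹ • s.f j x = (s.hol i)⁻¹ • s.f i x := by
  rcases s.arcs.eq_or_eq_succ hij hj hi hxj with rfl | rfl
  · rfl
  · rw [(s.compat i (by omega) x ⟨hxj.1, hi.2⟩).2]
    simp [hol, mul_smul]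

open Classical in
/-- The common lift of the maps of a loop system. -/
def lift (x : ℝ) : A.Y :=
  if h : ∃ i ≤ s.N, x ∈ s.arc i then (s.hol h.choose)⁻¹ • s.f h.choose x else A.basePt

theorem lift_eq {i : ℕ} {x : ℝ} (hi : i ≤ s.N) (hx : x ∈ s.arc i) :
    s.lift x = (s.hol i)⁻¹ • s.f i x := by
  have h : ∃ i ≤ s.N, x ∈ s.arc i := ⟨i, hi, hx⟩
  have h' := h.choose_spec
  unfold lift
  rw [dif_pos h]
  rcases le_total i h.choose with h1 | h1
  · exact s.hol_smul_compat h1 h'.1 hx h'.2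
  · exact (s.hol_smul_compat h1 hi h'.2 hx).symm

theorem lift_zero : s.lift 0 = A.basePt := by
  rw [s.lift_eq (Nat.zero_le _) s.zero_mem_arc, s.f_base]; simp [hol]

theorem hol_smul_lift_one : s.hol s.N • s.lift 1 = A.basePt := by
  rw [s.lift_eq le_rfl s.one_mem_arc, s.f_one, smul_inv_smul]

theorem continuousAt_lift {i : ℕ} {x : ℝ} (hi : i ≤ s.N) (hx : x ∈ s.arc i) :
    ContinuousAt s.lift x := by
  have hn : s.arc i ∈ 𝓝 x := isOpen_Ioo.mem_nhds hx
  refine (((s.f_cont i hi).continuousAt hn).const_smul (s.hol i)⁻¹).congr ?_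
  filter_upwards [hn] with y hy
  exact (s.lift_eq hi hy).symm

/-- The `G`-path of a loop system. -/
def gpath : A.GPath :=
  ⟨(⟨fun t => s.lift t, continuous_iff_continuousAt.2 fun t => by
    obtain ⟨i, hi, h⟩ := s.arcs.exists_mem_arc_unitInterval t
    exact (s.continuousAt_lift hi h).comp continuous_subtype_val.continuousAt⟩, s.hol s.N),
    s.lift_zero, s.hol_smul_lift_one⟩

theorem gpath_ext {s : LoopSystem A} {p : A.GPath} (hN : s.hol s.N = p.1.2)
    (h : ∀ t : I, s.lift t = p.1.1 t) : s.gpath = p :=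
  Subtype.ext (Prod.ext (ContinuousMap.ext h) hN)

/-- Within `[0, 1]` this is the definition of the lift. A point below 0 lies on the arc `0` only and
a point above 1 on the arc `N` only; both are treated by shifting one turn and using `f_last`. -/
theorem gpathExt_gpath {i : ℕ} {x : ℝ} (hi : i ≤ s.N) (hx : x ∈ s.arc i) :
    gpathExt s.gpath x = (s.hol i)⁻¹ • s.f i x := by
  have hI : ∀ y : ℝ, 0 ≤ y → y ≤ 1 → gpathExt s.gpath y = s.lift y := fun y h0 h1 =>
    gpathExt_of_mem s.gpath ⟨y, h0, h1⟩
  rcases lt_or_ge x 0 with h0 | h0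
  · have hi0 : i = 0 := by
      by_contra h
      have := s.arcs.a_le (i := 1) (j := i) (by omega) hi
      have h1 := s.a_one
      have h2 := hx.1
      change s.a 1 ≤ s.a i at this
      linarith
    subst hi0
    have h1 : -1 < x := s.arcs.neg_one_lt_a.trans hx.1
    have h2 : x + 1 ∈ s.arc s.N := s.arcs.mem_arc_last.2 hx
    rw [← gpathExt_add_one _ h1 (by linarith), hI _ (by linarith) (by linarith),
      s.lift_eq le_rfl h2, s.f_last x hx]
    simp [gpath, hol]
  rcases le_or_gt x 1 with h1 | h1
  · rw [hI x h0 h1, s.lift_eq hi hx]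
  · have hiN : i = s.N := by
      by_contra h
      have := s.arcs.b_le (i := i) (j := s.N - 1) (by omega) (Nat.sub_le _ _)
      have h2 := s.b_pred
      have h3 := hx.2
      change s.b i ≤ s.b (s.N - 1) at this
      linarith
    subst hiN
    obtain ⟨y, rfl⟩ : ∃ y, x = y + 1 := ⟨x - 1, by ring⟩
    have hy : y ∈ s.arc 0 := s.arcs.mem_arc_last.1 hx
    have hy1 : y < 1 := hy.2.trans s.arcs.b_zero_lt_one
    have e := gpathExt_add_one s.gpath (x := y) (by linarith) hy1.le
    rw [hI y (by linarith) hy1.le, s.lift_eq (Nat.zero_le _) hy] at e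
    rw [s.f_last y hy, eq_inv_smul_iff]
    simpa [hol, gpath] using e

theorem smul_gpathExt_gpath {i : ℕ} {x : ℝ} (hi : i ≤ s.N) (hx : x ∈ s.arc i) :
    s.hol i • gpathExt s.gpath x = s.f i x := by
  rw [s.gpathExt_gpath hi hx, smul_inv_smul]

/-- The relations for the transition maps give `(j k).elt * t.hol k = s.hol (θ k)` by induction, so
that the local factors cancel in the lift. At the last arc `j` is the identity, which gives equality
of the group elements. -/
theorem gpath_eq_of_refines {s t : LoopSystem A} (h : t.Refines s) : t.gpath = s.gpath := by
  obtain ⟨θ, j, h0, hN, hj0, hjN, h1, h2⟩ := h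
  have key : ∀ k ≤ t.N, (j k).elt * t.hol k = s.hol (θ k) := by
    intro k hk
    induction k with
    | zero => simp [hol, hj0, h0]
    | succ k ih =>
      obtain ⟨g, hg, hρ⟩ := h2 k hk
      have e : s.hol (θ (k + 1)) = g * s.hol (θ k) := by
        rcases hg with ⟨e, rfl⟩ | ⟨e, rfl⟩ | ⟨e, rfl⟩
        · rw [e, one_mul]
        · rw [e]; rfl
        · rw [e]; simp [hol]
      rw [e, ← ih (by omega)]
      simp [hol, hρ, mul_assoc]
  refine gpath_ext ?_ fun x => ?_
  · have := key t.N le_rfl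
    rwa [hjN, one_mul, hN] at this
  · obtain ⟨k, hk, hx⟩ := t.arcs.exists_mem_arc_unitInterval x
    obtain ⟨h3, h4, -, h5⟩ := h1 k hk
    rw [t.lift_eq hk hx]
    refine Eq.trans ?_ (s.lift_eq h3 (h4 hx)).symm
    rw [← key k hk, ← (h5 x hx).2]
    simp [mul_smul]

/-- The automorphisms telescope to `t.hol k = δ k * s.hol k`; they cancel in the lift, and they are
trivial at both ends. -/
theorem gpath_eq_of_iso {s t : LoopSystem A} (h : s.Iso t) : s.gpath = t.gpath := by
  obtain ⟨hN, hU, δ, h0, hδN, h1, h2⟩ := h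
  have key : ∀ k ≤ s.N, t.hol k = δ k * s.hol k := by
    intro k hk
    induction k with
    | zero => simp [hol, h0]
    | succ k ih => simp [hol, h2 k hk, ih (by omega), mul_assoc]
  refine gpath_ext ?_ fun x => ?_
  · change s.hol s.N = t.hol t.N
    rw [hN, key _ le_rfl, hδN, one_mul]
  · obtain ⟨k, hk, hx⟩ := s.arcs.exists_mem_arc_unitInterval x
    have hx' : (x : ℝ) ∈ t.arc k := by
      change (x : ℝ) ∈ Ioo _ _
      rw [(hU k hk).1, (hU k hk).2.1]; exact hx
    rw [s.lift_eq hk hx]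
    refine Eq.trans ?_ (t.lift_eq (hN ▸ hk) hx').symm
    rw [(h1 k hk).2 x hx, key k hk]
    simp [mul_smul]

end LoopSystem

/-- The `G`-path of a based loop. -/
def OrbiLoops.toGPath {A : BasedGlobalOrbispace.{u, v}} : OrbiLoops A → A.GPath :=
  Quot.lift LoopSystem.gpath fun _ _ ⟨_, _, hs, ht, h⟩ =>
    (LoopSystem.gpath_eq_of_refines hs).symm.trans
      ((LoopSystem.gpath_eq_of_iso h).trans (LoopSystem.gpath_eq_of_refines ht))

/-! ### Loop systems with a given `G`-path -/

namespace LoopSystem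

open BasedGlobalOrbispace

variable {A : BasedGlobalOrbispace.{u, v}}

/-- The components of `Û ∩ π⁻¹(V)` contain the connected subsets which they meet. -/
theorem mem_component {U V : A.BasicOpen} {c d : A.G} {f : ℝ → A.Y} (hf : Continuous f) {l r : ℝ}
    (hU : ∀ x ∈ Ioo l r, c • f x ∈ A.hat U) (hV : ∀ x ∈ Ioo l r, d • f x ∈ A.hat V) {x y : ℝ}
    (hx : x ∈ Ioo l r) (hy : y ∈ Ioo l r) :
    c • f y ∈ connectedComponentIn (A.hat U ∩ A.preim V) (c • f x) := by
  have hpre : IsPreconnected ((fun x => c • f x) '' Ioo l r) :=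
    isPreconnected_Ioo.image _ (hf.const_smul c).continuousOn
  refine hpre.subset_connectedComponentIn (mem_image_of_mem _ hx) ?_ (mem_image_of_mem _ hy)
  rintro _ ⟨z, hz, rfl⟩
  refine ⟨hU z hz, ?_⟩
  have := A.hat_subset V (hV z hz)
  exact (A.smul_mem_preim c).2 ((A.smul_mem_preim d).1 this)

theorem gpathExt_eq_of_arc_zero (p : A.GPath) (C : CircleArcs) {x : ℝ} (hx : x ∈ C.arc 0) :
    p.1.2 • gpathExt p (x + 1) = gpathExt p x :=
  gpathExt_add_one p (C.neg_one_lt_a.trans hx.1) (hx.2.trans C.b_zero_lt_one).le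

/-- The loop system over given arcs and basic open sets with a given `G`-path, where `c i` takes the
values of the path over the arc `i` into `Û_i`. -/
def ofGPath (p : A.GPath) (C : CircleArcs) (U : ℕ → A.BasicOpen) (hU0 : U 0 = A.baseOpen)
    (hUN : U C.N = A.baseOpen) (c : ℕ → A.G) (hc0 : c 0 = 1) (hcN : c C.N = p.1.2)
    (hc : ∀ i ≤ C.N, ∀ x ∈ C.arc i, c i • gpathExt p x ∈ A.hat (U i)) : LoopSystem A where
  N := C.N
  three_le := C.three_le
  a := C.a
  b := C.b
  a_zero := C.a_zero
  b_zero := C.b_zero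
  a_one := C.a_one
  b_pred := C.b_pred
  a_last := C.a_last
  b_last := C.b_last
  overlap := C.overlap
  separate := C.separate
  U := U
  U_zero := hU0
  U_last := hUN
  f i x := c i • gpathExt p x
  f_cont _ _ := ((continuous_gpathExt_const p).const_smul _).continuousOn
  f_mem := hc
  f_last x hx := by rw [hcN, gpathExt_eq_of_arc_zero p C hx, hc0, one_smul]
  f_base := by rw [hc0, one_smul, gpathExt_zero]
  -- The overlap is connected, so its image lies in a single component, which may be selected by the
  -- midpoint.
  ρ i := ⟨c (i + 1) * (c i)⁻¹, connectedComponentIn (A.hat (U i) ∩ A.preim (U (i + 1)))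
    (c i • gpathExt p (C.mid i))⟩
  ρ_mem i hi := ⟨c i • gpathExt p (C.mid i), hc i hi.le _ (C.overlap_subset hi (C.mid_mem hi)), by
    simpa [mul_smul] using hc (i + 1) hi _ (C.overlap_subset_succ hi (C.mid_mem hi)), rfl⟩
  compat i hi x hx := ⟨mem_component (continuous_gpathExt_const p)
    (fun y hy => hc i hi.le y (C.overlap_subset hi hy))
    (fun y hy => hc (i + 1) hi y (C.overlap_subset_succ hi hy)) (C.mid_mem hi) hx,
    by simp [mul_smul]⟩

section ofGPath

variable {p : A.GPath} {C : CircleArcs} {U : ℕ → A.BasicOpen} {hU0 : U 0 = A.baseOpen}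
  {hUN : U C.N = A.baseOpen} {c : ℕ → A.G} {hc0 : c 0 = 1} {hcN : c C.N = p.1.2}
  {hc : ∀ i ≤ C.N, ∀ x ∈ C.arc i, c i • gpathExt p x ∈ A.hat (U i)}

theorem hol_ofGPath (i : ℕ) : (ofGPath p C U hU0 hUN c hc0 hcN hc).hol i = c i := by
  induction i with
  | zero => exact hc0.symm
  | succ i ih => rw [hol, ih]; simp [ofGPath]

theorem gpath_ofGPath : (ofGPath p C U hU0 hUN c hc0 hcN hc).gpath = p := by
  refine gpath_ext ((hol_ofGPath _).trans hcN) fun t => ?_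
  obtain ⟨i, hi, ht⟩ := C.exists_mem_arc_unitInterval t
  rw [lift_eq _ hi ht, hol_ofGPath]
  exact (inv_smul_smul _ _).trans (gpathExt_of_mem p t)

/-- Two systems with the same `G`-path are related over an arc by the element `s.hol (θ k) * (c
k)⁻¹`. The arcs `θ k` and `θ (k + 1)` share the midpoint of an overlap, hence are equal or
consecutive. -/
theorem ofGPath_refines {s : LoopSystem A} (hs : s.gpath = p) {θ : ℕ → ℕ} (h0 : θ 0 = 0)
    (hN : θ C.N = s.N) (hθ : ∀ k ≤ C.N, θ k ≤ s.N ∧ C.arc k ⊆ s.arc (θ k)) :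
    (ofGPath p C U hU0 hUN c hc0 hcN hc).Refines s := by
  have hmid : ∀ k ≤ C.N, (C.a k + C.b k) / 2 ∈ C.arc k := fun k hk => by
    have h : C.a k < C.b k := by
      rcases hk.lt_or_eq with h | rfl
      · exact (C.a_lt_succ h).trans (C.overlap k h)
      · rw [C.a_last, C.b_last]; linarith [C.a_zero, C.b_zero]
    exact ⟨by linarith, by linarith⟩
  have hs' : ∀ k ≤ C.N, ∀ x ∈ C.arc k, s.hol (θ k) • gpathExt p x = s.f (θ k) x := fun k hk x hx => by
    rw [← hs]; exact s.smul_gpathExt_gpath (hθ k hk).1 ((hθ k hk).2 hx)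
  have hs'' : ∀ k ≤ C.N, ∀ x ∈ C.arc k, s.hol (θ k) • gpathExt p x ∈ A.hat (s.U (θ k)) :=
    fun k hk x hx => by
      rw [hs' k hk x hx]; exact s.f_mem _ (hθ k hk).1 x ((hθ k hk).2 hx)
  refine ⟨θ, fun k => ⟨s.hol (θ k) * (c k)⁻¹, connectedComponentIn
    (A.hat (U k) ∩ A.preim (s.U (θ k))) (c k • gpathExt p ((C.a k + C.b k) / 2))⟩, h0, hN, ?_, ?_,
    fun k hk => ⟨(hθ k hk).1, (hθ k hk).2, ?_, fun x hx => ⟨?_, ?_⟩⟩, fun k hk => ?_⟩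
  · simp [h0, hc0, hol]
  · change s.hol (θ C.N) * (c C.N)⁻¹ = 1
    rw [hN, hcN, ← hs, mul_inv_eq_one]; rfl
  · refine ⟨c k • gpathExt p ((C.a k + C.b k) / 2), hc k hk _ (hmid k hk), ?_, rfl⟩
    simpa [mul_smul] using hs'' k hk _ (hmid k hk)
  · exact mem_component (continuous_gpathExt_const p) (hc k hk) (hs'' k hk) (hmid k hk) hx
  · simpa [ofGPath, mul_smul] using hs' k hk x hx
  · have hk' : k < C.N := hk
    have hm := C.mid_mem hk'
    have h1 := (hθ k hk'.le).2 (C.overlap_subset hk' hm)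
    have h2 := (hθ (k + 1) hk').2 (C.overlap_subset_succ hk' hm)
    refine ⟨s.hol (θ (k + 1)) * (s.hol (θ k))⁻¹, ?_, by simp [ofGPath, mul_assoc]⟩
    rcases le_total (θ k) (θ (k + 1)) with h | h
    · rcases s.arcs.eq_or_eq_succ h (hθ (k + 1) hk').1 h1 h2 with e | e
      · exact Or.inl ⟨e, by rw [e, mul_inv_cancel]⟩
      · exact Or.inr (Or.inl ⟨e, by rw [e]; simp [hol]⟩)
    · rcases s.arcs.eq_or_eq_succ h (hθ k hk'.le).1 h2 h1 with e | e
      · exact Or.inl ⟨e.symm, by rw [e, mul_inv_cancel]⟩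
      · exact Or.inr (Or.inr ⟨e, by rw [e]; simp [hol]⟩)

end ofGPath

theorem uniform_arc_subset {n : ℕ} (hn : 3 ≤ n) {δ : ℝ} (h : 1 / (n : ℝ) < δ) (k : ℕ) :
    (CircleArcs.uniform n hn).arc k ⊆ Ioo (k / n - δ : ℝ) (k / n + δ) := by
  have hn0 : (0 : ℝ) < n := by positivity
  rintro x ⟨h1, h2⟩
  have e : (2 / 3 : ℝ) / n ≤ 1 / n := by gcongr; norm_num
  simp only [CircleArcs.uniform, sub_div, add_div] at h1 h2
  constructor <;> linarith

/-- Sufficiently fine uniform covers refine the cover of a loop system. -/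
theorem exists_uniform_refinement (s : LoopSystem A) : ∃ δ > 0, ∀ (n : ℕ) (hn : 3 ≤ n),
    1 / (n : ℝ) < δ → ∃ θ : ℕ → ℕ, θ 0 = 0 ∧ θ n = s.N ∧
      ∀ k ≤ n, θ k ≤ s.N ∧ (CircleArcs.uniform n hn).arc k ⊆ s.arc (θ k) := by
  classical
  obtain ⟨δ, hδ, hball⟩ := lebesgue_number_lemma_of_metric (isCompact_Icc (a := (0 : ℝ)) (b := 1))
    (c := fun i : Fin (s.N + 1) => s.arc i) (fun i => isOpen_Ioo) (fun x hx => by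
      obtain ⟨i, hi, h⟩ := s.arcs.exists_mem_arc_unitInterval ⟨x, hx⟩
      exact mem_iUnion.2 ⟨⟨i, by change i ≤ s.N at hi; omega⟩, h⟩)
  have ha := s.a_zero
  have hb := s.b_zero
  -- Besides the Lebesgue number, the bounds `-s.a 0` and `s.b 0` are needed: they put the first and
  -- the last uniform arc into the arcs `0` and `N`, as demanded of `θ` at the base point.
  refine ⟨min δ (min (-s.a 0) (s.b 0)), lt_min hδ (lt_min (by linarith) hb), fun n hn h => ?_⟩
  have hn0 : (0 : ℝ) < n := by positivity
  have h1 := h.trans_le (min_le_left _ _)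
  have h2 := h.trans_le ((min_le_right _ _).trans (min_le_left _ _))
  have h3 := h.trans_le ((min_le_right _ _).trans (min_le_right _ _))
  have hex : ∀ k : ℕ, k ≤ n → ∃ i ≤ s.N, (CircleArcs.uniform n hn).arc k ⊆ s.arc i := by
    intro k hk
    have hk' : (k : ℝ) ≤ n := by exact_mod_cast hk
    obtain ⟨i, hi⟩ := hball (k / n) ⟨by positivity, (div_le_one hn0).2 hk'⟩
    refine ⟨i, by omega, (uniform_arc_subset hn h1 k).trans ?_⟩
    rwa [Real.ball_eq_Ioo] at hi
  choose! θ hθ using hex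
  refine ⟨fun k => if k = 0 then 0 else if k = n then s.N else θ k, if_pos rfl, ?_, fun k hk => ?_⟩
  · simp only [if_true, if_neg (show n ≠ 0 by omega)]
  · rcases eq_or_ne k 0 with rfl | hk0
    · simp only [if_true]
      refine ⟨Nat.zero_le _, fun x hx => ?_⟩
      have h4 := uniform_arc_subset hn h2 0 hx
      have h5 := uniform_arc_subset hn h3 0 hx
      simp only [Nat.cast_zero, zero_div, zero_sub, zero_add, neg_neg] at h4 h5
      exact ⟨h4.1, h5.2⟩
    rcases eq_or_ne k n with rfl | hkn
    · simp only [if_true, if_neg hk0]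
      refine ⟨le_rfl, fun x hx => ?_⟩
      have h4 := uniform_arc_subset hn h2 k hx
      have h5 := uniform_arc_subset hn h3 k hx
      rw [div_self hn0.ne'] at h4 h5
      exact ⟨by linarith [h4.1, s.a_last], by linarith [h5.2, s.b_last]⟩
    · simp only [if_neg hk0, if_neg hkn]
      exact hθ k hk

theorem exists_fine {δ : ℝ} (hδ : 0 < δ) : ∃ n : ℕ, 3 ≤ n ∧ 1 / (n : ℝ) < δ := by
  obtain ⟨m, hm⟩ := exists_nat_one_div_lt hδ
  refine ⟨m + 3, by omega, lt_of_le_of_lt ?_ hm⟩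
  push_cast
  gcongr; norm_num

/-- Loop systems with the same `G`-path are equivalent. -/
theorem directEquiv_of_gpath_eq {s t : LoopSystem A} (h : s.gpath = t.gpath) : s.DirectEquiv t := by
  obtain ⟨δ₁, hδ₁, H₁⟩ := s.exists_uniform_refinement
  obtain ⟨δ₂, hδ₂, H₂⟩ := t.exists_uniform_refinement
  obtain ⟨n, hn, hlt⟩ := exists_fine (lt_min hδ₁ hδ₂)
  obtain ⟨θ, h0, hN, hθ⟩ := H₁ n hn (hlt.trans_le (min_le_left _ _))
  obtain ⟨θ', h0', hN', hθ'⟩ := H₂ n hn (hlt.trans_le (min_le_right _ _))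
  let C := CircleArcs.uniform n hn
  -- The basic open sets are taken from `s`, but `r` refines `t` as well: a refinement requires
  -- transition maps between the basic open sets, not inclusions.
  let r : LoopSystem A := ofGPath s.gpath C (fun k => s.U (θ k)) (by rw [h0, s.U_zero])
    (by rw [show θ C.N = s.N from hN, s.U_last]) (fun k => s.hol (θ k)) (by rw [h0]; rfl)
    (by rw [show θ C.N = s.N from hN]; rfl) (fun k hk x hx => by
      rw [s.smul_gpathExt_gpath (hθ k hk).1 ((hθ k hk).2 hx)]
      exact s.f_mem _ (hθ k hk).1 x ((hθ k hk).2 hx))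
  exact ⟨r, r, ofGPath_refines rfl h0 hN hθ, ofGPath_refines h.symm h0' hN' hθ', Iso.refl r⟩

/-- Every `G`-path is the `G`-path of a loop system. -/
theorem exists_gpath_eq (p : A.GPath) : ∃ s : LoopSystem A, s.gpath = p := by
  classical
  -- The path never leaves the component of `ô`, so this single basic open set serves for all arcs
  -- away from the base point.
  let V : A.BasicOpen :=
    { carrier := A.proj '' connectedComponent A.basePt
      isOpen := A.isOpenQuotientMap_proj.isOpenMap _ isOpen_connectedComponent
      isConnected := isConnected_connectedComponent.image _
        A.isOpenQuotientMap_proj.continuous.continuousOn }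
  have hV : ∀ y ∈ connectedComponent A.basePt, y ∈ A.preim V := fun y hy => mem_image_of_mem _ hy
  obtain ⟨g, hg⟩ := A.exists_mem_hat (hV _ mem_connectedComponent)
  have hgV : ∀ x, g • gpathExt p x ∈ A.hat V := fun x => by
    refine A.subset_hat (S := (fun y => g • y) '' connectedComponent A.basePt)
      (isPreconnected_connectedComponent.image _ (continuous_const_smul g).continuousOn) ?_
      (mem_image_of_mem _ mem_connectedComponent) hg (mem_image_of_mem _ ?_)
    · rintro _ ⟨y, hy, rfl⟩
      exact (A.smul_mem_preim g).2 (hV y hy)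
    · have hr : IsPreconnected (range (gpathExt p)) :=
        isPreconnected_range (continuous_gpathExt_const p)
      exact hr.subset_connectedComponent ⟨0, gpathExt_zero p⟩ (mem_range_self x)
  have hnear : gpathExt p ⁻¹' A.hat A.baseOpen ∈ 𝓝 (0 : ℝ) :=
    (continuous_gpathExt_const p).continuousAt.preimage_mem_nhds
      ((A.hat_isOpen _).mem_nhds (by rw [gpathExt_zero]; exact A.basePt_mem))
  obtain ⟨δ, hδ, hsub⟩ := Metric.mem_nhds_iff.1 hnear
  obtain ⟨n, hn, hlt⟩ := exists_fine hδ
  have hn0 : n ≠ 0 := by omega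
  let C := CircleArcs.uniform n hn
  have hz : ∀ x ∈ C.arc 0, gpathExt p x ∈ A.hat A.baseOpen := fun x hx => hsub (by
    have := uniform_arc_subset hn hlt 0 hx
    rw [Real.ball_eq_Ioo]
    simpa using this)
  -- Only the arcs `0` and `n`, the two lifts of the arc at the base point, must carry `U_o`, with
  -- the group elements 1 and `p.1.2`.
  refine ⟨ofGPath p C (fun k => if k = 0 ∨ k = n then A.baseOpen else V) (if_pos (Or.inl rfl))
    (if_pos (Or.inr rfl)) (fun k => if k = 0 then 1 else if k = n then p.1.2 else g) (if_pos rfl)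
    ((if_neg hn0).trans (if_pos rfl)) fun k hk x hx => ?_, gpath_ofGPath⟩
  rcases eq_or_ne k 0 with rfl | hk0
  · simpa using hz x hx
  rcases eq_or_ne k n with rfl | hkn
  · obtain ⟨y, rfl⟩ : ∃ y, x = y + 1 := ⟨x - 1, by ring⟩
    have hy : y ∈ C.arc 0 := C.mem_arc_last.1 hx
    simp only [if_neg hk0, if_true, or_true]
    rw [gpathExt_eq_of_arc_zero p C hy]
    exact hz y hy
  · simpa [hk0, hkn] using hgV x

end LoopSystem

namespace OrbiLoops

variable {A : BasedGlobalOrbispace.{u, v}}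

/-- The `G`-path is thus a complete invariant of a based loop, and a single direct equivalence
already connects any two representatives. -/
theorem toGPath_bijective : Function.Bijective (toGPath (A := A)) := by
  constructor
  · rintro ⟨s⟩ ⟨t⟩ h
    exact Quot.sound (LoopSystem.directEquiv_of_gpath_eq h)
  · intro p
    obtain ⟨s, hs⟩ := LoopSystem.exists_gpath_eq p
    exact ⟨mk s, hs⟩

end OrbiLoops

/-! ### The topology of the based loop space -/

theorem Transition.continuous_elt {G Y : Type*} [TopologicalSpace G] :
    Continuous (Transition.elt : Transition G Y → G) :=
  continuous_iff_le_induced.2 inf_le_left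

theorem Transition.continuous_mk {G Y : Type*} [TopologicalSpace G] (D : Set Y) :
    Continuous fun g : G => (⟨g, D⟩ : Transition G Y) := by
  refine continuous_iff_coinduced_le.2 (le_inf ?_ ?_)
  · exact continuous_iff_coinduced_le.1 (continuous_induced_rng.2 continuous_id)
  · let _ : TopologicalSpace (Set Y) := ⊥
    exact continuous_iff_coinduced_le.1 (continuous_induced_rng.2 continuous_const)

namespace LoopSystem

open BasedGlobalOrbispace

variable {A : BasedGlobalOrbispace.{u, v}}

/-- The products of the group elements depend continuously on the transition maps. -/
theorem exists_nhds_hol (s : LoopSystem A) (n : ℕ) {O : Set A.G} (hO : O ∈ 𝓝 (s.hol n)) :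
    ∃ W : ℕ → Set (Transition A.G A.Y), (∀ i, IsOpen (W i) ∧ s.ρ i ∈ W i) ∧
      ∀ t : LoopSystem A, (∀ i < n, t.ρ i ∈ W i) → t.hol n ∈ O := by
  classical
  induction n generalizing O with
  | zero => exact ⟨fun _ => univ, fun _ => ⟨isOpen_univ, mem_univ _⟩, fun t _ => mem_of_mem_nhds hO⟩
  | succ n ih =>
    have hO' : O ∈ 𝓝 ((s.ρ n).elt * s.hol n) := hO
    obtain ⟨O₁, h₁, O₂, h₂, hO₁₂⟩ := mem_nhds_prod_iff.1
      (continuous_mul.continuousAt.preimage_mem_nhds (x := ((s.ρ n).elt, s.hol n)) hO')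
    obtain ⟨O₃, h₃, ho, hm⟩ := mem_nhds_iff.1 h₁
    obtain ⟨W, hW, hWt⟩ := ih h₂
    refine ⟨fun i => W i ∩ if i = n then Transition.elt ⁻¹' O₃ else univ, fun i => ?_,
      fun t ht => ?_⟩
    · rcases eq_or_ne i n with rfl | h
      · simp only [if_true]
        exact ⟨(hW i).1.inter (ho.preimage Transition.continuous_elt), (hW i).2, hm⟩
      · simpa only [if_neg h, inter_univ] using hW i
    · have h4 : (t.ρ n).elt ∈ O₃ := by
        have := (ht n (Nat.lt_succ_self n)).2
        rwa [if_pos rfl] at this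
      have h5 : t.hol n ∈ O₂ := hWt t fun i hi => (ht i (hi.trans (Nat.lt_succ_self n))).1
      exact hO₁₂ (mk_mem_prod (h₃ h4) h5)

end LoopSystem

namespace OrbiLoops

open BasedGlobalOrbispace

variable {A : BasedGlobalOrbispace.{u, v}}

theorem subbasic_mem_nhds (s : LoopSystem A) {K : ℕ → Set ℝ} {V : ℕ → Set A.Y}
    {W : ℕ → Set (Transition A.G A.Y)} (h : ∀ i < s.N, IsCompact (K i) ∧ K i ⊆ s.arc i ∧
      IsOpen (V i) ∧ MapsTo (s.f i) (K i) (V i) ∧ IsOpen (W i) ∧ s.ρ i ∈ W i) :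
    subbasic s K V W ∈ 𝓝 (mk s) :=
  IsOpen.mem_nhds (TopologicalSpace.isOpen_generateFrom_of_mem ⟨s, K, V, W, h, rfl⟩)
    ⟨s, rfl, rfl, fun _ _ => rfl, fun i hi => ⟨(h i hi).2.1, (h i hi).2.2.2.1, (h i hi).2.2.2.2.2⟩⟩

/-- The element is a finite product of transition elements, so the maps need no control and the
compact sets can be empty. -/
theorem continuous_toGPath_elt : Continuous fun γ : OrbiLoops A => (toGPath γ).1.2 := by
  refine continuous_iff_continuousAt.2 ?_
  rintro ⟨s⟩ O hO
  obtain ⟨W, hW, hWt⟩ := s.exists_nhds_hol s.N hO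
  refine Filter.mem_map.2 (Filter.mem_of_superset (subbasic_mem_nhds s (K := fun _ => ∅)
    (V := fun _ => univ) (W := W) fun i _ => ⟨isCompact_empty, empty_subset _, isOpen_univ,
      mapsTo_univ _ _, (hW i).1, (hW i).2⟩) ?_)
  rintro _ ⟨t, rfl, hN, -, ht⟩
  have : t.hol s.N ∈ O := hWt t fun i hi => (ht i hi).2.2
  rw [← hN] at this
  exact this

/-- On the arc `i` the value is `(hol i)⁻¹ • f i x`. The first factor is controlled by the
transition maps, the second jointly in loop and time by a compact neighbourhood of `x`. The arc `N`
is excluded, as the subbasic sets impose conditions on the indices below `N` only. -/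
theorem continuousAt_gpathExt (s : LoopSystem A) {i : ℕ} (hi : i < s.N) {x : ℝ} (hx : x ∈ s.arc i) :
    ContinuousAt (fun q : OrbiLoops A × ℝ => gpathExt (toGPath q.1) q.2) (mk s, x) := by
  classical
  intro O hO
  have hO : O ∈ 𝓝 (gpathExt s.gpath x) := hO
  rw [s.gpathExt_gpath hi.le hx] at hO
  have hc : Continuous fun q : A.G × A.Y => q.1⁻¹ • q.2 := continuous_fst.inv.smul continuous_snd
  obtain ⟨O₁, h₁, O₂, h₂, hO₁₂⟩ := mem_nhds_prod_iff.1
    (hc.continuousAt.preimage_mem_nhds (x := (s.hol i, s.f i x)) hO)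
  obtain ⟨V, hV, hVo, hVx⟩ := mem_nhds_iff.1 h₂
  obtain ⟨W, hW, hWt⟩ := s.exists_nhds_hol i h₁
  have hn : s.arc i ∈ 𝓝 x := isOpen_Ioo.mem_nhds hx
  have hn' : s.arc i ∩ s.f i ⁻¹' V ∈ 𝓝 x := Filter.inter_mem hn
    (((s.f_cont i hi.le).continuousAt hn).preimage_mem_nhds (hVo.mem_nhds hVx))
  obtain ⟨K, hK, hKs, hKc⟩ := local_compact_nhds hn'
  have hsub := subbasic_mem_nhds s (K := fun j => if j = i then K else ∅)
    (V := fun j => if j = i then V else univ) (W := W) fun j _ => by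
      rcases eq_or_ne j i with rfl | h
      · simp only [if_true]
        exact ⟨hKc, fun y hy => (hKs hy).1, hVo, fun y hy => (hKs hy).2, (hW j).1, (hW j).2⟩
      · simp only [if_neg h]
        exact ⟨isCompact_empty, empty_subset _, isOpen_univ, mapsTo_univ _ _, (hW j).1, (hW j).2⟩
  refine Filter.mem_map.2 (Filter.mem_of_superset (prod_mem_nhds hsub hK) ?_)
  rintro ⟨_, y⟩ ⟨⟨t, rfl, hN, -, ht⟩, hy⟩
  obtain ⟨h3, h4, -⟩ := ht i hi
  simp only [if_true] at h3 h4
  have h5 : t.hol i ∈ O₁ := hWt t fun j hj => (ht j (hj.trans hi)).2.2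
  change gpathExt t.gpath y ∈ O
  rw [t.gpathExt_gpath (hN ▸ hi.le) (h3 hy)]
  exact hO₁₂ (mk_mem_prod h5 (hV (h4 hy)))

theorem continuous_toGPath : Continuous (toGPath (A := A)) := by
  refine Continuous.subtype_mk (f := fun γ => (toGPath γ).1)
    (Continuous.prodMk (f := fun γ => (toGPath γ).1.1) ?_ continuous_toGPath_elt) _
  refine ContinuousMap.continuous_of_continuous_uncurry _ (continuous_iff_continuousAt.2 ?_)
  rintro ⟨⟨s⟩, x⟩
  change ContinuousAt _ (mk s, x)
  obtain ⟨i, hi, hx⟩ := s.arcs.exists_mem_arc_unitInterval x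
  rcases hi.lt_or_eq with hi | rfl
  · have h1 : ContinuousAt (fun q : OrbiLoops A × I => (q.1, (q.2 : ℝ))) (mk s, x) :=
      (continuous_fst.prodMk (continuous_subtype_val.comp continuous_snd)).continuousAt
    refine (ContinuousAt.comp (x := (mk s, x)) (continuousAt_gpathExt s hi hx) h1).congr (Filter.Eventually.of_forall fun q => ?_)
    exact gpathExt_of_mem _ _
  -- A point of the arc `N` is moved back by one turn to the arc `0`, at the cost of the factor
  -- `g⁻¹`, which is already known to be continuous.
  · have hx' : (x : ℝ) - 1 ∈ s.arc 0 := s.arcs.mem_arc_last.1 (by rwa [sub_add_cancel])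
    have h1 : ContinuousAt (fun q : OrbiLoops A × I => (q.1, (q.2 : ℝ) - 1)) (mk s, x) :=
      (continuous_fst.prodMk
        ((continuous_subtype_val.comp continuous_snd).sub continuous_const)).continuousAt
    have hpos : 0 < s.N := by have := s.three_le; omega
    have h2 : ContinuousAt (fun q : OrbiLoops A × I => (toGPath q.1).1.2⁻¹) (mk s, x) :=
      (continuous_toGPath_elt.comp continuous_fst).inv.continuousAt
    have h3 := h2.smul (ContinuousAt.comp (x := (mk s, x)) (continuousAt_gpathExt s hpos hx') h1)
    have hx0 : (0 : ℝ) < x := by linarith [s.arcs.neg_one_lt_a, hx'.1, show s.a 0 = s.arcs.a 0 from rfl]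
    have hnear : {q : OrbiLoops A × I | 0 < (q.2 : ℝ)} ∈ 𝓝 (mk s, x) :=
      (isOpen_lt continuous_const (continuous_subtype_val.comp continuous_snd)).mem_nhds hx0
    refine h3.congr ?_
    filter_upwards [hnear] with q hq
    have hq' : 0 < (q.2 : ℝ) := hq
    have h4 := gpathExt_add_one (toGPath q.1) (x := (q.2 : ℝ) - 1) (by linarith)
      (by linarith [q.2.2.2])
    rw [sub_add_cancel, gpathExt_of_mem] at h4
    exact inv_smul_eq_iff.2 h4.symm

/-! ### Continuity of the inverse bijection. -/

/-- The loops near a given loop system are represented by loop systems over slightly smaller arcs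
with nearby maps and transition maps. -/
theorem exists_system_of_near (t : LoopSystem A) {K : ℕ → Set ℝ} {V : ℕ → Set A.Y}
    {W : ℕ → Set (Transition A.G A.Y)} (h : ∀ i < t.N, IsCompact (K i) ∧ K i ⊆ t.arc i ∧
      IsOpen (V i) ∧ MapsTo (t.f i) (K i) (V i) ∧ IsOpen (W i) ∧ t.ρ i ∈ W i) :
    ∀ᶠ p in 𝓝 t.gpath, ∃ r : LoopSystem A, r.gpath = p ∧ r.N = t.N ∧ (∀ i ≤ t.N, r.U i = t.U i) ∧
      ∀ i < t.N, K i ⊆ r.arc i ∧ MapsTo (r.f i) (K i) (V i) ∧ r.ρ i ∈ W i := by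
  classical
  have hpos : 0 < t.N := by have := t.three_le; omega
  -- the size by which the arcs are shrunk
  have e1 : ∀ᶠ ε in 𝓝[>] (0 : ℝ), t.a 0 + ε < 0 := by
    refine nhdsWithin_le_nhds (ContinuousAt.eventually_lt (f := fun ε : ℝ => t.a 0 + ε)
      (by fun_prop) continuousAt_const ?_)
    simpa using t.a_zero
  have e2 : ∀ᶠ ε in 𝓝[>] (0 : ℝ), 0 < t.b 0 - ε := by
    refine nhdsWithin_le_nhds (ContinuousAt.eventually_lt (g := fun ε : ℝ => t.b 0 - ε)
      continuousAt_const (by fun_prop) ?_)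
    simpa using t.b_zero
  have e3 : ∀ᶠ ε in 𝓝[>] (0 : ℝ), ∀ i ∈ Finset.range t.N, t.a (i + 1) + ε < t.b i - ε := by
    refine (Filter.eventually_all_finset _).2 fun i hi => nhdsWithin_le_nhds
      (ContinuousAt.eventually_lt (f := fun ε : ℝ => t.a (i + 1) + ε) (g := fun ε : ℝ => t.b i - ε)
        (by fun_prop) (by fun_prop) ?_)
    simpa using t.overlap i (Finset.mem_range.1 hi)
  have e4 : ∀ᶠ ε in 𝓝[>] (0 : ℝ), ∀ i ∈ Finset.range t.N,
      ∀ x ∈ K i, t.a i + ε < x ∧ x < t.b i - ε := by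
    refine (Filter.eventually_all_finset _).2 fun i hi => nhdsWithin_le_nhds ?_
    have hi' := Finset.mem_range.1 hi
    refine (h i hi').1.eventually_forall_of_forall_eventually fun x hx => ?_
    have hx' := (h i hi').2.1 hx
    refine Filter.Eventually.and ?_ ?_
    · exact ContinuousAt.eventually_lt (x₀ := ((0 : ℝ), x)) (f := fun q : ℝ × ℝ => t.a i + q.1)
        (g := Prod.snd) (by fun_prop) (by fun_prop) (by simpa using hx'.1)
    · exact ContinuousAt.eventually_lt (x₀ := ((0 : ℝ), x)) (f := Prod.snd)
        (g := fun q : ℝ × ℝ => t.b i - q.1) (by fun_prop) (by fun_prop) (by simpa using hx'.2)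
  obtain ⟨ε, ⟨⟨⟨h1, h2⟩, h3⟩, h4⟩, hε⟩ :=
    (((e1.and e2).and e3).and e4 |>.and self_mem_nhdsWithin).exists
  have hε0 : 0 < ε := hε
  -- The closures of the shrunk arcs are compact inside the arcs of `t`, so mapping them into `Û_i`
  -- is an open condition on the path, and they still contain the sets `K i`.
  let C := t.arcs.shrink ε hε0.le h1 h2 fun i hi => h3 i (Finset.mem_range.2 hi)
  have hCsub : ∀ i, Icc (C.a i) (C.b i) ⊆ t.arc i := fun i x hx =>
    ⟨by have : t.a i + ε ≤ x := hx.1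
        linarith, by
        have : x ≤ t.b i - ε := hx.2
        linarith⟩
  have hmid : ∀ i, C.mid i = t.arcs.mid i := fun i => by
    simp only [CircleArcs.mid, C, CircleArcs.shrink]; ring
  -- The group elements of `t` are kept for nearby paths, except at the last arc, where `p.1.2` is
  -- forced. Only the last transition element varies.
  let c : A.GPath → ℕ → A.G := fun p i => if i < t.N then t.hol i else p.1.2
  have hc0 : ∀ p, c p 0 = 1 := fun p => if_pos hpos
  have hcN : ∀ p, c p t.N = p.1.2 := fun p => if_neg (lt_irrefl _)
  have hct : ∀ i ≤ t.N, c t.gpath i = t.hol i := fun i hi => by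
    rcases hi.lt_or_eq with hi | rfl
    · exact if_pos hi
    · exact hcN _
  have hcc : ∀ i, Continuous fun p : A.GPath => c p i := fun i => by
    by_cases hi : i < t.N
    · simp only [c, if_pos hi]; exact continuous_const
    · simp only [c, if_neg hi]; exact continuous_snd.comp continuous_subtype_val
  have hcf : ∀ i, Continuous fun q : A.GPath × ℝ => c q.1 i • gpathExt q.1 q.2 := fun i =>
    ((hcc i).comp continuous_fst).smul continuous_gpathExt
  have hf : ∀ i ≤ t.N, ∀ x ∈ t.arc i, c t.gpath i • gpathExt t.gpath x = t.f i x :=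
    fun i hi x hx => by rw [hct i hi, t.smul_gpathExt_gpath hi hx]
  -- the conditions on nearby paths
  have n1 : ∀ᶠ p in 𝓝 t.gpath, ∀ i ∈ Finset.range t.N, ∀ x ∈ Icc (C.a i) (C.b i),
      c p i • gpathExt p x ∈ A.hat (t.U i) := by
    refine (Filter.eventually_all_finset _).2 fun i hi => ?_
    have hi' := Finset.mem_range.1 hi
    refine isCompact_Icc.eventually_forall_of_forall_eventually fun x hx => ?_
    refine (hcf i).continuousAt.preimage_mem_nhds ((A.hat_isOpen _).mem_nhds ?_)
    simp only [hf i hi'.le x (hCsub i hx)]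
    exact t.f_mem i hi'.le x (hCsub i hx)
  have n2 : ∀ᶠ p in 𝓝 t.gpath, ∀ i ∈ Finset.range t.N, ∀ x ∈ K i,
      c p i • gpathExt p x ∈ V i := by
    refine (Filter.eventually_all_finset _).2 fun i hi => ?_
    have hi' := Finset.mem_range.1 hi
    obtain ⟨k1, k2, k3, k4, -⟩ := h i hi'
    refine k1.eventually_forall_of_forall_eventually fun x hx => ?_
    refine (hcf i).continuousAt.preimage_mem_nhds (k3.mem_nhds ?_)
    simp only [hf i hi'.le x (k2 hx)]
    exact k4 hx
  -- The topology of transition maps is discrete in the domain, so the domain must not change: the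
  -- midpoint has to stay in the same open component.
  have n3 : ∀ᶠ p in 𝓝 t.gpath, ∀ i ∈ Finset.range t.N,
      c p i • gpathExt p (C.mid i) ∈ (t.ρ i).dom := by
    refine (Filter.eventually_all_finset _).2 fun i hi => ?_
    have hi' := Finset.mem_range.1 hi
    have hm := t.arcs.mid_mem (i := i) hi'
    have ho : IsOpen (t.ρ i).dom := by
      obtain ⟨y, -, -, e⟩ := t.ρ_mem i hi'
      rw [e]
      exact ((A.hat_isOpen _).inter (A.isOpen_preim _)).connectedComponentIn
    have hcont : Continuous fun p : A.GPath => c p i • gpathExt p (C.mid i) :=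
      (hcf i).comp (continuous_id.prodMk continuous_const)
    refine hcont.continuousAt.preimage_mem_nhds (ho.mem_nhds ?_)
    rw [hmid, hf i hi'.le _ (t.arcs.overlap_subset hi' hm)]
    exact (t.compat i hi' _ hm).1
  have n4 : ∀ᶠ p in 𝓝 t.gpath, ∀ i ∈ Finset.range t.N,
      (⟨c p (i + 1) * (c p i)⁻¹, (t.ρ i).dom⟩ : Transition A.G A.Y) ∈ W i := by
    refine (Filter.eventually_all_finset _).2 fun i hi => ?_
    have hi' := Finset.mem_range.1 hi
    obtain ⟨-, -, -, -, k5, k6⟩ := h i hi'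
    have hcont := (Transition.continuous_mk (t.ρ i).dom).comp ((hcc (i + 1)).mul (hcc i).inv)
    refine hcont.continuousAt.preimage_mem_nhds (k5.mem_nhds ?_)
    have e : (⟨c t.gpath (i + 1) * (c t.gpath i)⁻¹, (t.ρ i).dom⟩ : Transition A.G A.Y) = t.ρ i := by
      rw [hct _ hi', hct _ hi'.le]
      exact Transition.ext (by simp [LoopSystem.hol]) rfl
    exact e ▸ k6
  filter_upwards [n1, n2, n3, n4] with p m1 m2 m3 m4
  have hmem : ∀ i ≤ C.N, ∀ x ∈ C.arc i, c p i • gpathExt p x ∈ A.hat (t.U i) := by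
    intro i hi x hx
    have hi' : i ≤ t.N := hi
    rcases hi'.lt_or_eq with hi' | rfl
    · exact m1 i (Finset.mem_range.2 hi') x (Ioo_subset_Icc_self hx)
    · obtain ⟨y, rfl⟩ : ∃ y, x = y + 1 := ⟨x - 1, by ring⟩
      have hy : y ∈ C.arc 0 := C.mem_arc_last.1 hx
      have := m1 0 (Finset.mem_range.2 hpos) y (Ioo_subset_Icc_self hy)
      rw [hcN, LoopSystem.gpathExt_eq_of_arc_zero p C hy, t.U_last]
      rwa [hc0, one_smul, t.U_zero] at this
  refine ⟨LoopSystem.ofGPath p C t.U t.U_zero t.U_last (c p) (hc0 p) (hcN p) hmem,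
    LoopSystem.gpath_ofGPath, rfl, fun _ _ => rfl, fun i hi => ?_⟩
  have hi' := Finset.mem_range.2 hi
  refine ⟨fun x hx => h4 i hi' x hx, fun x hx => m2 i hi' x hx, ?_⟩
  have e : (t.ρ i).dom = connectedComponentIn (A.hat (t.U i) ∩ A.preim (t.U (i + 1)))
      (c p i • gpathExt p (C.mid i)) := by
    obtain ⟨y, -, -, e⟩ := t.ρ_mem i hi
    have := m3 i hi'
    rw [e] at this ⊢
    exact connectedComponentIn_eq this
  have := m4 i hi'
  rw [e] at this
  exact this

variable (A) in
/-- The based loop space is homeomorphic to the space of `G`-paths. -/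
def gpathHomeo : OrbiLoops A ≃ₜ A.GPath where
  toEquiv := Equiv.ofBijective toGPath toGPath_bijective
  continuous_toFun := continuous_toGPath
  continuous_invFun := by
    let e : OrbiLoops A ≃ A.GPath := Equiv.ofBijective toGPath toGPath_bijective
    change Continuous e.symm
    refine continuous_generateFrom_iff.2 ?_
    rintro _ ⟨s, K, V, W, h, rfl⟩
    refine isOpen_iff_mem_nhds.2 fun p hp => ?_
    -- The neighbourhood is built around the representative `t` that witnesses membership; the arcs
    -- of `s` may be different ones.
    obtain ⟨t, ht, hN, hU, hK⟩ := hp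
    have hp' : t.gpath = p := by
      have := congrArg e ht
      rwa [Equiv.apply_symm_apply] at this
    subst hp'
    filter_upwards [exists_system_of_near t (K := K) (V := V) (W := W) fun i hi => by
      rw [hN] at hi
      exact ⟨(h i hi).1, (hK i hi).1, (h i hi).2.2.1, (hK i hi).2.1, (h i hi).2.2.2.2.1,
        (hK i hi).2.2⟩] with p hp
    obtain ⟨r, rfl, hrN, hrU, hrK⟩ := hp
    exact ⟨r, (e.symm_apply_apply (mk r)).symm, hrN.trans hN,
      fun i hi => (hrU i (hN ▸ hi)).trans (hU i hi), fun i hi => hrK i (hN ▸ hi)⟩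

end OrbiLoops

/-! ### Concatenation, equivariant maps and the constant loop -/

namespace LoopSystem

open BasedGlobalOrbispace

variable {A : BasedGlobalOrbispace.{u, v}}

theorem hol_concat_of_le (s t : LoopSystem A) {i : ℕ} (hi : i ≤ s.N) :
    (s.concat t).hol i = s.hol i := by
  induction i with
  | zero => rfl
  | succ i ih =>
    have e : (s.concat t).ρ i = s.ρ i := if_pos hi
    rw [hol, hol, ih (by omega), e]

theorem hol_concat_add (s t : LoopSystem A) (j : ℕ) :
    (s.concat t).hol (s.N + j) = t.hol j * s.hol s.N := by
  induction j with
  | zero => rw [add_zero, hol_concat_of_le s t le_rfl]; simp [hol]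
  | succ j ih =>
    have e : (s.concat t).ρ (s.N + j) = t.ρ j := by
      refine (if_neg (by omega)).trans ?_
      rw [Nat.add_sub_cancel_left]
    rw [← add_assoc, hol, ih, e, hol, mul_assoc]

theorem lift_concat_left (s t : LoopSystem A) {x : ℝ} (h0 : 0 ≤ x) (h1 : x ≤ 1 / 2) :
    (s.concat t).lift x = s.lift (2 * x) := by
  have hN := s.three_le
  have hN' := t.three_le
  obtain ⟨i, hi, hx⟩ := s.arcs.exists_mem_arc_unitInterval ⟨2 * x, by linarith, by linarith⟩
  have hx : s.a i < 2 * x ∧ 2 * x < s.b i := hx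
  have hi : i ≤ s.N := hi
  have key : x ∈ (s.concat t).arc i ∧ (s.concat t).f i x = s.f i (2 * x) := by
    simp only [arc, concat, mem_Ioo]
    rcases Nat.eq_zero_or_pos i with rfl | hi0
    · rw [if_pos rfl, if_pos (by omega), if_pos rfl]
      refine ⟨⟨by linarith [t.a_zero], by linarith⟩, ?_⟩
      split_ifs with h
      -- The half of the regrouped arc that comes from `t` is met at time 0 only, where both maps
      -- take the base value.
      · rw [le_antisymm h h0, mul_zero, s.f_base, t.f_base]
      · rfl
    rcases hi.lt_or_eq with hi' | rfl
    · rw [if_neg hi0.ne', if_pos hi, if_pos hi', if_neg hi0.ne', if_pos hi']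
      exact ⟨⟨by linarith, by linarith⟩, rfl⟩
    · rw [if_neg hi0.ne', if_pos le_rfl, if_neg (lt_irrefl _), if_pos (by omega), if_neg hi0.ne',
        if_neg (lt_irrefl _), if_pos rfl, if_pos h1, Nat.sub_self]
      exact ⟨⟨by linarith, by linarith [t.b_zero]⟩, rfl⟩
  have hi' : i ≤ (s.concat t).N := hi.trans (Nat.le_add_right _ _)
  rw [(s.concat t).lift_eq hi' key.1, s.lift_eq hi hx, key.2, hol_concat_of_le s t hi]

/-- Once `s` has been traversed, all products carry the additional factor `s.hol s.N`; its inverse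
is the translation built into `totalConcatPath`. -/
theorem lift_concat_right (s t : LoopSystem A) {x : ℝ} (h0 : 1 / 2 < x) (h1 : x ≤ 1) :
    (s.concat t).lift x = (s.hol s.N)⁻¹ • t.lift (2 * x - 1) := by
  have hN := s.three_le
  have hN' := t.three_le
  obtain ⟨i, hi, hx⟩ := t.arcs.exists_mem_arc_unitInterval ⟨2 * x - 1, by linarith, by linarith⟩
  have hx : t.a i < 2 * x - 1 ∧ 2 * x - 1 < t.b i := hx
  have hi : i ≤ t.N := hi
  have key : x ∈ (s.concat t).arc (s.N + i) ∧
      (s.concat t).f (s.N + i) x = t.f i (2 * x - 1) := by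
    simp only [arc, concat, mem_Ioo]
    rw [if_neg (by omega : ¬ s.N + i = 0), if_neg (by omega : ¬ s.N + i < s.N),
      if_neg (by omega : ¬ s.N + i = 0), if_neg (by omega : ¬ s.N + i < s.N),
      Nat.add_sub_cancel_left]
    rcases Nat.eq_zero_or_pos i with rfl | hi0
    · have := s.one_mem_arc.1
      rw [if_pos (by omega), if_pos (by omega), if_pos (by omega), if_neg (by linarith), add_zero]
      exact ⟨⟨by linarith, by linarith⟩, rfl⟩
    · rw [if_neg (by omega : ¬ s.N + i ≤ s.N), if_neg (by omega : ¬ s.N + i = s.N)]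
      rcases hi.lt_or_eq with hi' | rfl
      · rw [if_pos (by omega), if_pos (by omega)]
        exact ⟨⟨by linarith, by linarith⟩, rfl⟩
      · rw [if_neg (lt_irrefl _), if_neg (lt_irrefl _), if_pos h1]
        exact ⟨⟨by linarith, by linarith [s.b_zero]⟩, rfl⟩
  have hi' : s.N + i ≤ (s.concat t).N := Nat.add_le_add_left hi _
  rw [(s.concat t).lift_eq hi' key.1, t.lift_eq hi hx, key.2, hol_concat_add, mul_inv_rev, mul_smul]

theorem gpath_concat (s t : LoopSystem A) {z w : A.TotalGPath}
    (hz : toGPath z = s.gpath) (hw : toGPath w = t.gpath) :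
    (s.concat t).gpath = toGPath (totalConcat z w) := by
  have hz2 : z.1.2 = s.hol s.N := congrArg (fun p => p.1.2) hz
  have hw2 : w.1.2 = t.hol t.N := congrArg (fun p => p.1.2) hw
  have hz1 : ∀ x, (z.1.1 x).2 = s.lift x := fun x => congrArg (fun p => p.1.1 x) hz
  have hw1 : ∀ x, (w.1.1 x).2 = t.lift x := fun x => congrArg (fun p => p.1.1 x) hw
  refine gpath_ext ?_ fun x => ?_
  · change (s.concat t).hol (s.N + t.N) = w.1.2 * z.1.2
    rw [hol_concat_add, hz2, hw2]
  · change _ = (totalConcatPath z w x).2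
    simp only [totalConcatPath, ContinuousMap.coe_mk]
    split_ifs with h
    · rw [lift_concat_left s t x.2.1 h, hz1,
        projIcc_of_mem zero_le_one (x := 2 * (x : ℝ)) ⟨by linarith [x.2.1], by linarith⟩]
    · rw [lift_concat_right s t (not_le.1 h) x.2.2]
      change _ = z.1.2⁻¹ • (w.1.1 _).2
      rw [hw1, hz2, projIcc_of_mem zero_le_one (x := 2 * (x : ℝ) - 1)
        ⟨by linarith, by linarith [x.2.2]⟩]

theorem hol_const (i : ℕ) : (const A).hol i = 1 := by
  induction i with
  | zero => rfl
  | succ i ih => rw [hol, ih]; simp [const]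

theorem gpath_const : (const A).gpath = A.gpathBase := by
  refine gpath_ext (hol_const _) fun x => ?_
  obtain ⟨i, hi, hx⟩ := (const A).arcs.exists_mem_arc_unitInterval x
  rw [(const A).lift_eq hi hx, hol_const]
  simp [const, gpathBase]

end LoopSystem

/-! ### Composition with an equivariant map in terms of `G`-paths. -/

namespace EquivariantMap.LocalSystem

variable {A B : BasedGlobalOrbispace.{u, v}} {F : EquivariantMap A B} (R : F.LocalSystem)

/-- The elements `R.h` telescope along the chain, and `R.h` is 1 at the base open set. The remaining
factor cancels against the one in the local map, so the choice of `R` leaves no trace in the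
`G`-path. -/
theorem hol_push (s : LoopSystem A) (i : ℕ) :
    (R.push s).hol i = R.h (s.U i) * F.hom (s.hol i) := by
  induction i with
  | zero => simp [LoopSystem.hol, s.U_zero, R.h_base]
  | succ i ih => rw [LoopSystem.hol, ih]; simp [LoopSystem.hol, push, tran, mul_assoc]

theorem gpath_push (s : LoopSystem A) : (R.push s).gpath = F.gpathMap s.gpath := by
  refine LoopSystem.gpath_ext ?_ fun x => ?_
  · refine (hol_push R s s.N).trans ?_
    rw [s.U_last, R.h_base, one_mul]; rfl
  · obtain ⟨i, hi, hx⟩ := s.arcs.exists_mem_arc_unitInterval x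
    rw [(R.push s).lift_eq hi hx, hol_push]
    change _ = F.map (s.lift x)
    rw [s.lift_eq hi hx, F.map_smul]
    simp [push, mul_smul]

theorem toGPath_loopMap (γ : OrbiLoops A) : (R.loopMap γ).toGPath = F.gpathMap γ.toGPath := by
  obtain ⟨s⟩ := γ
  exact R.gpath_push s

/-- Under the homeomorphisms with the spaces of `G`-paths the map becomes `gpathMap`, whose
continuity is evident. -/
theorem continuous_loopMap : Continuous R.loopMap := by
  have e : R.loopMap =
      (OrbiLoops.gpathHomeo B).symm ∘ F.gpathMap ∘ OrbiLoops.gpathHomeo A := by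
    funext γ
    refine ((OrbiLoops.gpathHomeo B).symm_apply_eq.2 ?_).symm
    exact (R.toGPath_loopMap γ).symm
  rw [e]
  exact (OrbiLoops.gpathHomeo B).symm.continuous.comp
    (F.continuous_gpathMap.comp (OrbiLoops.gpathHomeo A).continuous)

end EquivariantMap.LocalSystem

namespace OrbiLoops

open HomotopyGroup BasedGlobalOrbispace

theorem toGPath_base (A : BasedGlobalOrbispace.{u, v}) : (base A).toGPath = A.gpathBase :=
  LoopSystem.gpath_const

/-- The isomorphism `π_{k+1}(X, o) ≃ π_{k+1}(Y_G)`. -/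
def borelEquiv (k : ℕ) (A : BasedGlobalOrbispace.{u, v}) :
    OrbiPi k A ≃ HomotopyGroup.Pi (k + 1) A.Borel A.borelBase :=
  (Equiv.ofBijective _ (induced_bijective continuous_toGPath (toGPath_base A)
    (gpathHomeo A).isTrivialFibration k)).trans (gpathEquiv k A)

theorem borelEquiv_apply {k : ℕ} {A : BasedGlobalOrbispace.{u, v}} (x : OrbiPi k A) :
    borelEquiv k A x = gpathEquiv k A (induced toGPath continuous_toGPath (toGPath_base A) x) := rfl

theorem borelEquiv_cls {A : BasedGlobalOrbispace.{u, v}} (s : LoopSystem A) :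
    borelEquiv 0 A s.cls = gpathEquiv 0 A (ofPoint _ s.gpath) := rfl

end OrbiLoops

end

theorem theorem3p4p1 :
    ∃ θ : ∀ (k : ℕ) (A : BasedGlobalOrbispace.{u, v}),
        OrbiPi k A ≃ HomotopyGroup.Pi (k + 1) A.Borel A.borelBase,
      -- `θ` is multiplicative on `π_{k+1}(X)` for `k ≥ 1`
      (∀ (k : ℕ) (A : BasedGlobalOrbispace.{u, v}) (x y : OrbiPi (k + 1) A),
        θ (k + 1) A (x * y) = θ (k + 1) A x * θ (k + 1) A y) ∧
      -- `θ` is multiplicative on `π_1(X)`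
      (∀ (A : BasedGlobalOrbispace.{u, v}) (s t : LoopSystem A),
        θ 0 A (s.concat t).cls = HomotopyGroup.seqMul (θ 0 A s.cls) (θ 0 A t.cls)) ∧
      -- `θ` is natural with respect to equivariant maps
      ∀ (A B : BasedGlobalOrbispace.{u, v}) (F : EquivariantMap A B) (R : F.LocalSystem),
        ∃ hR : Continuous R.loopMap, ∀ (k : ℕ) (x : OrbiPi k A),
          θ k B (HomotopyGroup.induced R.loopMap hR R.loopMap_base x) =
            HomotopyGroup.induced F.borelMap F.continuous_borelMap F.borelMap_base (θ k A x) := by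
  refine ⟨OrbiLoops.borelEquiv, fun k A x y => ?_, fun A s t => ?_, fun A B F R =>
    ⟨R.continuous_loopMap, fun k x => ?_⟩⟩
  · simp only [OrbiLoops.borelEquiv_apply]
    refine (congrArg _ (HomotopyGroup.induced_mul _ _ _ _)).trans ?_
    exact BasedGlobalOrbispace.gpathEquiv_mul _ _ _
  -- Lifts of both `G`-paths to `EG × Y` are chosen, since the product on `π_1` is compared through
  -- concatenation there.
  · obtain ⟨z, hz⟩ := BasedGlobalOrbispace.isTrivialFibration_toGPath.surjective s.gpath
    obtain ⟨w, hw⟩ := BasedGlobalOrbispace.isTrivialFibration_toGPath.surjective t.gpath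
    simp only [OrbiLoops.borelEquiv_cls]
    rw [LoopSystem.gpath_concat s t hz hw, ← hz, ← hw]
    exact BasedGlobalOrbispace.gpathEquiv_ofPoint z w
  · rw [OrbiLoops.borelEquiv_apply, OrbiLoops.borelEquiv_apply,
      ← BasedGlobalOrbispace.gpathEquiv_natural]
    congr 1
    induction x using Quotient.inductionOn with | _ p
    exact congrArg (Quotient.mk _) (GenLoop.ext _ _ fun y => R.toGPath_loopMap _)
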